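/- Let $q\in\mathbb{C}$ be a primitive fifth root of unity, and let $B=\mathbb{C}\langle t_0,\dots,t_4\rangle/(t_it_j-q_{ij}t_jt_i,\ \sum_k t_k^5)$ with $$(q_{ij})=\begin{pmatrix}1&q&q^{-1}&q&q^{-1}\\ q^{-1}&1&q&q^{-1}&q\\ q&q^{-1}&1&q&q^{-1}\\ q^{-1}&q&q^{-1}&1&q\\ q&q^{-1}&q&q^{-1}&1\end{pmatrix}.$$ The elements $x_k=t_k^5$ are central. Let $X=\mathrm{Proj}\,\mathbb{C}[x_0,\dots,x_4]/(x_0+\dots+x_4)\cong\mathbb{P}^3$, and let $\mathcal{A}$ be the sheaf of $\mathcal{O}_X$-algebras associated with $\bigoplus_n B_{5n}$ (where $x_k$ has degree one). Everything below is taken in the analytic topology, with $\mathcal{O}$ the sheaf of holomorphic functions. For $0\le i\le 3$ let $X_{(i)}\subset X$ be the set of points with exactly $i+2$ nonzero homogeneous coordinates. Let $Q$ be the quiver with vertices $E_i$ ($i\in\mathbb{Z}/5$) and arrows $a_i,c_i:E_i\to E_{i+3}$, $b_i:E_i\to E_{i+4}$, with potential $W=\mathbf{b}\mathbf{a}\mathbf{c}-q^4\mathbf{b}\mathbf{c}\mathbf{a}$,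 where $\mathbf a=\sum a_i$, $\mathbf c=\sum c_i$, $\mathbf b=q^4b_0+b_1+qb_2+q^2b_3+q^3b_4$ and paths are composed from right to left. The Jacobi algebra $\mathrm{Jac}(Q,W)$ is an algebra over $\mathbb{C}[x,y,z]$ through the central elements $x=u^5$, $y=v^5$, $z=w^5$, where $u=\sum a_i$, $v=\sum b_i$, $w=\sum c_i$. Let $J_{(0)},\dots,J_{(3)}$ be the sheaves of $\mathcal{O}_{\mathbb{C}^3}$-algebras associated with the $\mathbb{C}[x,y,z]$-algebras $$\mathrm{Jac}(Q,W),\qquad M_5(\mathbb{C})\otimes_{\mathbb{C}}\mathbb{C}[x,y,z][v,w]/(v^5-y,\,w^5-z),$$ $$M_5(\mathbb{C})^{\oplus 5}\otimes_{\mathbb{C}}\mathbb{C}[x,y,z][w]/(w^5-z),\qquad M_5(\mathbb{C})^{\oplus 25}\otimes_{\mathbb{C}}\mathbb{C}[x,y,z],$$ that is, $V\mapsto\mathcal{O}(V)\otimes_{\mathbb{C}[x,y,z]}(-)$; these are sheaves, and so is $\mathcal{A}$, with sections over an open $V\subset X$ the degree-zero homogeneous elements of $\mathcal{O}(CV)\otimes_{\mathbb{C}[x_0,\dots,x_4]}B$,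 where $CV\subset\{v\in\mathbb{C}^5\setminus 0:\sum_k v_k=0\}$ is the punctured cone over $V$ and elements of $B$ of degree $5n$ have degree $n$. Then $X=X_{(0)}\sqcup X_{(1)}\sqcup X_{(2)}\sqcup X_{(3)}$ with each $X_{(i)}$ locally closed, and for every $i$ and every $p\in X_{(i)}$ there are an analytic open neighbourhood $U\subset X$ of $p$ and a biholomorphic map $\varphi$ of $U$ onto an open subset of $\mathbb{C}^3$, with $\varphi(p)=0$, such that $$\mathcal{A}|_U\cong J_{(i)}|_U$$ as sheaves of $\mathcal{O}_U$-algebras ($U$ being identified with its image), and such that $\varphi(U\cap X_{(i)})$ is the locus in $\varphi(U)$ where the last $3-i$ of the coordinates $x,y,z$ vanish: the origin for $i=0$, $y=z=0$ for $i=1$, $z=0$ for $i=2$, and all of $\varphi(U)$ for $i=3$. Moreover, for $i=1,2,3$ the $\mathbb{C}[x,y,z]$-algebra defining $J_{(i)}$ is, as a $\mathbb{C}$-algebra, Morita equivalent to $\mathbb{C}[x,y,z]^{\oplus 5^{i-1}}$. -/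

import Mathlib

open CategoryTheory TopologicalSpace Opposite
open scoped TensorProduct

namespace QuantumFermat

/-! ### Holomorphic functions on open subsets of a complex normed space -/

/-- The algebra of holomorphic functions on an open subset `V` of a complex normed space. -/
def holo {E : Type} [NormedAddCommGroup E] [NormedSpace ℂ E] (V : Opens E) :
    Subalgebra ℂ (V → ℂ) where
  carrier := {f | ∃ F : E → ℂ, DifferentiableOn ℂ F V ∧ ∀ x : V, F x = f x}
  mul_mem' := by
    rintro f g ⟨F, hF, hf⟩ ⟨G, hG, hg⟩
    exact ⟨fun x => F x * G x, hF.mul hG, fun x => by simp [hf, hg]⟩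
  add_mem' := by
    rintro f g ⟨F, hF, hf⟩ ⟨G, hG, hg⟩
    exact ⟨fun x => F x + G x, hF.add hG, fun x => by simp [hf, hg]⟩
  algebraMap_mem' c := ⟨fun _ => c, differentiableOn_const c, fun _ => rfl⟩

/-- Restriction of holomorphic functions. -/
def holoRes {E : Type} [NormedAddCommGroup E] [NormedSpace ℂ E] {V₁ V₂ : Opens E}
    (h : V₁ ≤ V₂) : holo V₂ →ₐ[ℂ] holo V₁ where
  toFun f := ⟨fun x => f.1 ⟨x.1, h x.2⟩, by
    obtain ⟨F, hF, hf⟩ := f.2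
    exact ⟨F, hF.mono h, fun x => hf ⟨x.1, h x.2⟩⟩⟩
  map_one' := rfl
  map_mul' _ _ := rfl
  map_zero' := rfl
  map_add' _ _ := rfl
  commutes' _ := rfl

/-! ### Affine three-space and sheaves of algebras on it -/

/-- The polynomial ring `ℂ[x, y, z]`. -/
abbrev P : Type := MvPolynomial (Fin 3) ℂ

/-- The space `ℂ³` with its analytic topology. -/
abbrev C3 : Type := Fin 3 → ℂ

/-- The coordinate functions on an open subset of `ℂ³`. -/
def coordC3 (V : Opens C3) (k : Fin 3) : holo V :=
  ⟨fun x => x.1 k, fun x => x k, by fun_prop, fun _ => rfl⟩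

/-- Polynomials as holomorphic functions on an open subset of `ℂ³`. -/
noncomputable instance (V : Opens C3) : Algebra P (holo V) :=
  (MvPolynomial.aeval (coordC3 V) : P →ₐ[ℂ] holo V).toAlgebra

theorem algebraMap_C3 (V : Opens C3) (k : Fin 3) :
    algebraMap P (holo V) (MvPolynomial.X k) = coordC3 V k :=
  MvPolynomial.aeval_X _ _

/-- Restriction is linear over polynomials. -/
noncomputable def holoResC3 {V₁ V₂ : Opens C3} (h : V₁ ≤ V₂) : holo V₂ →ₐ[P] holo V₁ where
  toRingHom := (holoRes h).toRingHom
  commutes' p := by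
    have : (holoRes h).comp (MvPolynomial.aeval (coordC3 V₂) : P →ₐ[ℂ] holo V₂) =
        MvPolynomial.aeval (coordC3 V₁) := by
      ext k : 1
      simp only [AlgHom.comp_apply, MvPolynomial.aeval_X]
      rfl
    exact DFunLike.congr_fun this p

/-- The structure sheaf of `ℂ³` (holomorphic functions). -/
noncomputable def sheafOC3 : TopCat.Presheaf RingCat.{0} (TopCat.of C3) where
  obj V := RingCat.of (holo (E := C3) V.unop)
  map i := RingCat.ofHom (holoRes (leOfHom i.unop)).toRingHom
  map_id _ := rfl
  map_comp _ _ := rfl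

/-- The analytic sheaf of algebras on `ℂ³` associated with a (finite free) algebra `D` over
`ℂ[x, y, z]`: its sections on `V` are `𝒪(V) ⊗ D`, the tensor product being over `ℂ[x, y, z]`.
No sheafification is needed because `D` is free of finite rank. -/
noncomputable def assocSheaf (D : AlgCat.{0} P) :
    TopCat.Presheaf RingCat.{0} (TopCat.of C3) where
  obj V := RingCat.of (holo (E := C3) V.unop ⊗[P] D)
  map i := RingCat.ofHom
    (Algebra.TensorProduct.map (holoResC3 (leOfHom i.unop)) (AlgHom.id P D)).toRingHom
  map_id V := by
    refine RingCat.hom_ext (RingHom.ext fun x => ?_)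
    exact DFunLike.congr_fun (Algebra.TensorProduct.map_id (R := P) (S := P)
      (A := holo (E := C3) V.unop) (B := D)) x
  map_comp {V₁ V₂ V₃} i j := by
    refine RingCat.hom_ext (RingHom.ext fun x => ?_)
    exact DFunLike.congr_fun (Algebra.TensorProduct.map_comp (R := P) (S := P)
      (holoResC3 (leOfHom j.unop)) (holoResC3 (leOfHom i.unop))
      (AlgHom.id P D) (AlgHom.id P D)) x

/-- The structure morphism `f ↦ f ⊗ 1` of an associated sheaf of algebras. -/
noncomputable def assocUnit (D : AlgCat.{0} P) : sheafOC3 ⟶ assocSheaf D where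
  app V := RingCat.ofHom (Algebra.TensorProduct.includeLeftRingHom
    (R := P) (A := holo (E := C3) V.unop) (B := D))
  naturality {V₁ V₂} i := by
    ext x
    exact (congrArg (fun d : D => (holoResC3 (leOfHom i.unop) x) ⊗ₜ[P] d)
      (map_one (AlgHom.id P D))).symm

/-! ### Quivers with potential and their Jacobi algebras -/

/-- A finite quiver, with its sets of vertices and arrows and its source and target maps. -/
structure FiniteQuiver where
  Vertex : Type
  Arrow : Type
  [fintypeVertex : Fintype Vertex]
  [decEqArrow : DecidableEq Arrow]
  src : Arrow → Vertex
  tgt : Arrow → Vertex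

attribute [instance] FiniteQuiver.fintypeVertex FiniteQuiver.decEqArrow

namespace FiniteQuiver

variable (Q : FiniteQuiver)

/-- The defining relations of the path algebra, on generators `e_i` (vertices) and `a` (arrows).
Paths compose like functions, from right to left, so that left modules over the path algebra
are representations of the quiver. -/
inductive PathRel : FreeAlgebra ℂ (Q.Vertex ⊕ Q.Arrow) → FreeAlgebra ℂ (Q.Vertex ⊕ Q.Arrow) → Prop
  | idem (i : Q.Vertex) : PathRel
      (FreeAlgebra.ι ℂ (Sum.inl i) * FreeAlgebra.ι ℂ (Sum.inl i)) (FreeAlgebra.ι ℂ (Sum.inl i))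
  | orth (i j : Q.Vertex) (h : i ≠ j) : PathRel
      (FreeAlgebra.ι ℂ (Sum.inl i) * FreeAlgebra.ι ℂ (Sum.inl j)) 0
  | unit : PathRel (∑ i : Q.Vertex, FreeAlgebra.ι ℂ (Sum.inl i)) 1
  | tgt (a : Q.Arrow) : PathRel
      (FreeAlgebra.ι ℂ (Sum.inl (Q.tgt a)) * FreeAlgebra.ι ℂ (Sum.inr a))
      (FreeAlgebra.ι ℂ (Sum.inr a))
  | src (a : Q.Arrow) : PathRel
      (FreeAlgebra.ι ℂ (Sum.inr a) * FreeAlgebra.ι ℂ (Sum.inl (Q.src a)))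
      (FreeAlgebra.ι ℂ (Sum.inr a))

/-- The path algebra `ℂQ`. -/
abbrev PathAlgebra : Type := RingQuot Q.PathRel

/-- The idempotent of a vertex. -/
noncomputable def vertex (i : Q.Vertex) : Q.PathAlgebra :=
  RingQuot.mkAlgHom ℂ Q.PathRel (FreeAlgebra.ι ℂ (Sum.inl i))

/-- An arrow as an element of the path algebra. -/
noncomputable def arrow (a : Q.Arrow) : Q.PathAlgebra :=
  RingQuot.mkAlgHom ℂ Q.PathRel (FreeAlgebra.ι ℂ (Sum.inr a))

/-- A potential: a linear combination of cyclic paths. The list `[a₁, …, aₙ]` stands for the path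
`a₁ ⋯ aₙ`, in which `aₙ` is traversed first. -/
abbrev Potential : Type := List Q.Arrow →₀ ℂ

/-- The cyclic derivative of a cyclic path: the sum, over the occurrences `aᵢ = a`, of
`aᵢ₊₁ ⋯ aₙ a₁ ⋯ aᵢ₋₁`. -/
noncomputable def pathDeriv (a : Q.Arrow) (w : List Q.Arrow) : Q.PathAlgebra :=
  ∑ i : Fin w.length,
    if w.get i = a then ((w.drop (i + 1) ++ w.take i).map Q.arrow).prod else 0

/-- The cyclic derivative `∂_a W` of a potential. -/
noncomputable def cyclicDeriv (a : Q.Arrow) (W : Q.Potential) : Q.PathAlgebra :=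
  Finsupp.linearCombination ℂ (Q.pathDeriv a) W

/-- The relations `∂_a W = 0`. -/
inductive JacRel (W : Q.Potential) : Q.PathAlgebra → Q.PathAlgebra → Prop
  | deriv (a : Q.Arrow) : JacRel W (Q.cyclicDeriv a W) 0

/-- The Jacobi algebra `Jac(Q, W)`. -/
abbrev Jac (W : Q.Potential) : Type := RingQuot (Q.JacRel W)

/-- The quotient map `ℂQ → Jac(Q, W)`. -/
noncomputable def toJac (W : Q.Potential) : Q.PathAlgebra →ₐ[ℂ] Q.Jac W :=
  RingQuot.mkAlgHom ℂ (Q.JacRel W)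

end FiniteQuiver

/-! ### The quiver with potential of the generic quantum Fermat quintic threefold -/

/-- The arrows `a_i`, `b_i`, `c_i`, for `i ∈ ℤ/5`. -/
inductive Arr : Type
  | a (i : ZMod 5)
  | b (i : ZMod 5)
  | c (i : ZMod 5)
  deriving DecidableEq

/-- The quiver with five vertices `E_i`, `i ∈ ℤ/5`, and arrows `a_i, c_i : E_i → E_{i+3}` and
`b_i : E_i → E_{i+4}`. -/
abbrev quiver : FiniteQuiver where
  Vertex := ZMod 5
  Arrow := Arr
  src
    | .a i => i
    | .b i => i
    | .c i => i
  tgt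
    | .a i => i + 3
    | .b i => i + 4
    | .c i => i + 3

/-- The potential `W = 𝐛𝐚𝐜 - q⁴ 𝐛𝐜𝐚`, where `𝐚 = ∑ a_i`, `𝐜 = ∑ c_i` and
`𝐛 = q⁴ b_0 + b_1 + q b_2 + q² b_3 + q³ b_4 = ∑ q^(i-1) b_i`. It is written as a combination
of the paths that survive in `𝐛𝐚𝐜` and `𝐛𝐜𝐚`, namely `b_{i+1} a_{i+3} c_i` and
`b_{i+1} c_{i+3} a_i`. -/
noncomputable def potential (q : ℂ) : quiver.Potential :=
  ∑ i : ZMod 5, (Finsupp.single [Arr.b (i + 1), Arr.a (i + 3), Arr.c i] (q ^ i.val)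
    - Finsupp.single [Arr.b (i + 1), Arr.c (i + 3), Arr.a i] (q ^ 4 * q ^ i.val))

/-- The Jacobi algebra `Jac(Q, W)`. -/
def JacQW (q : ℂ) : Type := quiver.Jac (potential q)

noncomputable instance (q : ℂ) : Ring (JacQW q) :=
  inferInstanceAs (Ring (quiver.Jac (potential q)))
noncomputable instance (q : ℂ) : Algebra ℂ (JacQW q) :=
  inferInstanceAs (Algebra ℂ (quiver.Jac (potential q)))

section Jacobi

variable (q : ℂ)

/-- The class of an element of the path algebra in `Jac(Q, W)`. -/
noncomputable def toJacQW : quiver.PathAlgebra →ₐ[ℂ] JacQW q := quiver.toJac (potential q)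

/-- The images of the idempotents and arrows in `Jac(Q, W)`. -/
noncomputable def jE (i : ZMod 5) : JacQW q := toJacQW q (quiver.vertex i)
noncomputable def jA (i : ZMod 5) : JacQW q := toJacQW q (quiver.arrow (Arr.a i))
noncomputable def jB (i : ZMod 5) : JacQW q := toJacQW q (quiver.arrow (Arr.b i))
noncomputable def jC (i : ZMod 5) : JacQW q := toJacQW q (quiver.arrow (Arr.c i))

/-- The elements `u = ∑ a_i`, `v = ∑ b_i`, `w = ∑ c_i` of `Jac(Q, W)`. -/
noncomputable def jU : JacQW q := ∑ i, jA q i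
noncomputable def jV : JacQW q := ∑ i, jB q i
noncomputable def jW : JacQW q := ∑ i, jC q i


theorem jE_mul_self (i : ZMod 5) : jE q i * jE q i = jE q i := by
  simp only [jE, FiniteQuiver.vertex, ← map_mul]
  rw [RingQuot.mkAlgHom_rel ℂ (FiniteQuiver.PathRel.idem (Q := quiver) i)]

theorem jE_mul_ne {i j : ZMod 5} (h : i ≠ j) : jE q i * jE q j = 0 := by
  simp only [jE, FiniteQuiver.vertex, ← map_mul]
  rw [RingQuot.mkAlgHom_rel ℂ (FiniteQuiver.PathRel.orth (Q := quiver) i j h), map_zero, map_zero]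

theorem sum_jE : ∑ i, jE q i = 1 := by
  have h := RingQuot.mkAlgHom_rel ℂ (FiniteQuiver.PathRel.unit (Q := quiver))
  have h' := congrArg (toJacQW q) h
  simp only [map_sum, map_one] at h'
  exact h'

theorem tgt_mul (x : Arr) : jE q (quiver.tgt x) * toJacQW q (quiver.arrow x) =
    toJacQW q (quiver.arrow x) := by
  simp only [jE, FiniteQuiver.vertex, FiniteQuiver.arrow, ← map_mul]
  rw [RingQuot.mkAlgHom_rel ℂ (FiniteQuiver.PathRel.tgt (Q := quiver) x)]

theorem mul_src (x : Arr) : toJacQW q (quiver.arrow x) * jE q (quiver.src x) =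
    toJacQW q (quiver.arrow x) := by
  simp only [jE, FiniteQuiver.vertex, FiniteQuiver.arrow, ← map_mul]
  rw [RingQuot.mkAlgHom_rel ℂ (FiniteQuiver.PathRel.src (Q := quiver) x)]

theorem jac_rel (x : Arr) : toJacQW q (quiver.cyclicDeriv x (potential q)) = 0 := by
  have h := RingQuot.mkAlgHom_rel ℂ (FiniteQuiver.JacRel.deriv (Q := quiver) (W := potential q) x)
  rw [map_zero] at h
  exact h

/-- The image of an arrow in `Jac(Q, W)`. -/
noncomputable def jArr (x : Arr) : JacQW q := toJacQW q (quiver.arrow x)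

theorem toJac_pathDeriv (x y₁ y₂ y₃ : Arr) :
    toJacQW q (quiver.pathDeriv x [y₁, y₂, y₃]) =
      (if y₁ = x then jArr q y₂ * jArr q y₃ else 0) +
      (if y₂ = x then jArr q y₃ * jArr q y₁ else 0) +
      (if y₃ = x then jArr q y₁ * jArr q y₂ else 0) := by
  have h3 : quiver.pathDeriv x [y₁, y₂, y₃] =
      (if y₁ = x then quiver.arrow y₂ * quiver.arrow y₃ else 0) +
      (if y₂ = x then quiver.arrow y₃ * quiver.arrow y₁ else 0) +
      (if y₃ = x then quiver.arrow y₁ * quiver.arrow y₂ else 0) := by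
    simp [FiniteQuiver.pathDeriv, Fin.sum_univ_succ, add_assoc]
  rw [h3]
  simp only [map_add, apply_ite (toJacQW q), map_mul, map_zero]
  rfl

/-- The value of `∂_x (y₁ y₂ y₃)` in `Jac(Q, W)`. -/
noncomputable def jDeriv (x y₁ y₂ y₃ : Arr) : JacQW q :=
  (if y₁ = x then jArr q y₂ * jArr q y₃ else 0) +
  (if y₂ = x then jArr q y₃ * jArr q y₁ else 0) +
  (if y₃ = x then jArr q y₁ * jArr q y₂ else 0)

theorem jac_rel' (x : Arr) : ∑ i : ZMod 5,
    (q ^ i.val • jDeriv q x (Arr.b (i + 1)) (Arr.a (i + 3)) (Arr.c i) -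
    (q ^ 4 * q ^ i.val) • jDeriv q x (Arr.b (i + 1)) (Arr.c (i + 3)) (Arr.a i)) = 0 := by
  have h := jac_rel q x
  simp only [FiniteQuiver.cyclicDeriv, potential, map_sum, map_sub,
    Finsupp.linearCombination_single, map_smul] at h
  rw [← h]
  refine Finset.sum_congr rfl fun i _ => ?_
  rw [toJac_pathDeriv, toJac_pathDeriv]
  rfl

end Jacobi

theorem prim_pow (q : ℂ) [hq : Fact (IsPrimitiveRoot q 5)] : q ^ 5 = 1 := hq.out.pow_eq_one

theorem prim_ne_zero (q : ℂ) [hq : Fact (IsPrimitiveRoot q 5)] : q ≠ 0 :=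
  hq.out.ne_zero (by norm_num)

theorem prim_pow_val (q : ℂ) [Fact (IsPrimitiveRoot q 5)] (k : ZMod 5) :
    q ^ (k + 2).val = q ^ k.val * q ^ 2 := by
  have h2 : (2 : ZMod 5).val = 2 := rfl
  rw [ZMod.val_add, h2, ← pow_add, ← pow_eq_pow_mod _ (prim_pow q)]

section JacobiCentral

variable (q : ℂ)

theorem sum_mul_sum_shift {X Y : ZMod 5 → JacQW q} (s : ZMod 5)
    (hX : ∀ i, X i * jE q i = X i) (hY : ∀ i, jE q (i + s) * Y i = Y i) :
    (∑ i, X i) * (∑ i, Y i) = ∑ i, X (i + s) * Y i := by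
  rw [Finset.mul_sum]
  refine Finset.sum_congr rfl fun j _ => ?_
  rw [Finset.sum_mul, Finset.sum_eq_single (j + s)]
  · intro i _ hi
    rw [← hX i, ← hY j, mul_assoc, ← mul_assoc (jE q i), jE_mul_ne q hi, zero_mul, mul_zero]
  · simp

theorem jA_src (i : ZMod 5) : jA q i * jE q i = jA q i := mul_src q (Arr.a i)
theorem jB_src (i : ZMod 5) : jB q i * jE q i = jB q i := mul_src q (Arr.b i)
theorem jC_src (i : ZMod 5) : jC q i * jE q i = jC q i := mul_src q (Arr.c i)
theorem jA_tgt (i : ZMod 5) : jE q (i + 3) * jA q i = jA q i := tgt_mul q (Arr.a i)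
theorem jB_tgt (i : ZMod 5) : jE q (i + 4) * jB q i = jB q i := tgt_mul q (Arr.b i)
theorem jC_tgt (i : ZMod 5) : jE q (i + 3) * jC q i = jC q i := tgt_mul q (Arr.c i)

theorem sum_mul_jE {X : ZMod 5 → JacQW q} (hX : ∀ i, X i * jE q i = X i) (j : ZMod 5) :
    (∑ i, X i) * jE q j = X j := by
  rw [Finset.sum_mul, Finset.sum_eq_single j, hX]
  · intro i _ hi
    rw [← hX i, mul_assoc, jE_mul_ne q hi, mul_zero]
  · simp

theorem jE_mul_sum {X : ZMod 5 → JacQW q} (s : ZMod 5) (hX : ∀ i, jE q (i + s) * X i = X i)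
    (j : ZMod 5) : jE q (j + s) * (∑ i, X i) = X j := by
  rw [Finset.mul_sum, Finset.sum_eq_single j, hX]
  · intro i _ hi
    rw [← hX i, ← mul_assoc, jE_mul_ne q (fun h => hi (add_right_cancel h).symm), zero_mul]
  · simp

theorem shift_iff (i k : ZMod 5) : i + 3 = k ↔ i = k + 2 := by
  revert i k; decide

variable [Fact (IsPrimitiveRoot q 5)]

theorem rel_b (k : ZMod 5) : jA q (k + 3) * jC q k = q ^ 4 • (jC q (k + 3) * jA q k) := by
  have h := jac_rel' q (Arr.b (k + 1))
  simp only [jDeriv, Arr.b.injEq, add_left_inj, reduceCtorEq, if_false, add_zero,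
    smul_ite, smul_zero, Finset.sum_sub_distrib, Finset.sum_ite_eq', Finset.mem_univ,
    if_true] at h
  rw [mul_comm (q ^ 4), mul_smul, ← smul_sub, smul_eq_zero] at h
  exact sub_eq_zero.mp (h.resolve_left (pow_ne_zero _ (prim_ne_zero q)))

theorem rel_c (k : ZMod 5) : jB q (k + 1) * jA q (k + 3) =
    q • (jA q (k + 2) * jB q (k + 3)) := by
  have h := jac_rel' q (Arr.c k)
  simp only [jDeriv, Arr.c.injEq, shift_iff, reduceCtorEq, if_false, add_zero, zero_add,
    smul_ite, smul_zero, Finset.sum_sub_distrib, Finset.sum_ite_eq', Finset.mem_univ,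
    if_true, prim_pow_val] at h
  have e : q ^ 4 * (q ^ k.val * q ^ 2) = q ^ k.val * q := by
    linear_combination q ^ k.val * q * prim_pow q
  have e2 : k + 2 + 1 = k + 3 := by ring
  rw [e, e2, mul_smul, ← smul_sub, smul_eq_zero] at h
  exact sub_eq_zero.mp (h.resolve_left (pow_ne_zero _ (prim_ne_zero q)))

theorem rel_a (k : ZMod 5) : jC q (k + 2) * jB q (k + 3) =
    q ^ 2 • (jB q (k + 1) * jC q (k + 3)) := by
  have h := jac_rel' q (Arr.a k)
  simp only [jDeriv, Arr.a.injEq, shift_iff, reduceCtorEq, if_false, add_zero, zero_add,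
    smul_ite, smul_zero, Finset.sum_sub_distrib, Finset.sum_ite_eq', Finset.mem_univ,
    if_true, prim_pow_val] at h
  have e : q ^ 4 * q ^ k.val = (q ^ k.val * q ^ 2) * q ^ 2 := by ring
  have e2 : k + 2 + 1 = k + 3 := by ring
  rw [e, e2, mul_smul (q ^ k.val * q ^ 2) (q ^ 2), ← smul_sub, smul_eq_zero] at h
  exact sub_eq_zero.mp (h.resolve_left (mul_ne_zero (pow_ne_zero _ (prim_ne_zero q))
    (pow_ne_zero _ (prim_ne_zero q))))

theorem jU_mul_jW : jU q * jW q = q ^ 4 • (jW q * jU q) := by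
  unfold jU jW
  rw [sum_mul_sum_shift q 3 (jA_src q) (jC_tgt q), sum_mul_sum_shift q 3 (jC_src q) (jA_tgt q),
    Finset.smul_sum]
  exact Finset.sum_congr rfl fun k _ => rel_b q k

theorem jV_mul_jU : jV q * jU q = q • (jU q * jV q) := by
  unfold jU jV
  rw [sum_mul_sum_shift q 3 (jB_src q) (jA_tgt q), sum_mul_sum_shift q 4 (jA_src q) (jB_tgt q),
    Finset.smul_sum, ← Equiv.sum_comp (Equiv.addRight (3 : ZMod 5)),
    ← Equiv.sum_comp (Equiv.addRight (3 : ZMod 5)) (fun i => q • (jA q (i + 4) * jB q i))]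
  refine Finset.sum_congr rfl fun k _ => ?_
  have e1 : k + 3 + 3 = k + 1 := by revert k; decide
  have e2 : k + 3 + 4 = k + 2 := by revert k; decide
  simp only [Equiv.coe_addRight, e1, e2]
  exact rel_c q k

theorem jW_mul_jV : jW q * jV q = q ^ 2 • (jV q * jW q) := by
  unfold jW jV
  rw [sum_mul_sum_shift q 4 (jC_src q) (jB_tgt q), sum_mul_sum_shift q 3 (jB_src q) (jC_tgt q),
    Finset.smul_sum, ← Equiv.sum_comp (Equiv.addRight (3 : ZMod 5)),
    ← Equiv.sum_comp (Equiv.addRight (3 : ZMod 5)) (fun i => q ^ 2 • (jB q (i + 3) * jC q i))]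
  refine Finset.sum_congr rfl fun k _ => ?_
  have e1 : k + 3 + 3 = k + 1 := by revert k; decide
  have e2 : k + 3 + 4 = k + 2 := by revert k; decide
  simp only [Equiv.coe_addRight, e1, e2]
  exact rel_a q k

end JacobiCentral

/-- If `x y = c y x` with `c ^ 5 = 1`, then `x ^ 5` commutes with `y` and `y ^ 5` with `x`. -/
theorem pow_five_comm {R : Type} [Ring R] [Algebra ℂ R] {x y : R} {c : ℂ} (hc : c ^ 5 = 1)
    (h : x * y = c • (y * x)) : Commute (x ^ 5) y ∧ Commute (y ^ 5) x := by
  have h1 : ∀ n : ℕ, x ^ n * y = c ^ n • (y * x ^ n) := by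
    intro n
    induction n with
    | zero => simp
    | succ n ih =>
      rw [pow_succ, mul_assoc, h, mul_smul_comm, ← mul_assoc, ih, smul_mul_assoc, smul_smul,
        mul_assoc, ← pow_succ, ← pow_succ']
  have h2 : ∀ n : ℕ, x * y ^ n = c ^ n • (y ^ n * x) := by
    intro n
    induction n with
    | zero => simp
    | succ n ih =>
      rw [pow_succ, ← mul_assoc, ih, smul_mul_assoc, mul_assoc, h, mul_smul_comm, smul_smul,
        ← mul_assoc, ← pow_succ, ← pow_succ]
  constructor
  · have := h1 5
    rwa [hc, one_smul] at this
  · have := h2 5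
    rw [hc, one_smul] at this
    exact this.symm

section JacobiCenter

variable (q : ℂ)

theorem jac_induction (S : Subalgebra ℂ (JacQW q)) (hE : ∀ i, jE q i ∈ S) (hA : ∀ i, jA q i ∈ S)
    (hB : ∀ i, jB q i ∈ S) (hC : ∀ i, jC q i ∈ S) (z : JacQW q) : z ∈ S := by
  obtain ⟨y, rfl⟩ : ∃ y, toJacQW q y = z := RingQuot.mkAlgHom_surjective ℂ _ z
  obtain ⟨x, rfl⟩ := RingQuot.mkAlgHom_surjective ℂ (FiniteQuiver.PathRel quiver) y
  induction x using FreeAlgebra.induction with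
  | grade0 r =>
    rw [AlgHom.commutes, AlgHom.commutes]
    exact S.algebraMap_mem r
  | grade1 x =>
    rcases x with i | (i | i | i)
    · exact hE i
    · exact hA i
    · exact hB i
    · exact hC i
  | mul a b ha hb => rw [map_mul, map_mul]; exact S.mul_mem ha hb
  | add a b ha hb => rw [map_add, map_add]; exact S.add_mem ha hb

/-- An element of `Jac(Q, W)` is central if it commutes with the idempotents and `u, v, w`. -/
theorem jac_central (z : JacQW q) (hE : ∀ i, Commute z (jE q i)) (hU : Commute z (jU q))
    (hV : Commute z (jV q)) (hW : Commute z (jW q)) : z ∈ Subalgebra.center ℂ (JacQW q) := by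
  rw [Subalgebra.mem_center_iff]
  intro b
  have hb : b ∈ Subalgebra.centralizer ℂ {z} := by
    refine jac_induction q _ (fun i => ?_) (fun i => ?_) (fun i => ?_) (fun i => ?_) b <;>
      rw [Subalgebra.mem_centralizer_iff] <;> rintro _ rfl
    · exact hE i
    · rw [← sum_mul_jE q (jA_src q) i]; exact hU.mul_right (hE i)
    · rw [← sum_mul_jE q (jB_src q) i]; exact hV.mul_right (hE i)
    · rw [← sum_mul_jE q (jC_src q) i]; exact hW.mul_right (hE i)
  exact (Subalgebra.mem_centralizer_iff ℂ |>.mp hb z rfl).symm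

theorem pow_five_jE (z : JacQW q) (s : ZMod 5) (h : ∀ i, jE q (i + s) * z = z * jE q i)
    (i : ZMod 5) : Commute (z ^ 5) (jE q i) := by
  have h1 : ∀ (n : ℕ) (i : ZMod 5), jE q (i + n * s) * z ^ n = z ^ n * jE q i := by
    intro n
    induction n with
    | zero => intro i; simp
    | succ n ih =>
      intro i
      have e : i + ((n + 1 : ℕ) : ZMod 5) * s = (i + s) + n * s := by push_cast; ring
      rw [e, pow_succ, ← mul_assoc, ih, mul_assoc, h, mul_assoc]
  have h5 := h1 5 i
  have e : ((5 : ℕ) : ZMod 5) = 0 := rfl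
  rw [e, zero_mul, add_zero] at h5
  exact h5.symm

variable [Fact (IsPrimitiveRoot q 5)]

theorem jU_pow_central : jU q ^ 5 ∈ Subalgebra.center ℂ (JacQW q) := by
  have h5 := prim_pow q
  have h4 : (q ^ 4) ^ 5 = 1 := by rw [← pow_mul, mul_comm, pow_mul, h5, one_pow]
  exact jac_central q _ (pow_five_jE q _ 3 fun i =>
      (jE_mul_sum q 3 (jA_tgt q) i).trans (sum_mul_jE q (jA_src q) i).symm)
    (Commute.pow_self _ _) (pow_five_comm h5 (jV_mul_jU q)).2 (pow_five_comm h4 (jU_mul_jW q)).1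

theorem jV_pow_central : jV q ^ 5 ∈ Subalgebra.center ℂ (JacQW q) := by
  have h5 := prim_pow q
  have h2 : (q ^ 2) ^ 5 = 1 := by rw [← pow_mul, mul_comm, pow_mul, h5, one_pow]
  exact jac_central q _ (pow_five_jE q _ 4 fun i =>
      (jE_mul_sum q 4 (jB_tgt q) i).trans (sum_mul_jE q (jB_src q) i).symm)
    (pow_five_comm h5 (jV_mul_jU q)).1 (Commute.pow_self _ _) (pow_five_comm h2 (jW_mul_jV q)).2

theorem jW_pow_central : jW q ^ 5 ∈ Subalgebra.center ℂ (JacQW q) := by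
  have h5 := prim_pow q
  have h4 : (q ^ 4) ^ 5 = 1 := by rw [← pow_mul, mul_comm, pow_mul, h5, one_pow]
  have h2 : (q ^ 2) ^ 5 = 1 := by rw [← pow_mul, mul_comm, pow_mul, h5, one_pow]
  exact jac_central q _ (pow_five_jE q _ 3 fun i =>
      (jE_mul_sum q 3 (jC_tgt q) i).trans (sum_mul_jE q (jC_src q) i).symm)
    (pow_five_comm h4 (jU_mul_jW q)).2 (pow_five_comm h2 (jW_mul_jV q)).1 (Commute.pow_self _ _)

/-- The map `ℂ[x, y, z] → Z(Jac(Q, W))` with `x ↦ u⁵`, `y ↦ v⁵`, `z ↦ w⁵`. -/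
noncomputable def jacStructure : P →ₐ[ℂ] Subalgebra.center ℂ (JacQW q) :=
  MvPolynomial.aeval ![⟨jU q ^ 5, jU_pow_central q⟩, ⟨jV q ^ 5, jV_pow_central q⟩,
    ⟨jW q ^ 5, jW_pow_central q⟩]

/-- `Jac(Q, W)` as an algebra over `ℂ[x, y, z]`. -/
noncomputable instance : Algebra P (JacQW q) :=
  ((Subalgebra.center ℂ (JacQW q)).val.toRingHom.comp (jacStructure q).toRingHom).toAlgebra'
    fun p x => ((Subalgebra.mem_center_iff.mp (jacStructure q p).2) x).symm

end JacobiCenter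

/-! ### The local models `J_(0), …, J_(3)` -/

/-- The ring `ℂ[x, y, z][v, w] / (v⁵ - y, w⁵ - z)`. -/
abbrev Cover1 : Type :=
  MvPolynomial (Fin 2) P ⧸ Ideal.span
    ({MvPolynomial.X 0 ^ 5 - MvPolynomial.C (MvPolynomial.X 1),
      MvPolynomial.X 1 ^ 5 - MvPolynomial.C (MvPolynomial.X 2)} : Set (MvPolynomial (Fin 2) P))

/-- The ring `ℂ[x, y, z][w] / (w⁵ - z)`. -/
abbrev Cover2 : Type :=
  AdjoinRoot (Polynomial.X ^ 5 - Polynomial.C (MvPolynomial.X 2 : P))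

/-- The matrix algebra `M₅(ℂ)`. -/
abbrev M5 : Type := Matrix (Fin 5) (Fin 5) ℂ

/-- `M₅(ℂ) ⊗ ℂ[x, y, z][v, w] / (v⁵ - y, w⁵ - z)`. -/
abbrev J1 : Type := Cover1 ⊗[ℂ] M5

/-- `M₅(ℂ)^{⊕5} ⊗ ℂ[x, y, z][w] / (w⁵ - z)`. -/
abbrev J2 : Type := Cover2 ⊗[ℂ] (Fin 5 → M5)

/-- `M₅(ℂ)^{⊕25} ⊗ ℂ[x, y, z]`. -/
abbrev J3 : Type := P ⊗[ℂ] (Fin 25 → M5)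

/-- The four local models, as algebras over `ℂ[x, y, z]`. -/
noncomputable def localModel (q : ℂ) [Fact (IsPrimitiveRoot q 5)] : Fin 4 → AlgCat.{0} P
  | 0 => AlgCat.of P (JacQW q)
  | 1 => AlgCat.of P J1
  | 2 => AlgCat.of P J2
  | 3 => AlgCat.of P J3

/-- The sheaves of algebras `J_(i)` on `ℂ³`. -/
noncomputable def sheafJ (q : ℂ) [Fact (IsPrimitiveRoot q 5)] (i : Fin 4) :
    TopCat.Presheaf RingCat.{0} (TopCat.of C3) :=
  assocSheaf (localModel q i)

/-! ### The graded algebra of the generic quantum Fermat quintic threefold -/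

/-- The quantum parameters `q_{ij}`. -/
noncomputable def qParam (q : ℂ) : Matrix (Fin 5) (Fin 5) ℂ :=
  !![1, q, q⁻¹, q, q⁻¹;
     q⁻¹, 1, q, q⁻¹, q;
     q, q⁻¹, 1, q, q⁻¹;
     q⁻¹, q, q⁻¹, 1, q;
     q, q⁻¹, q, q⁻¹, 1]

/-- The relations `t_i t_j = q_{ij} t_j t_i` and `∑ t_k⁵ = 0`. -/
inductive FermatRel (q : ℂ) : FreeAlgebra ℂ (Fin 5) → FreeAlgebra ℂ (Fin 5) → Prop
  | comm (i j : Fin 5) : FermatRel q (FreeAlgebra.ι ℂ i * FreeAlgebra.ι ℂ j)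
      (qParam q i j • (FreeAlgebra.ι ℂ j * FreeAlgebra.ι ℂ i))
  | fermat : FermatRel q (∑ k, FreeAlgebra.ι ℂ k ^ 5) 0

/-- The algebra `ℂ⟨t_0, …, t_4⟩_{(q_ij)} / (∑ t_k⁵)`. -/
def FermatAlg (q : ℂ) : Type := RingQuot (FermatRel q)

noncomputable instance (q : ℂ) : Ring (FermatAlg q) :=
  inferInstanceAs (Ring (RingQuot (FermatRel q)))
noncomputable instance (q : ℂ) : Algebra ℂ (FermatAlg q) :=
  inferInstanceAs (Algebra ℂ (RingQuot (FermatRel q)))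

/-- The quotient map from the free algebra. -/
noncomputable def toFermat (q : ℂ) : FreeAlgebra ℂ (Fin 5) →ₐ[ℂ] FermatAlg q :=
  RingQuot.mkAlgHom ℂ (FermatRel q)

/-- The generators `t_k`. -/
noncomputable def gen (q : ℂ) (k : Fin 5) : FermatAlg q := toFermat q (FreeAlgebra.ι ℂ k)

/-- The homogeneous part of degree `n`, spanned by the products of `n` generators. -/
noncomputable def degreePart (q : ℂ) (n : ℕ) : Submodule ℂ (FermatAlg q) :=
  Submodule.span ℂ (Set.range (gen q)) ^ n

theorem gen_comm (q : ℂ) (i j : Fin 5) :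
    gen q i * gen q j = qParam q i j • (gen q j * gen q i) := by
  have h := RingQuot.mkAlgHom_rel ℂ (FermatRel.comm (q := q) i j)
  simp only [map_mul, map_smul] at h
  exact h

theorem qParam_pow (q : ℂ) [Fact (IsPrimitiveRoot q 5)] (i j : Fin 5) :
    qParam q i j ^ 5 = 1 := by
  have h5 := prim_pow q
  fin_cases i <;> fin_cases j <;> simp [qParam, h5]

theorem gen_pow_central (q : ℂ) [Fact (IsPrimitiveRoot q 5)] (k : Fin 5) :
    gen q k ^ 5 ∈ Subalgebra.center ℂ (FermatAlg q) := by
  rw [Subalgebra.mem_center_iff]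
  intro b
  obtain ⟨x, rfl⟩ : ∃ x, toFermat q x = b := RingQuot.mkAlgHom_surjective ℂ _ b
  change Commute _ _
  induction x using FreeAlgebra.induction with
  | grade0 r => rw [AlgHom.commutes]; exact Algebra.commute_algebraMap_left _ _
  | grade1 j => exact ((pow_five_comm (qParam_pow q k j) (gen_comm q k j)).1).symm
  | mul a b ha hb => rw [map_mul]; exact ha.mul_left hb
  | add a b ha hb => rw [map_add]; exact ha.add_left hb

/-- The homogeneous coordinate ring `ℂ[x_0, …, x_4]` of `ℙ⁴`. -/
abbrev S5 : Type := MvPolynomial (Fin 5) ℂ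

/-- The map from `ℂ[x_0, …, x_4]` to the centre, `x_k ↦ t_k⁵`. -/
noncomputable def fermatStructure (q : ℂ) [Fact (IsPrimitiveRoot q 5)] :
    S5 →ₐ[ℂ] Subalgebra.center ℂ (FermatAlg q) :=
  MvPolynomial.aeval fun k => ⟨gen q k ^ 5, gen_pow_central q k⟩

/-- The graded algebra as an algebra over `ℂ[x_0, …, x_4]`. -/
noncomputable instance (q : ℂ) [Fact (IsPrimitiveRoot q 5)] : Algebra S5 (FermatAlg q) :=
  ((Subalgebra.center ℂ (FermatAlg q)).val.toRingHom.comp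
    (fermatStructure q).toRingHom).toAlgebra'
    fun p x => ((Subalgebra.mem_center_iff.mp (fermatStructure q p).2) x).symm

/-! ### The hyperplane `X ⊂ ℙ⁴` as an analytic space -/

/-- The linear hyperplane `x_0 + ⋯ + x_4 = 0` in `ℂ⁵`. -/
def H : Submodule ℂ (Fin 5 → ℂ) where
  carrier := {v | ∑ k, v k = 0}
  add_mem' {v w} hv hw := by
    simp only [Set.mem_ofPred_eq, Pi.add_apply, Finset.sum_add_distrib] at *
    rw [hv, hw, add_zero]
  zero_mem' := by simp
  smul_mem' c v hv := by
    simp only [Set.mem_ofPred_eq, Pi.smul_apply, smul_eq_mul, ← Finset.mul_sum] at *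
    rw [hv, mul_zero]

/-- The set of points of `X = Proj (ℂ[x_0, …, x_4] / (x_0 + ⋯ + x_4)) ≅ ℙ³`, that is, the lines
in `H`. -/
def X : Type := Projectivization ℂ H

/-- The analytic topology on `X`: the quotient topology from `H ∖ {0}`. -/
instance : TopologicalSpace X :=
  inferInstanceAs (TopologicalSpace (Quotient (projectivizationSetoid ℂ H)))

/-- The point of `X` with given homogeneous coordinates. -/
noncomputable def X.mk (v : H) (hv : v ≠ 0) : X := Projectivization.mk ℂ v hv

/-- The homogeneous coordinates of a point of `X`, well defined up to a common nonzero factor. -/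
noncomputable def X.coord (p : X) : Fin 5 → ℂ := (Projectivization.rep p : H)

/-- The stratum `X_(i)`: the points with exactly `i + 2` nonzero homogeneous coordinates. -/
def stratum (i : Fin 4) : Set X :=
  {p | {k : Fin 5 | p.coord k ≠ 0}.ncard = (i : ℕ) + 2}

theorem continuous_mk : Continuous fun v : {v : H // v ≠ 0} => X.mk v.1 v.2 :=
  continuous_quotient_mk'

/-- The punctured cone over an open subset of `X`. -/
def cone (W : Opens X) : Opens H where
  carrier := {v | ∃ hv : v ≠ 0, X.mk v hv ∈ W}
  is_open' := by
    have h1 : IsOpen {v : H | v ≠ 0} := isOpen_ne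
    have h2 := h1.isOpenMap_subtype_val _ (W.2.preimage continuous_mk)
    convert h2 using 1
    ext v
    constructor
    · rintro ⟨hv, h⟩
      exact ⟨⟨v, hv⟩, h, rfl⟩
    · rintro ⟨w, h, rfl⟩
      exact ⟨w.2, h⟩

theorem cone_mono {W₁ W₂ : Opens X} (h : W₁ ≤ W₂) : cone W₁ ≤ cone W₂ :=
  fun _ ⟨hv, hw⟩ => ⟨hv, h hw⟩

/-- The point of `W` under a point of the cone over `W`. -/
noncomputable def conePoint {W : Opens X} (v : cone W) : W := ⟨X.mk v.1 v.2.1, v.2.2⟩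

/-- The coordinate functions on an open subset of `H`. -/
def coordH (V : Opens H) (k : Fin 5) : holo V :=
  ⟨fun x => (x.1 : Fin 5 → ℂ) k, fun x => (x : Fin 5 → ℂ) k,
    ((ContinuousLinearMap.proj (R := ℂ) (φ := fun _ : Fin 5 => ℂ) k).comp
      H.subtypeL).differentiable.differentiableOn, fun _ => rfl⟩

/-- Polynomials as holomorphic functions on an open subset of `H`. -/
noncomputable instance (V : Opens H) : Algebra S5 (holo V) :=
  (MvPolynomial.aeval (coordH V) : S5 →ₐ[ℂ] holo V).toAlgebra

/-- Restriction is linear over polynomials. -/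
noncomputable def holoResH {V₁ V₂ : Opens H} (h : V₁ ≤ V₂) : holo V₂ →ₐ[S5] holo V₁ where
  toRingHom := (holoRes h).toRingHom
  commutes' p := by
    have : (holoRes h).comp (MvPolynomial.aeval (coordH V₂) : S5 →ₐ[ℂ] holo V₂) =
        MvPolynomial.aeval (coordH V₁) := by
      ext k : 1
      simp only [AlgHom.comp_apply, MvPolynomial.aeval_X]
      rfl
    exact DFunLike.congr_fun this p

/-- A function on the cone over `W` is homogeneous of degree `-n`. -/
def HomogNeg {W : Opens X} (n : ℕ) (f : holo (cone W)) : Prop :=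
  ∀ (v v' : cone W) (c : ℂ), (v' : H) = c • (v : H) → c ^ n * f.1 v' = f.1 v

theorem HomogNeg.res {W₁ W₂ : Opens X} (h : W₁ ≤ W₂) {n : ℕ} {f : holo (cone W₂)}
    (hf : HomogNeg n f) : HomogNeg (W := W₁) n (holoResH (cone_mono h) f) :=
  fun v v' c e => hf ⟨v.1, cone_mono h v.2⟩ ⟨v'.1, cone_mono h v'.2⟩ c e

/-- The holomorphic functions on an open subset `W` of `X`: holomorphic functions on the cone
over `W` that are constant along the lines. -/
noncomputable def secO (W : Opens X) : Subring (holo (cone W)) where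
  carrier := {f | HomogNeg 0 f}
  mul_mem' {f g} hf hg v v' c e := by
    have h1 := hf v v' c e
    have h2 := hg v v' c e
    simp only [pow_zero, one_mul] at *
    change f.1 v' * g.1 v' = f.1 v * g.1 v
    rw [h1, h2]
  one_mem' v v' c _ := by simp
  add_mem' {f g} hf hg v v' c e := by
    have h1 := hf v v' c e
    have h2 := hg v v' c e
    simp only [pow_zero, one_mul] at *
    change f.1 v' + g.1 v' = f.1 v + g.1 v
    rw [h1, h2]
  zero_mem' v v' c _ := by simp
  neg_mem' {f} hf v v' c e := by
    have h1 := hf v v' c e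
    simp only [pow_zero, one_mul] at *
    change - f.1 v' = - f.1 v
    rw [h1]

/-- The value of a holomorphic function on `W` at a point of the cone over `W`. -/
noncomputable def secO.eval {W : Opens X} (f : secO W) (v : cone W) : ℂ := f.1.1 v

/-- The structure sheaf of `X` (holomorphic functions). -/
noncomputable def sheafOX : TopCat.Presheaf RingCat.{0} (TopCat.of X) where
  obj W := RingCat.of (secO W.unop)
  map i := RingCat.ofHom ((holoResH (cone_mono (leOfHom i.unop))).toRingHom.restrict _ _
    fun _ hf => HomogNeg.res (leOfHom i.unop) hf)
  map_id _ := rfl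
  map_comp _ _ := rfl

/-! ### The sheaf of algebras `𝒜` on `X` -/

section SheafA

variable (q : ℂ) [Fact (IsPrimitiveRoot q 5)]

/-- The pullback of the graded algebra to the cone over `W`. -/
abbrev conePull (W : Opens X) : Type := holo (cone W) ⊗[S5] FermatAlg q

/-- The sections of `𝒜` on `W`: `𝒜` is the coherent sheaf associated with the graded
`ℂ[x_0, …, x_4] / (∑ x_k)`-module `⨁ₙ B_{5n}`, where `B` is the graded algebra
`ℂ⟨t_0, …, t_4⟩_{(q_ij)} / (∑ t_k⁵)` and `x_k = t_k⁵` has degree one. Analytically, its sections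
on `W` are the homogeneous elements of degree zero in the pullback to the cone over `W`. They are
the sums of elements `f ⊗ b`, where `b` lies in `B_{5n}` and `f` is homogeneous of degree `-n`;
this set of elements is closed under products. -/
noncomputable def secA (W : Opens X) : Subring (conePull q W) :=
  Subring.closure {s | ∃ (n : ℕ) (f : holo (cone W)) (b : FermatAlg q),
    HomogNeg n f ∧ b ∈ degreePart q (5 * n) ∧ s = f ⊗ₜ[S5] b}

/-- Restriction of sections of the pullback to the cone. -/
noncomputable def conePullRes {W₁ W₂ : Opens X} (h : W₁ ≤ W₂) :
    conePull q W₂ →ₐ[S5] conePull q W₁ :=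
  Algebra.TensorProduct.map (holoResH (cone_mono h)) (AlgHom.id S5 (FermatAlg q))

theorem conePullRes_mem {W₁ W₂ : Opens X} (h : W₁ ≤ W₂) (s : conePull q W₂)
    (hs : s ∈ secA q W₂) : conePullRes q h s ∈ secA q W₁ := by
  have h1 : secA q W₂ ≤ (secA q W₁).comap (conePullRes q h).toRingHom := by
    refine Subring.closure_le.mpr ?_
    rintro _ ⟨n, f, b, hf, hb, rfl⟩
    exact Subring.subset_closure ⟨n, holoResH (cone_mono h) f, b, hf.res h, hb, rfl⟩
  exact h1 hs

/-- The sheaf of algebras `𝒜` on `X`. -/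
noncomputable def sheafA : TopCat.Presheaf RingCat.{0} (TopCat.of X) where
  obj W := RingCat.of (secA q W.unop)
  map i := RingCat.ofHom ((conePullRes q (leOfHom i.unop)).toRingHom.restrict _ _
    fun s hs => conePullRes_mem q (leOfHom i.unop) s hs)
  map_id W := by
    refine RingCat.hom_ext (RingHom.ext fun x => Subtype.ext ?_)
    exact DFunLike.congr_fun (Algebra.TensorProduct.map_id (R := S5) (S := S5)
      (A := holo (cone W.unop)) (B := FermatAlg q)) x.1
  map_comp i j := by
    refine RingCat.hom_ext (RingHom.ext fun x => Subtype.ext ?_)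
    exact DFunLike.congr_fun (Algebra.TensorProduct.map_comp (R := S5) (S := S5)
      (holoResH (cone_mono (leOfHom j.unop))) (holoResH (cone_mono (leOfHom i.unop)))
      (AlgHom.id S5 (FermatAlg q)) (AlgHom.id S5 (FermatAlg q))) x.1

/-- The structure morphism `f ↦ f ⊗ 1` from holomorphic functions to `𝒜`. -/
noncomputable def unitA : sheafOX ⟶ sheafA q where
  app W := RingCat.ofHom ((Algebra.TensorProduct.includeLeftRingHom
    (R := S5) (A := holo (cone W.unop)) (B := FermatAlg q)).restrict (secO W.unop) (secA q W.unop)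
      fun f hf => Subring.subset_closure ⟨0, f, 1, hf, by
        simp only [degreePart, mul_zero, pow_zero]; exact Submodule.one_le.mp le_rfl, rfl⟩)
  naturality W₁ W₂ i := by
    refine RingCat.hom_ext (RingHom.ext fun x => Subtype.ext ?_)
    exact (congrArg (fun d : FermatAlg q => (holoResH (cone_mono (leOfHom i.unop)) x.1) ⊗ₜ[S5] d)
      (map_one (AlgHom.id S5 (FermatAlg q)))).symm

end SheafA

/-! ### Analytic charts and local isomorphisms -/

/-- An analytic chart of `p`: an open neighbourhood `U` of `p` in the analytic topology, with an
embedding of `U` onto an open subset of `ℂ³` that maps `p` to the origin and is biholomorphic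
onto its image. The last condition is expressed by an isomorphism `comorphism` between the sheaf
of holomorphic functions on the image and the one on `U`, given by pullback of functions. -/
structure AnalyticChart (p : X) where
  /-- The domain of the chart. -/
  U : Opens (TopCat.of X)
  mem : p ∈ U
  /-- The embedding. -/
  map : (Opens.toTopCat (TopCat.of X)).obj U ⟶ TopCat.of C3
  isOpenEmbedding : Topology.IsOpenEmbedding map
  map_center : map ⟨p, mem⟩ = (0 : C3)
  /-- The pullback of holomorphic functions. -/
  comorphism : isOpenEmbedding.functor.op ⋙ sheafOC3 ≅ U.isOpenEmbedding.functor.op ⋙ sheafOX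
  comorphism_apply : ∀ (V : Opens ((Opens.toTopCat (TopCat.of X)).obj U))
    (f : holo (E := C3) (isOpenEmbedding.functor.obj V))
    (v : cone (U.isOpenEmbedding.functor.obj V)) (x : U) (hx : x ∈ V),
    (conePoint v : X) = x →
      secO.eval ((comorphism.hom.app (op V)).hom f) v = f.1 ⟨map x, ⟨x, hx, rfl⟩⟩

/-- An isomorphism `𝒜|_U ≅ J_(i)|_U` of sheaves of algebras over the holomorphic functions on
the domain `U` of a chart, where `J_(i)` is transported to `U` by the chart. -/
structure LocalIso (q : ℂ) [Fact (IsPrimitiveRoot q 5)] (i : Fin 4) {p : X}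
    (φ : AnalyticChart p) where
  /-- The isomorphism of sheaves of rings. -/
  iso : φ.U.isOpenEmbedding.functor.op ⋙ sheafA q ≅ φ.isOpenEmbedding.functor.op ⋙ sheafJ q i
  /-- It is linear over the holomorphic functions. -/
  linear : φ.comorphism.hom ≫ Functor.whiskerLeft φ.U.isOpenEmbedding.functor.op (unitA q) ≫
    iso.hom = Functor.whiskerLeft φ.isOpenEmbedding.functor.op (assocUnit (localModel q i))

end QuantumFermat

namespace QuantumFermat

/-! ### Quantum frames -/

section Frame

variable {A R R' : Type*} [CommRing A] [Ring R] [Ring R'] {n : ℕ}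

/-! Every algebra involved is a quantum algebra over a commutative ring `A`: it is generated by
elements `s_i` with `s_i s_j = q^(N i j) s_j s_i` and `s_i ^ 5 = y_i` in `A`, and the ordered
monomials with exponents from 0 to 4 form an `A`-basis (`IsFrame`). The data `N` and `y` determine
such an algebra up to an isomorphism (`frameEquiv`) that is compatible with restriction
(`frameEquiv_natural`). A local isomorphism between `𝒜` and `J_(i)` therefore amounts to four
generators on each side with the same `N` and the same `y`.

On the side of `𝒜`, order the homogeneous coordinates by a permutation `π` such that `x_{π 4}` and
`x_{π 0}` do not vanish at `p`. Over the holomorphic functions of the chart, the sections of degree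
zero are generated by the four quotients `t_{π k} / t_{π 4}`, whose fifth powers are `x_{π k} / x_{π
4}` (`chart_isFrame`). A function that does not vanish at `p` has a fifth root near `p`, so its
generator can be rescaled to have fifth power 1; a function that vanishes at `p` is kept as one of
the coordinates of `ℂ³`. The relation `∑ x_k = 0` eliminates `x_{π 0}`. At a point of `X_(i)` this
leaves the fifth powers `1`, then `1` repeated `i` times, then the last `3 - i` of the coordinates
(`exists_units`), and the common zero locus of these coordinates is the stratum (`mem_stratum_iff`).

On the side of the models, the Jacobi algebra is generated by `g = ∑ q^i e_i` and `u, v, w`, with `g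
^ 5 = 1` (`jac_isFrame`). In the other three models the clock and shift matrices generate `M₅(ℂ)`,
and the two remaining generators come from central elements: fifth roots of coordinates, or elements
that take different fifth roots of unity on the summands (`exists_matrix_frame`).

To match the exponents, note that `t_0 ⋯ t_4` commutes with all generators, because the rows of
`fermatExp` sum to zero. Its exponent vector has total degree 5, which is 0 in `ZMod 5`, so it lies
in the radical of the form induced on exponents of degree zero. Hence the four by four alternating
matrix of the quotients is singular and its Pfaffian vanishes. Under this condition the generators
of a model can be multiplied by monomials of fifth power 1 so as to realize the given matrix; fifth
powers do not change, since `5.choose 2` is divisible by 5 (`QComm.mul_pow_five`). For `i = 0` only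
powers of `g` are available for this, so the row of `g` must be proportional to `(3, 4, 3)`; a
finite check provides a suitable `π` (`exists_order`).

Linear independence of monomials is read off from the regular representation (`QRel.isFrame_of_hom`)
or from a known rank (`QRel.isFrame_of_equiv`). The sheaf properties hold because sections are
families of coefficient functions subject to local conditions (`isSheaf_of_coords`). The Morita
equivalences hold because the covers by fifth roots are again affine spaces, so the last three
models are matrix algebras over products of polynomial rings. -/

/-- The ordered monomial `s_0^{e_0} ⋯ s_{n-1}^{e_{n-1}}`. -/
def mono {n : ℕ} (s : Fin n → R) (e : Fin n → ZMod 5) : R :=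
  (List.ofFn fun i => s i ^ (e i).val).prod

theorem mono_succ (s : Fin (n + 1) → R) (e : Fin (n + 1) → ZMod 5) :
    mono s e = s 0 ^ (e 0).val * mono (fun i => s i.succ) (fun i => e i.succ) := by
  simp [mono, List.ofFn_succ]

theorem mono_castSucc (s : Fin (n + 1) → R) (e : Fin (n + 1) → ZMod 5) :
    mono s e = mono (fun i => s i.castSucc) (fun i => e i.castSucc) *
      s (Fin.last n) ^ (e (Fin.last n)).val := by
  rw [mono, mono, List.ofFn_succ', List.concat_eq_append, List.prod_append, List.prod_singleton]

@[simp] theorem mono_zero (s : Fin n → R) : mono s 0 = 1 := by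
  simp [mono, List.ofFn_const]

theorem map_mono (f : R →+* R') (s : Fin n → R) (e : Fin n → ZMod 5) :
    f (mono s e) = mono (fun i => f (s i)) e := by
  simp only [mono, map_list_prod, List.map_ofFn]
  congr 2
  ext i
  simp

/-- The factor that appears when the `i`-th generator, whose fifth power is `y`, is raised by one
in a monomial. -/
def wrap (y : A) (a : ZMod 5) : A := if a = 4 then y else 1

/-- The coefficient in `s_i s^e = c s^{e + δ_i}`. -/
def shiftCoeff (κ : AddChar (ZMod 5) A) (N : Fin n → Fin n → ZMod 5) (y : Fin n → A) (i : Fin n)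
    (e : Fin n → ZMod 5) : A :=
  κ (∑ j, if j < i then N i j * e j else 0) * wrap (y i) (e i)

/-- The elements `s_i` commute up to the fifth roots of unity `κ (N i j)`, and their fifth powers
are the scalars `y_i`. -/
structure QRel (κ : AddChar (ZMod 5) A) (α : A →+* R) (N : Fin n → Fin n → ZMod 5)
    (y : Fin n → A) (s : Fin n → R) : Prop where
  central : ∀ a r, α a * r = r * α a
  comm : ∀ i j, s i * s j = α (κ (N i j)) * (s j * s i)
  pow : ∀ i, s i ^ 5 = α (y i)

theorem mul_pow_of_comm {κ : AddChar (ZMod 5) A} {α : A →+* R} (hα : ∀ a r, α a * r = r * α a)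
    {x y : R} {c : ZMod 5} (h : x * y = α (κ c) * (y * x)) (k : ℕ) :
    x * y ^ k = α (κ (c * k)) * (y ^ k * x) := by
  induction k with
  | zero => simp
  | succ k ih =>
    rw [pow_succ, ← mul_assoc, ih, mul_assoc, mul_assoc, h, ← mul_assoc (y ^ k), ← hα,
      Nat.cast_succ, mul_add, mul_one, AddChar.map_add_eq_mul, map_mul α]
    simp only [mul_assoc]

theorem QRel.tail {κ : AddChar (ZMod 5) A} {α : A →+* R} {N : Fin (n + 1) → Fin (n + 1) → ZMod 5}
    {y : Fin (n + 1) → A} {s : Fin (n + 1) → R} (h : QRel κ α N y s) :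
    QRel κ α (fun i j => N i.succ j.succ) (fun i => y i.succ) (fun i => s i.succ) :=
  ⟨h.central, fun i j => h.comm _ _, fun i => h.pow _⟩

/-- Moving `s_i` to its place in the ordered monomial passes it over the generators of smaller
index, which produces the root of unity. If its exponent there is 4, the monomial wraps around and
releases the scalar `y_i`. The induction splits off the first generator, which is either `s_i` or
one that `s_i` has to pass. -/
theorem QRel.mul_mono {κ : AddChar (ZMod 5) A} {α : A →+* R} {N : Fin n → Fin n → ZMod 5}
    {y : Fin n → A} {s : Fin n → R} (h : QRel κ α N y s) (i : Fin n) (e : Fin n → ZMod 5) :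
    s i * mono s e = α (shiftCoeff κ N y i e) * mono s (e + Pi.single i 1) := by
  induction n with
  | zero => exact i.elim0
  | succ n ih =>
    rw [mono_succ, mono_succ]
    refine Fin.cases ?_ (fun i => ?_) i
    · have h0 : shiftCoeff κ N y 0 e = wrap (y 0) (e 0) := by simp [shiftCoeff]
      have h1 : s 0 * s 0 ^ (e 0).val = α (wrap (y 0) (e 0)) * s 0 ^ (e 0 + 1).val := by
        unfold wrap
        split_ifs with h4
        · rw [h4]
          -- In `ZMod 5` the exponent `4 + 1` is `0`, so the monomial on the right has lost this
          -- generator.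
          change s 0 * s 0 ^ 4 = α (y 0) * s 0 ^ 0
          rw [← pow_succ', h.pow, pow_zero, mul_one]
        · have : (e 0 + 1).val = (e 0).val + 1 := by
            generalize e 0 = a at h4
            revert a; decide
          rw [this, map_one, one_mul, pow_succ']
      rw [h0, ← mul_assoc, h1, mul_assoc]
      simp
    · rw [← mul_assoc, mul_pow_of_comm h.central (h.comm i.succ 0), mul_assoc, mul_assoc,
        ih h.tail i, ← mul_assoc (s 0 ^ _), ← h.central]
      have e1 : (e + Pi.single i.succ 1 : Fin (n + 1) → ZMod 5) 0 = e 0 := by simp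
      have e2 : (fun j : Fin n => (e + Pi.single i.succ 1 : Fin (n + 1) → ZMod 5) j.succ) =
          (fun j => e j.succ) + Pi.single i 1 := by
        ext j
        simp [Pi.single_apply]
      have e3 : shiftCoeff κ N y i.succ e = κ (N i.succ 0 * e 0) *
          shiftCoeff κ (fun i j => N i.succ j.succ) (fun i => y i.succ) i (fun j => e j.succ) := by
        simp only [shiftCoeff, Fin.sum_univ_succ, Fin.succ_pos, if_true, Fin.succ_lt_succ_iff,
          AddChar.map_add_eq_mul, mul_assoc]
      rw [e1, e2, e3, map_mul α, ZMod.natCast_zmod_val]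
      simp only [mul_assoc]

/-- The combination of monomials with given coefficients. -/
def frameMap (α : A →+* R) (s : Fin n → R) (f : (Fin n → ZMod 5) → A) : R :=
  ∑ e, α (f e) * mono s e

/-- The elements `s_i` satisfy the relations `QRel`, and their monomials form a basis. -/
structure IsFrame (κ : AddChar (ZMod 5) A) (α : A →+* R) (N : Fin n → Fin n → ZMod 5)
    (y : Fin n → A) (s : Fin n → R) : Prop extends QRel κ α N y s where
  bij : Function.Bijective (frameMap α s)

theorem frameMap_add (α : A →+* R) (s : Fin n → R) (f g : (Fin n → ZMod 5) → A) :
    frameMap α s (f + g) = frameMap α s f + frameMap α s g := by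
  simp [frameMap, add_mul, Finset.sum_add_distrib]

theorem frameMap_smul (α : A →+* R) (s : Fin n → R) (a : A) (f : (Fin n → ZMod 5) → A) :
    frameMap α s (a • f) = α a * frameMap α s f := by
  simp [frameMap, mul_assoc, Finset.mul_sum]

theorem frameMap_single (α : A →+* R) (s : Fin n → R) (e : Fin n → ZMod 5) (a : A) :
    frameMap α s (Pi.single e a) = α a * mono s e := by
  classical
  rw [frameMap, Finset.sum_eq_single e]
  · simp
  · intro b _ hb
    simp [hb]
  · simp

theorem mono_eq_frameMap (α : A →+* R) (s : Fin n → R) (e : Fin n → ZMod 5) :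
    mono s e = frameMap α s (Pi.single e 1) := by
  rw [frameMap_single, map_one, one_mul]

theorem map_frameMap (f : R →+* R') (α : A →+* R) (s : Fin n → R) (g : (Fin n → ZMod 5) → A) :
    f (frameMap α s g) = frameMap (f.comp α) (fun i => f (s i)) g := by
  simp [frameMap, map_mono]

/-- The additive subgroup of combinations of monomials. -/
def frameSpan (α : A →+* R) (s : Fin n → R) : AddSubgroup R :=
  (AddMonoidHom.mk' (frameMap α s) (frameMap_add α s)).range

theorem frameMap_induction {α : A →+* R} {s : Fin n → R} (S : AddSubgroup R)
    (h : ∀ a e, α a * mono s e ∈ S) (f : (Fin n → ZMod 5) → A) : frameMap α s f ∈ S :=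
  S.sum_mem fun e _ => h _ e

/-- By `QRel.mul_mono`, left multiplication by a scalar or a generator preserves the span of the
monomials; hence so does everything that these generate. Applied to `1`, this shows that the
monomials span the generated subring. -/
theorem QRel.frameSpan_mul {κ : AddChar (ZMod 5) A} {α : A →+* R} {N : Fin n → Fin n → ZMod 5}
    {y : Fin n → A} {s : Fin n → R} (h : QRel κ α N y s) {r : R}
    (hr : r ∈ Subring.closure (Set.range α ∪ Set.range s)) {r' : R} (hr' : r' ∈ frameSpan α s) :
    r * r' ∈ frameSpan α s := by
  have hα : ∀ a, ∀ r' ∈ frameSpan α s, α a * r' ∈ frameSpan α s := by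
    rintro a _ ⟨f, rfl⟩
    exact ⟨a • f, frameMap_smul _ _ _ _⟩
  induction hr using Subring.closure_induction generalizing r' with
  | mem x hx =>
    rcases hx with ⟨a, rfl⟩ | ⟨i, rfl⟩
    · exact hα a _ hr'
    · obtain ⟨f, rfl⟩ := hr'
      refine frameMap_induction ((frameSpan α s).comap (AddMonoidHom.mulLeft (s i)))
        (fun a e => ?_) f
      change s i * (α a * mono s e) ∈ frameSpan α s
      rw [← mul_assoc, ← h.central, mul_assoc, h.mul_mono]
      refine hα _ _ (hα _ _ ?_)
      exact ⟨_, (mono_eq_frameMap α s _).symm⟩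
  | zero => rw [zero_mul]; exact zero_mem _
  | one => rwa [one_mul]
  | add x y _ _ hx hy => rw [add_mul]; exact add_mem (hx hr') (hy hr')
  | neg x _ hx => rw [neg_mul]; exact neg_mem (hx hr')
  | mul x y _ _ hx hy => rw [mul_assoc]; exact hx (hy hr')

theorem QRel.closure_le_frameSpan {κ : AddChar (ZMod 5) A} {α : A →+* R}
    {N : Fin n → Fin n → ZMod 5} {y : Fin n → A} {s : Fin n → R} (h : QRel κ α N y s) {r : R}
    (hr : r ∈ Subring.closure (Set.range α ∪ Set.range s)) : r ∈ frameSpan α s := by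
  rw [← mul_one r]
  exact h.frameSpan_mul hr ⟨_, ((mono_zero s).symm.trans (mono_eq_frameMap α s 0)).symm⟩

theorem QRel.surjective {κ : AddChar (ZMod 5) A} {α : A →+* R}
    {N : Fin n → Fin n → ZMod 5} {y : Fin n → A} {s : Fin n → R} (h : QRel κ α N y s)
    (hr : Subring.closure (Set.range α ∪ Set.range s) = ⊤) :
    Function.Surjective (frameMap α s) := fun r =>
  h.closure_le_frameSpan (hr ▸ Subring.mem_top r)

/-- Ring homomorphisms out of a framed algebra are determined by their values on scalars and
generators. -/
theorem frame_hom_ext {α : A →+* R} {s : Fin n → R} (h : Function.Surjective (frameMap α s))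
    {f g : R →+* R'} (hα : ∀ a, f (α a) = g (α a)) (hs : ∀ i, f (s i) = g (s i)) : f = g := by
  ext r
  obtain ⟨c, rfl⟩ := h r
  rw [map_frameMap, map_frameMap]
  congr 1
  · ext a; exact hα a
  · ext i; exact hs i

/-! ### Isomorphisms between framed algebras with the same relations -/

section Equiv

variable {κ : AddChar (ZMod 5) A} {α : A →+* R} {α' : A →+* R'} {N : Fin n → Fin n → ZMod 5}
  {y : Fin n → A} {s : Fin n → R} {s' : Fin n → R'}

/-- Two algebras with frames that satisfy the same relations: the underlying bijection. -/
noncomputable def frameEquivAux (h : IsFrame κ α N y s) (h' : IsFrame κ α' N y s') : R ≃ R' :=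
  (Equiv.ofBijective _ h.bij).symm.trans (Equiv.ofBijective _ h'.bij)

theorem frameEquivAux_frameMap (h : IsFrame κ α N y s) (h' : IsFrame κ α' N y s')
    (f : (Fin n → ZMod 5) → A) : frameEquivAux h h' (frameMap α s f) = frameMap α' s' f := by
  change Equiv.ofBijective _ h'.bij ((Equiv.ofBijective _ h.bij).symm _) = _
  have : frameMap α s f = Equiv.ofBijective _ h.bij f := rfl
  rw [this, Equiv.symm_apply_apply]
  rfl

theorem frameEquivAux_add (h : IsFrame κ α N y s) (h' : IsFrame κ α' N y s') (r₁ r₂ : R) :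
    frameEquivAux h h' (r₁ + r₂) = frameEquivAux h h' r₁ + frameEquivAux h h' r₂ := by
  obtain ⟨f, rfl⟩ := h.bij.2 r₁
  obtain ⟨g, rfl⟩ := h.bij.2 r₂
  rw [← frameMap_add, frameEquivAux_frameMap, frameEquivAux_frameMap, frameEquivAux_frameMap,
    frameMap_add]

theorem frameEquivAux_smul (h : IsFrame κ α N y s) (h' : IsFrame κ α' N y s') (a : A) (r : R) :
    frameEquivAux h h' (α a * r) = α' a * frameEquivAux h h' r := by
  obtain ⟨f, rfl⟩ := h.bij.2 r
  rw [← frameMap_smul, frameEquivAux_frameMap, frameEquivAux_frameMap, frameMap_smul]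

theorem frameEquivAux_mono (h : IsFrame κ α N y s) (h' : IsFrame κ α' N y s')
    (e : Fin n → ZMod 5) : frameEquivAux h h' (mono s e) = mono s' e := by
  rw [mono_eq_frameMap α, frameEquivAux_frameMap, ← mono_eq_frameMap]

/-- The structure constants in `QRel.mul_mono` depend only on `κ`, `N` and `y`, which the two
algebras share. From this, multiplicativity follows first for monomials and then for all elements.
-/
theorem frameEquivAux_gen_mul (h : IsFrame κ α N y s) (h' : IsFrame κ α' N y s') (i : Fin n)
    (r : R) : frameEquivAux h h' (s i * r) = s' i * frameEquivAux h h' r := by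
  obtain ⟨f, rfl⟩ := h.bij.2 r
  let F : R →+ R' := AddMonoidHom.mk' (frameEquivAux h h') (frameEquivAux_add h h')
  refine frameMap_induction ((F.comp (AddMonoidHom.mulLeft (s i))).eqLocus
    ((AddMonoidHom.mulLeft (s' i)).comp F)) (fun a e => ?_) f
  change frameEquivAux h h' (s i * (α a * mono s e)) = s' i * frameEquivAux h h' (α a * mono s e)
  rw [frameEquivAux_smul, frameEquivAux_mono, ← mul_assoc, ← h.central, mul_assoc,
    frameEquivAux_smul, h.mul_mono, frameEquivAux_smul, frameEquivAux_mono, ← mul_assoc (s' i),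
    ← h'.central, mul_assoc, h'.mul_mono]

theorem frameEquivAux_gen_pow_mul (h : IsFrame κ α N y s) (h' : IsFrame κ α' N y s') (i : Fin n)
    (k : ℕ) (r : R) : frameEquivAux h h' (s i ^ k * r) = s' i ^ k * frameEquivAux h h' r := by
  induction k with
  | zero => simp
  | succ k ih => rw [pow_succ', mul_assoc, frameEquivAux_gen_mul, ih, pow_succ', mul_assoc]

theorem frameEquivAux_mono_mul (h : IsFrame κ α N y s) (h' : IsFrame κ α' N y s')
    (e : Fin n → ZMod 5) (r : R) :
    frameEquivAux h h' (mono s e * r) = mono s' e * frameEquivAux h h' r := by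
  -- The claim is proved for products over arbitrary lists of indices so that the induction closes;
  -- the monomial is the product over the list of all indices.
  have key : ∀ l : List (Fin n), frameEquivAux h h' ((l.map fun i => s i ^ (e i).val).prod * r) =
      (l.map fun i => s' i ^ (e i).val).prod * frameEquivAux h h' r := by
    intro l
    induction l with
    | nil => simp
    | cons i l ih =>
      simp only [List.map_cons, List.prod_cons, mul_assoc, frameEquivAux_gen_pow_mul, ih]
  have := key (List.ofFn id)
  simpa only [List.map_ofFn] using! this

/-- Two algebras with frames that satisfy the same relations are isomorphic. -/
noncomputable def frameEquiv (h : IsFrame κ α N y s) (h' : IsFrame κ α' N y s') : R ≃+* R' where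
  __ := frameEquivAux h h'
  map_add' := frameEquivAux_add h h'
  map_mul' r₁ r₂ := by
    change frameEquivAux h h' (r₁ * r₂) = frameEquivAux h h' r₁ * frameEquivAux h h' r₂
    obtain ⟨f, rfl⟩ := h.bij.2 r₁
    let F : R →+ R' := AddMonoidHom.mk' (frameEquivAux h h') (frameEquivAux_add h h')
    refine frameMap_induction ((F.comp (AddMonoidHom.mulRight r₂)).eqLocus
      ((AddMonoidHom.mulRight (F r₂)).comp F)) (fun a e => ?_) f
    change frameEquivAux h h' (α a * mono s e * r₂) =
      frameEquivAux h h' (α a * mono s e) * frameEquivAux h h' r₂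
    rw [mul_assoc, frameEquivAux_smul, frameEquivAux_mono_mul, frameEquivAux_smul,
      frameEquivAux_mono, mul_assoc]

theorem frameEquiv_scalar (h : IsFrame κ α N y s) (h' : IsFrame κ α' N y s') (a : A) :
    frameEquiv h h' (α a) = α' a := by
  have := frameEquivAux_smul h h' a 1
  have h1 : frameEquivAux h h' 1 = 1 := by
    rw [← mono_zero s, frameEquivAux_mono, mono_zero]
  rw [h1, mul_one, mul_one] at this
  exact this

theorem frameEquiv_gen (h : IsFrame κ α N y s) (h' : IsFrame κ α' N y s') (i : Fin n) :
    frameEquiv h h' (s i) = s' i := by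
  have := frameEquivAux_gen_mul h h' i 1
  have h1 : frameEquivAux h h' 1 = 1 := by
    rw [← mono_zero s, frameEquivAux_mono, mono_zero]
  rw [h1, mul_one, mul_one] at this
  exact this

end Equiv

end Frame

/-! ### The regular representation of a quantum algebra -/

section Model

variable {A R : Type*} [CommRing A] [Ring R] {n : ℕ}

/-- The operators of the regular representation. -/
def modelOp (κ : AddChar (ZMod 5) A) (N : Fin n → Fin n → ZMod 5) (y : Fin n → A) (i : Fin n) :
    Module.End A ((Fin n → ZMod 5) → A) where
  toFun f e := shiftCoeff κ N y i (e - Pi.single i 1) * f (e - Pi.single i 1)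
  map_add' f g := by ext e; simp [mul_add]
  map_smul' a f := by ext e; simp [mul_left_comm]

theorem modelOp_apply (κ : AddChar (ZMod 5) A) (N : Fin n → Fin n → ZMod 5) (y : Fin n → A)
    (i : Fin n) (f : (Fin n → ZMod 5) → A) (e : Fin n → ZMod 5) :
    modelOp κ N y i f e = shiftCoeff κ N y i (e - Pi.single i 1) * f (e - Pi.single i 1) := rfl

theorem modelOp_single (κ : AddChar (ZMod 5) A) (N : Fin n → Fin n → ZMod 5) (y : Fin n → A)
    (i : Fin n) (e : Fin n → ZMod 5) :
    modelOp κ N y i (Pi.single e 1) = shiftCoeff κ N y i e • Pi.single (e + Pi.single i 1) 1 := by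
  ext e'
  rw [modelOp_apply]
  by_cases h : e' = e + Pi.single i 1
  · subst h; simp
  · have h' : e' - Pi.single i 1 ≠ e := fun h' => h (by rw [← h', sub_add_cancel])
    simp [h, h']

/-- The root of unity sees only the exponents below `i`, and `wrap` sees only the exponent of `i`
itself. Raising another exponent thus matters in just one of the two orders of `i` and `j`, and this
asymmetry produces the commutation relation. -/
theorem shiftCoeff_add_single {κ : AddChar (ZMod 5) A} {N : Fin n → Fin n → ZMod 5}
    {y : Fin n → A} {i j : Fin n} (h : i ≠ j) (e : Fin n → ZMod 5) :
    shiftCoeff κ N y i (e + Pi.single j 1) =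
      κ (if j < i then N i j else 0) * shiftCoeff κ N y i e := by
  have h1 : (∑ k, if k < i then N i k * (e + Pi.single j 1 : Fin n → ZMod 5) k else 0) =
      (if j < i then N i j else 0) + ∑ k, if k < i then N i k * e k else 0 := by
    have : ∀ k, (if k < i then N i k * (e + Pi.single j 1 : Fin n → ZMod 5) k else 0) =
        (if k = j then (if k < i then N i k else 0) else 0) +
          if k < i then N i k * e k else 0 := by
      intro k
      by_cases hk : k = j <;> by_cases hi : k < i <;> simp [hk, hi, mul_add, add_comm]
      all_goals subst hk; simp [hi]; try ring
    simp only [this, Finset.sum_add_distrib, Finset.sum_ite_eq', Finset.mem_univ, if_true]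
  unfold shiftCoeff
  rw [h1, AddChar.map_add_eq_mul, mul_assoc]
  simp [h]

/-- The scalars of the regular representation. -/
abbrev modelScalar (A : Type*) [CommRing A] (n : ℕ) :
    A →+* Module.End A ((Fin n → ZMod 5) → A) := algebraMap A _

/-- Five steps in the direction `i` go once around `ZMod 5`. The exponents below `i` do not change,
so the same root of unity occurs five times and cancels, and the wrap-around is met exactly once. -/
theorem modelOp_pow_five (κ : AddChar (ZMod 5) A) (N : Fin n → Fin n → ZMod 5) (y : Fin n → A)
    (i : Fin n) : modelOp κ N y i ^ 5 = modelScalar A n (y i) := by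
  refine LinearMap.ext fun f => funext fun e => ?_
  simp only [pow_succ, pow_zero, one_mul, Module.End.mul_apply, modelOp_apply,
    Module.algebraMap_end_apply, Pi.smul_apply, smul_eq_mul]
  have hS : ∀ e' : Fin n → ZMod 5, (∑ j, if j < i then N i j *
      (e' - Pi.single i 1 : Fin n → ZMod 5) j else 0) = ∑ j, if j < i then N i j * e' j else 0 := by
    intro e'
    refine Finset.sum_congr rfl fun j _ => ?_
    split_ifs with h
    · simp [h.ne]
    · rfl
  have he : e - Pi.single i 1 - Pi.single i 1 - Pi.single i 1 - Pi.single i 1 - Pi.single i 1 =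
      e := by
    ext j
    by_cases h : j = i
    · subst h
      simp only [Pi.sub_apply, Pi.single_eq_same]
      generalize e j = a; revert a; decide
    · simp [h]
  simp only [shiftCoeff, hS, he]
  generalize (∑ j, if j < i then N i j * e j else 0) = S
  have hκ : κ S * κ S * κ S * κ S * κ S = 1 := by
    simp only [← AddChar.map_add_eq_mul]
    have : S + S + S + S + S = 0 := by revert S; decide
    rw [this, AddChar.map_zero_eq_one]
  have hw : wrap (y i) ((e - Pi.single i 1 : Fin n → ZMod 5) i) *
      (wrap (y i) ((e - Pi.single i 1 - Pi.single i 1 : Fin n → ZMod 5) i) *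
      (wrap (y i) ((e - Pi.single i 1 - Pi.single i 1 - Pi.single i 1 : Fin n → ZMod 5) i) *
      (wrap (y i) ((e - Pi.single i 1 - Pi.single i 1 - Pi.single i 1 - Pi.single i 1 :
        Fin n → ZMod 5) i) * wrap (y i) (e i)))) = y i := by
    simp only [Pi.sub_apply, Pi.single_eq_same]
    generalize e i = a
    unfold wrap
    clear hκ he hS
    split_ifs <;> first | ring1 | (exfalso; revert a; decide)
  linear_combination (f e * y i) * hκ + (κ S * κ S * κ S * κ S * κ S * f e) * hw

/-- After `shiftCoeff_add_single`, the two orders of a pair of operators differ by `κ (N i j)` if `j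
< i`, and by the inverse of `κ (N j i)` if `i < j`; antisymmetry of `N` makes these the same. -/
theorem model_qrel (κ : AddChar (ZMod 5) A) (N : Fin n → Fin n → ZMod 5) (y : Fin n → A)
    (h0 : ∀ i, N i i = 0) (hN : ∀ i j, N j i = -N i j) :
    QRel κ (modelScalar A n) N y (modelOp κ N y) where
  central a r := Algebra.commutes a r
  pow := modelOp_pow_five κ N y
  comm i j := by
    rcases eq_or_ne i j with rfl | hij
    · rw [h0, AddChar.map_zero_eq_one, map_one, one_mul]
    refine LinearMap.ext fun f => funext fun e => ?_
    simp only [Module.End.mul_apply, modelOp_apply, Module.algebraMap_end_apply, Pi.smul_apply,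
      smul_eq_mul]
    rw [sub_right_comm e (Pi.single j 1)]
    generalize he' : e - Pi.single i 1 - Pi.single j 1 = e'
    have e1 : e - Pi.single i 1 = e' + Pi.single j 1 := by rw [← he']; abel
    have e2 : e - Pi.single j 1 = e' + Pi.single i 1 := by rw [← he']; abel
    rw [e1, e2, shiftCoeff_add_single hij, shiftCoeff_add_single hij.symm]
    rcases lt_or_gt_of_ne hij with h | h
    · have hκ : κ (N i j) * κ (N j i) = 1 := by
        rw [← AddChar.map_add_eq_mul, hN i j, add_neg_cancel, AddChar.map_zero_eq_one]
      simp only [h, h.not_gt, if_true, if_false, AddChar.map_zero_eq_one]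
      linear_combination (-(shiftCoeff κ N y i e' * shiftCoeff κ N y j e' * f e')) * hκ
    · simp only [h, h.not_gt, if_true, if_false, AddChar.map_zero_eq_one]
      ring

/-- Induction on the total exponent: the factor of smallest index is the outermost one, it has
nothing to pass and does not wrap, so the coefficient is 1. -/
theorem model_mono (κ : AddChar (ZMod 5) A) (N : Fin n → Fin n → ZMod 5) (y : Fin n → A)
    (h0 : ∀ i, N i i = 0) (hN : ∀ i j, N j i = -N i j) (e : Fin n → ZMod 5) :
    mono (modelOp κ N y) e (Pi.single 0 1) = Pi.single e 1 := by
  induction hm : ∑ i, (e i).val using Nat.strong_induction_on generalizing e with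
  | _ m ih =>
    by_cases he : e = 0
    · subst he; simp
    obtain ⟨i, hi⟩ : ∃ i, i ∈ Finset.univ.filter (fun i => e i ≠ 0) := by
      by_contra hcon
      push Not at hcon
      exact he (funext fun i => by simpa using hcon i)
    -- Minimality of `i` makes the sum in `shiftCoeff` vanish.
    obtain ⟨i, hi, hmin⟩ := Finset.exists_min_image (Finset.univ.filter (fun i => e i ≠ 0)) id
      ⟨i, hi⟩
    have hi0 : e i ≠ 0 := by simpa using hi
    have hlt : ∀ j < i, e j = 0 := by
      intro j hj
      by_contra hcon
      exact absurd (hmin j (by simpa using hcon)) (not_le.mpr hj)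
    set e' := e - Pi.single i 1 with he'
    have hval : (e' i).val + 1 = (e i).val := by
      have : e' i = e i - 1 := by simp [he']
      rw [this]
      generalize e i = a at hi0
      revert a; decide
    have hne : ∀ j, j ≠ i → e' j = e j := by
      intro j hj; simp [he', hj]
    have hcoef : shiftCoeff κ N y i e' = 1 := by
      have h4 : e' i ≠ 4 := by
        have : e' i = e i - 1 := by simp [he']
        rw [this]
        generalize e i = a at hi0
        revert a; decide
      have hs : (∑ j, if j < i then N i j * e' j else 0) = 0 := by
        refine Finset.sum_eq_zero fun j _ => ?_
        split_ifs with hj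
        · rw [hne j hj.ne, hlt j hj, mul_zero]
        · rfl
      rw [shiftCoeff, hs, AddChar.map_zero_eq_one, wrap, if_neg h4, mul_one]
    have hee : e' + Pi.single i 1 = e := by simp [he']
    have hsum : ∑ j, (e' j).val < m := by
      rw [← hm]
      refine Finset.sum_lt_sum (fun j _ => ?_) ⟨i, Finset.mem_univ _, by omega⟩
      rcases eq_or_ne j i with rfl | hj
      · omega
      · rw [hne j hj]
    have h1 := (model_qrel κ N y h0 hN).mul_mono i e'
    rw [hcoef, map_one, one_mul, hee] at h1
    rw [← h1, Module.End.mul_apply, ih _ hsum e' rfl, modelOp_single, hcoef, one_smul, hee]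

/-- Applying a combination of monomials to the basis vector at `0` returns its coefficients, so the
monomials are independent in every algebra that acts by these operators. -/
theorem model_frameMap (κ : AddChar (ZMod 5) A) (N : Fin n → Fin n → ZMod 5) (y : Fin n → A)
    (h0 : ∀ i, N i i = 0) (hN : ∀ i j, N j i = -N i j) (f : (Fin n → ZMod 5) → A) :
    frameMap (modelScalar A n) (modelOp κ N y) f (Pi.single 0 1) = f := by
  simp only [frameMap, LinearMap.sum_apply, Module.End.mul_apply, model_mono κ N y h0 hN,
    Module.algebraMap_end_apply]
  ext e
  simp [Finset.sum_apply, Pi.single_apply]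

/-- A generated algebra with the right relations that maps to the regular representation is
framed. -/
theorem QRel.isFrame_of_hom {κ : AddChar (ZMod 5) A} {α : A →+* R} {N : Fin n → Fin n → ZMod 5}
    {y : Fin n → A} {s : Fin n → R} (h : QRel κ α N y s)
    (hr : Subring.closure (Set.range α ∪ Set.range s) = ⊤)
    (h0 : ∀ i, N i i = 0) (hN : ∀ i j, N j i = -N i j)
    (Φ : R →+* Module.End A ((Fin n → ZMod 5) → A)) (hα : ∀ a, Φ (α a) = modelScalar A n a)
    (hs : ∀ i, Φ (s i) = modelOp κ N y i) : IsFrame κ α N y s where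
  __ := h
  bij := by
    refine ⟨fun f g hfg => ?_, h.surjective hr⟩
    have h1 := congrArg (fun r => Φ r (Pi.single 0 1)) hfg
    have e1 : Φ.comp α = modelScalar A n := RingHom.ext hα
    have e2 : (fun i => Φ (s i)) = modelOp κ N y := funext hs
    simpa only [map_frameMap, e1, e2, model_frameMap κ N y h0 hN] using h1

/-- A generated algebra with the right relations that is free of the right rank is framed. -/
theorem QRel.isFrame_of_equiv [Algebra A R] {κ : AddChar (ZMod 5) A}
    {N : Fin n → Fin n → ZMod 5}
    {y : Fin n → A} {s : Fin n → R} (h : QRel κ (algebraMap A R) N y s)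
    (hr : Subring.closure (Set.range (algebraMap A R) ∪ Set.range s) = ⊤)
    (E : R ≃ₗ[A] ((Fin n → ZMod 5) → A)) : IsFrame κ (algebraMap A R) N y s where
  __ := h
  bij := by
    have hsurj := h.surjective hr
    refine ⟨?_, hsurj⟩
    -- Composed with `E`, the spanning map is a surjective endomorphism of a finitely generated
    -- module over a commutative ring, hence injective.
    let F : ((Fin n → ZMod 5) → A) →ₗ[A] ((Fin n → ZMod 5) → A) :=
      E.toLinearMap ∘ₗ
      { toFun := frameMap (algebraMap A R) s
        map_add' := frameMap_add _ _
        map_smul' := fun a f => by rw [frameMap_smul, RingHom.id_apply, Algebra.smul_def] }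
    have hF : Function.Surjective F := E.surjective.comp hsurj
    have := OrzechProperty.injective_of_surjective_endomorphism F hF
    intro f g hfg
    exact this (congrArg E hfg)

/-- A frame gives a basis. -/
noncomputable def IsFrame.basis [Algebra A R] {κ : AddChar (ZMod 5) A}
    {N : Fin n → Fin n → ZMod 5} {y : Fin n → A} {s : Fin n → R}
    (h : IsFrame κ (algebraMap A R) N y s) : Module.Basis (Fin n → ZMod 5) A R :=
  Module.Basis.ofEquivFun (LinearEquiv.ofBijective
      { toFun := frameMap (algebraMap A R) s
        map_add' := frameMap_add _ _
        map_smul' := fun a f => by rw [frameMap_smul, RingHom.id_apply, Algebra.smul_def] }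
      h.bij).symm

theorem IsFrame.basis_apply [Algebra A R] {κ : AddChar (ZMod 5) A}
    {N : Fin n → Fin n → ZMod 5} {y : Fin n → A} {s : Fin n → R}
    (h : IsFrame κ (algebraMap A R) N y s) (e : Fin n → ZMod 5) : h.basis e = mono s e := by
  classical
  simp only [IsFrame.basis, Module.Basis.coe_ofEquivFun, LinearEquiv.symm_symm]
  exact (mono_eq_frameMap (algebraMap A R) s e).symm

end Model

end QuantumFermat

namespace QuantumFermat

/-! ### Elements that commute up to a fifth root of unity -/

/-- The character `a ↦ q ^ a` of `ℤ/5`. -/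
noncomputable def chi (q : ℂ) [Fact (IsPrimitiveRoot q 5)] : AddChar (ZMod 5) ℂ :=
  AddChar.zmodChar 5 (prim_pow q)

/-- The character `a ↦ q ^ a` with values in a `ℂ`-algebra. -/
noncomputable def chiAlg (q : ℂ) [Fact (IsPrimitiveRoot q 5)] (A : Type*) [CommRing A]
    [Algebra ℂ A] : AddChar (ZMod 5) A :=
  (algebraMap ℂ A).toMonoidHom.compAddChar (chi q)

theorem chiAlg_apply (q : ℂ) [Fact (IsPrimitiveRoot q 5)] (A : Type*) [CommRing A]
    [Algebra ℂ A] (a : ZMod 5) : chiAlg q A a = algebraMap ℂ A (chi q a) := rfl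

variable (q : ℂ) [Fact (IsPrimitiveRoot q 5)]

theorem chi_apply (a : ZMod 5) : chi q a = q ^ a.val := AddChar.zmodChar_apply _ _

theorem chi_sum (b : ZMod 5) : ∑ k, chi q (k * b) = if b = 0 then 5 else 0 := by
  have h := AddChar.sum_mulShift b (AddChar.zmodChar_primitive_of_primitive_root 5
    (Fact.out : IsPrimitiveRoot q 5))
  have h5 : ((Fintype.card (ZMod 5) : ℕ) : ℂ) = 5 := by rw [ZMod.card]; norm_num
  rw [Nat.cast_ite, h5, Nat.cast_zero] at h
  exact h

section QComm

variable {R : Type*} [Ring R] [Algebra ℂ R]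

/-- The elements `x` and `y` commute up to the factor `q ^ c`. -/
def QComm (c : ZMod 5) (x y : R) : Prop := x * y = chi q c • (y * x)

variable {q} {c d : ZMod 5} {x y z : R}

theorem QComm.symm (h : QComm q c x y) : QComm q (-c) y x := by
  unfold QComm at *
  rw [h, smul_smul, ← AddChar.map_add_eq_mul, neg_add_cancel, AddChar.map_zero_eq_one, one_smul]

theorem QComm.of_comm (h : x * y = y * x) : QComm q 0 x y := by
  rw [QComm, AddChar.map_zero_eq_one, one_smul, h]

theorem QComm.mul_right (h : QComm q c x y) (h' : QComm q d x z) : QComm q (c + d) x (y * z) := by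
  unfold QComm at *
  rw [← mul_assoc, h, smul_mul_assoc, mul_assoc, h', mul_smul_comm, smul_smul,
    ← AddChar.map_add_eq_mul, mul_assoc]

theorem QComm.mul_left (h : QComm q c x z) (h' : QComm q d y z) : QComm q (c + d) (x * y) z := by
  have := (h.symm.mul_right h'.symm).symm
  rwa [neg_add, neg_neg, neg_neg] at this

theorem QComm.pow_right (h : QComm q c x y) (k : ℕ) : QComm q (c * k) x (y ^ k) := by
  induction k with
  | zero => simpa using QComm.of_comm (q := q) (x := x) (y := 1) (by simp)
  | succ k ih =>
    rw [pow_succ, Nat.cast_succ, mul_add, mul_one]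
    exact ih.mul_right h

theorem QComm.pow_left (h : QComm q c x y) (k : ℕ) : QComm q (c * k) (x ^ k) y := by
  have := (h.symm.pow_right k).symm
  rwa [neg_mul, neg_neg] at this

theorem QComm.map {R' : Type*} [Ring R'] [Algebra ℂ R'] (f : R →ₐ[ℂ] R') (h : QComm q c x y) :
    QComm q c (f x) (f y) := by
  unfold QComm at *
  rw [← map_mul, h, map_smul, map_mul]

/-- Sorting `(x y) ^ n` into `x ^ n y ^ n` exchanges a `y` with a later `x` once for each of the
`n.choose 2` pairs. -/
theorem QComm.mul_pow (h : QComm q c x y) (n : ℕ) :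
    (x * y) ^ n = chi q (-c * n.choose 2) • (x ^ n * y ^ n) := by
  induction n with
  | zero => simp
  | succ n ih =>
    have h1 : y ^ n * x = chi q (-(c * n)) • (x * y ^ n) := (h.pow_right n).symm
    rw [pow_succ, ih, smul_mul_assoc, mul_assoc, ← mul_assoc (y ^ n), h1, smul_mul_assoc,
      mul_smul_comm, smul_smul, ← AddChar.map_add_eq_mul, mul_assoc x, ← pow_succ, ← mul_assoc,
      ← pow_succ, Nat.choose_succ_succ' n 1, Nat.choose_one_right]
    congr 2
    push_cast
    ring

/-- The correction factor disappears because `5.choose 2 = 10` is zero in `ZMod 5`. This allows a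
generator to be multiplied by another one of fifth power 1 without a change of its own fifth power.
-/
theorem QComm.mul_pow_five (h : QComm q c x y) : (x * y) ^ 5 = x ^ 5 * y ^ 5 := by
  rw [h.mul_pow]
  have : (-c * ((Nat.choose 5 2 : ℕ) : ZMod 5)) = 0 := by
    have h10 : ((Nat.choose 5 2 : ℕ) : ZMod 5) = 0 := by decide
    rw [h10, mul_zero]
  rw [this, AddChar.map_zero_eq_one, one_smul]

theorem pow_five_pow_val (h : x ^ 5 = 1) (a : ZMod 5) : (x ^ a.val) ^ 5 = 1 := by
  rw [← pow_mul, mul_comm, pow_mul, h, one_pow]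

theorem pow_val_add (h : x ^ 5 = 1) (a b : ZMod 5) : x ^ (a + b).val = x ^ a.val * x ^ b.val := by
  rw [ZMod.val_add, ← pow_add, ← pow_eq_pow_mod _ h]

theorem pow_val_mul (h : x ^ 5 = 1) (a b : ZMod 5) : x ^ (a * b).val = (x ^ a.val) ^ b.val := by
  rw [ZMod.val_mul, ← pow_mul, ← pow_eq_pow_mod _ h]

/-- The relations of a quantum algebra, in terms of `QComm`. -/
theorem QRel.of_qComm {A : Type*} [CommRing A] [Algebra ℂ A] [Algebra A R] [IsScalarTower ℂ A R]
    {n : ℕ} {N : Fin n → Fin n → ZMod 5} {y : Fin n → A} {s : Fin n → R}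
    (h : ∀ i j, QComm q (N i j) (s i) (s j)) (h5 : ∀ i, s i ^ 5 = algebraMap A R (y i)) :
    QRel (chiAlg q A) (algebraMap A R) N y s where
  central := Algebra.commutes
  comm i j := by
    rw [h i j, chiAlg_apply, ← IsScalarTower.algebraMap_apply, Algebra.smul_def]
  pow := h5

theorem QRel.qComm {A : Type*} [CommRing A] [Algebra ℂ A] [Algebra A R] [IsScalarTower ℂ A R]
    {n : ℕ} {N : Fin n → Fin n → ZMod 5} {y : Fin n → A} {s : Fin n → R}
    (h : QRel (chiAlg q A) (algebraMap A R) N y s) (i j : Fin n) :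
    QComm q (N i j) (s i) (s j) := by
  have := h.comm i j
  rwa [chiAlg_apply, ← IsScalarTower.algebraMap_apply, ← Algebra.smul_def] at this

/-! ### Eigenprojections of elements of order five -/

variable (q) in
/-- The eigenprojection of `x` (with `x ^ 5 = 1`) for the eigenvalue `q ^ i`. -/
noncomputable def eigenProj (x : R) (i : ZMod 5) : R :=
  (5⁻¹ : ℂ) • ∑ k : ZMod 5, chi q (-(k * i)) • x ^ k.val

theorem eigenProj_def (x : R) (i : ZMod 5) :
    eigenProj q x i = (5⁻¹ : ℂ) • ∑ k : ZMod 5, chi q (-(k * i)) • x ^ k.val := rfl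

theorem pow_mul_eigenProj (h : x ^ 5 = 1) (i m : ZMod 5) :
    x ^ m.val * eigenProj q x i = chi q (m * i) • eigenProj q x i := by
  rw [eigenProj, mul_smul_comm, smul_comm]
  congr 1
  rw [Finset.mul_sum, Finset.smul_sum]
  rw [← Equiv.sum_comp (Equiv.addLeft m) (fun k => chi q (m * i) • chi q (-(k * i)) • x ^ k.val)]
  refine Finset.sum_congr rfl fun k _ => ?_
  rw [Equiv.coe_addLeft, mul_smul_comm, ← pow_val_add h, smul_smul, ← AddChar.map_add_eq_mul]
  congr 2
  ring

theorem eigenProj_mul (h : x ^ 5 = 1) (i j : ZMod 5) :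
    eigenProj q x i * eigenProj q x j = if i = j then eigenProj q x j else 0 := by
  conv_lhs => rw [eigenProj_def x i]
  rw [smul_mul_assoc, Finset.sum_mul]
  have : ∀ k : ZMod 5, chi q (-(k * i)) • x ^ k.val * eigenProj q x j =
      chi q (k * (j - i)) • eigenProj q x j := by
    intro k
    rw [smul_mul_assoc, pow_mul_eigenProj h, smul_smul, ← AddChar.map_add_eq_mul]
    congr 2
    ring
  simp only [this, ← Finset.sum_smul, chi_sum, sub_eq_zero, eq_comm (a := j)]
  split_ifs
  · rw [smul_smul]; norm_num
  · simp

/-- Fourier inversion on `ZMod 5`; it recovers the powers of `x` from its eigenprojections. -/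
theorem sum_chi_eigenProj (m : ZMod 5) :
    ∑ i, chi q (m * i) • eigenProj q x i = x ^ m.val := by
  simp only [eigenProj, Finset.smul_sum, smul_smul]
  rw [Finset.sum_comm]
  have : ∀ k : ZMod 5, ∑ i : ZMod 5, (chi q (m * i) * (5⁻¹ * chi q (-(k * i)))) • x ^ k.val =
      (if k = m then x ^ k.val else 0) := by
    intro k
    have h1 : ∀ i : ZMod 5, chi q (m * i) * (5⁻¹ * chi q (-(k * i))) =
        5⁻¹ * chi q (i * (m - k)) := by
      intro i
      rw [mul_left_comm, ← AddChar.map_add_eq_mul]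
      congr 2
      ring
    simp only [← Finset.sum_smul, h1, ← Finset.mul_sum, chi_sum, sub_eq_zero, eq_comm (a := m)]
    split_ifs
    · norm_num
    · simp
  simp only [this, Finset.sum_ite_eq', Finset.mem_univ, if_true]

theorem sum_eigenProj : ∑ i, eigenProj q x i = 1 := by
  have := sum_chi_eigenProj (q := q) (x := x) 0
  simpa using this

/-- An element that commutes with `x` up to `q ^ c` shifts the eigenvalues of `x`. This is how
commutation relations turn into sources and targets of arrows: the eigenprojections of `x` play the
vertices and `y` a sum of arrows. -/
theorem eigenProj_mul_qComm (h : QComm q c x y) (i : ZMod 5) :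
    eigenProj q x (i + c) * y = y * eigenProj q x i := by
  rw [eigenProj, eigenProj, smul_mul_assoc, mul_smul_comm, Finset.sum_mul, Finset.mul_sum]
  congr 1
  refine Finset.sum_congr rfl fun k _ => ?_
  have h1 : x ^ k.val * y = chi q (c * (k.val : ZMod 5)) • (y * x ^ k.val) := h.pow_left k.val
  rw [smul_mul_assoc, h1, smul_smul, ← AddChar.map_add_eq_mul, mul_smul_comm,
    ZMod.natCast_zmod_val]
  congr 2
  ring

end QComm

/-! ### The Jacobi algebra as a quantum algebra -/

section Jac

variable {R : Type*} [Ring R] [Algebra ℂ R]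

/-- The images of the generators of the path algebra under a representation. -/
noncomputable def pathGen (E : ZMod 5 → R) (u v w : R) : ZMod 5 ⊕ Arr → R
  | .inl i => E i
  | .inr (.a i) => u * E i
  | .inr (.b i) => v * E i
  | .inr (.c i) => w * E i

/-- The homomorphism out of the path algebra given by orthogonal idempotents `E_i` and elements
`u, v, w` that shift them. -/
theorem exists_pathLift (E : ZMod 5 → R) (u v w : R)
    (hE : ∀ i j, E i * E j = if i = j then E j else 0) (h1 : ∑ i, E i = 1)
    (hu : ∀ i, E (i + 3) * u = u * E i) (hv : ∀ i, E (i + 4) * v = v * E i)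
    (hw : ∀ i, E (i + 3) * w = w * E i) :
    ∃ f : quiver.PathAlgebra →ₐ[ℂ] R, (∀ i, f (quiver.vertex i) = E i) ∧
      ∀ x, f (quiver.arrow x) = pathGen E u v w (.inr x) := by
  have hii : ∀ i, E i * E i = E i := fun i => by rw [hE, if_pos rfl]
  let F : FreeAlgebra ℂ (ZMod 5 ⊕ Arr) →ₐ[ℂ] R := FreeAlgebra.lift ℂ (pathGen E u v w)
  have hF : ∀ x, F (FreeAlgebra.ι ℂ x) = pathGen E u v w x := fun x => FreeAlgebra.lift_ι_apply _ _
  have hrel : ∀ ⦃x y⦄, quiver.PathRel x y → F x = F y := by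
    intro x y h
    induction h with
    | idem i => rw [map_mul, hF]; exact hii i
    | orth i j h => rw [map_mul, hF, hF, map_zero]; exact (hE i j).trans (if_neg h)
    | unit => rw [map_sum, map_one, ← h1]; exact Finset.sum_congr rfl fun i _ => hF _
    | tgt x =>
      rw [map_mul, hF, hF]
      cases x with
      | a i => change E (i + 3) * (u * E i) = u * E i; rw [← mul_assoc, hu, mul_assoc, hii]
      | b i => change E (i + 4) * (v * E i) = v * E i; rw [← mul_assoc, hv, mul_assoc, hii]
      | c i => change E (i + 3) * (w * E i) = w * E i; rw [← mul_assoc, hw, mul_assoc, hii]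
    | src x =>
      rw [map_mul, hF, hF]
      cases x with
      | a i => change u * E i * E i = u * E i; rw [mul_assoc, hii]
      | b i => change v * E i * E i = v * E i; rw [mul_assoc, hii]
      | c i => change w * E i * E i = w * E i; rw [mul_assoc, hii]
  refine ⟨RingQuot.liftAlgHom ℂ ⟨F, hrel⟩, fun i => ?_, fun x => ?_⟩
  · exact (RingQuot.liftAlgHom_mkAlgHom_apply ℂ F hrel _).trans (hF _)
  · exact (RingQuot.liftAlgHom_mkAlgHom_apply ℂ F hrel _).trans (hF _)

theorem pathDeriv_three (x y₁ y₂ y₃ : Arr) : quiver.pathDeriv x [y₁, y₂, y₃] =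
    (if y₁ = x then quiver.arrow y₂ * quiver.arrow y₃ else 0) +
    (if y₂ = x then quiver.arrow y₃ * quiver.arrow y₁ else 0) +
    (if y₃ = x then quiver.arrow y₁ * quiver.arrow y₂ else 0) := by
  simp [FiniteQuiver.pathDeriv, Fin.sum_univ_succ, add_assoc]

/-- Put `a_i = u E_i`, `b_i = v E_i`, `c_i = w E_i`. The derivatives of the potential by `a_i`,
`b_i`, `c_i` then reduce, respectively, to the relation between `w` and `v`, between `u` and `w`,
and between `v` and `u`, multiplied by an idempotent. -/
theorem exists_jacLift (E : ZMod 5 → R) (u v w : R)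
    (hE : ∀ i j, E i * E j = if i = j then E j else 0) (h1 : ∑ i, E i = 1)
    (hu : ∀ i, E (i + 3) * u = u * E i) (hv : ∀ i, E (i + 4) * v = v * E i)
    (hw : ∀ i, E (i + 3) * w = w * E i)
    (hvu : QComm q 1 v u) (hwv : QComm q 2 w v) (huw : QComm q 4 u w) :
    ∃ f : JacQW q →ₐ[ℂ] R, (∀ i, f (jE q i) = E i) ∧ f (jU q) = u ∧ f (jV q) = v ∧
      f (jW q) = w := by
  obtain ⟨f, hfE, hfA⟩ := exists_pathLift E u v w hE h1 hu hv hw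
  have hii : ∀ i, E i * E i = E i := fun i => by rw [hE, if_pos rfl]
  have hrel : ∀ x, f (quiver.cyclicDeriv x (potential q)) = 0 := by
    intro x
    have hqv : ∀ k : ZMod 5, q ^ k.val = chi q k := fun k => (chi_apply q k).symm
    have hq4 : q ^ 4 = chi q 4 := (chi_apply q 4).symm
    have hfa : ∀ i, f (quiver.arrow (.a i)) = u * E i := fun i => hfA _
    have hfb : ∀ i, f (quiver.arrow (.b i)) = v * E i := fun i => hfA _
    have hfc : ∀ i, f (quiver.arrow (.c i)) = w * E i := fun i => hfA _
    have hw' : ∀ k, E (k + 3) * (w * E k) = w * E k := fun k => by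
      rw [← mul_assoc, hw, mul_assoc, hii]
    have hu' : ∀ k, E (k + 3) * (u * E k) = u * E k := fun k => by
      rw [← mul_assoc, hu, mul_assoc, hii]
    have hv' : ∀ k, E (k + 2) * (v * E (k + 3)) = v * E (k + 3) := fun k => by
      have := hv (k + 3)
      rw [show k + 3 + 4 = k + 2 by ring_nf; congr 1] at this
      rw [← mul_assoc, this, mul_assoc, hii]
    have hw'' : ∀ k, E (k + 1) * (w * E (k + 3)) = w * E (k + 3) := fun k => by
      have := hw' (k + 3)
      rwa [show k + 3 + 3 = k + 1 by ring_nf; congr 1] at this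
    have hu'' : ∀ k, E (k + 1) * (u * E (k + 3)) = u * E (k + 3) := fun k => by
      have := hu' (k + 3)
      rwa [show k + 3 + 3 = k + 1 by ring_nf; congr 1] at this
    have e2 : ∀ k : ZMod 5, k + 2 + 1 = k + 3 := fun k => by ring
    let Z : Arr → R := fun x => f (quiver.arrow x)
    let D : Arr → Arr → Arr → Arr → R := fun x y₁ y₂ y₃ =>
      (if y₁ = x then Z y₂ * Z y₃ else 0) + (if y₂ = x then Z y₃ * Z y₁ else 0) +
        (if y₃ = x then Z y₁ * Z y₂ else 0)
    have hD : ∀ x y₁ y₂ y₃ : Arr, f (quiver.pathDeriv x [y₁, y₂, y₃]) = D x y₁ y₂ y₃ := by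
      intro x y₁ y₂ y₃
      rw [pathDeriv_three]
      simp only [map_add, apply_ite f, map_mul, map_zero]
      rfl
    have hsum : f (quiver.cyclicDeriv x (potential q)) = ∑ i : ZMod 5,
        (q ^ i.val • D x (Arr.b (i + 1)) (Arr.a (i + 3)) (Arr.c i) -
        (q ^ 4 * q ^ i.val) • D x (Arr.b (i + 1)) (Arr.c (i + 3)) (Arr.a i)) := by
      simp only [FiniteQuiver.cyclicDeriv, potential, map_sum, map_sub,
        Finsupp.linearCombination_single, map_smul]
      refine Finset.sum_congr rfl fun i _ => ?_
      rw [hD, hD]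
    have hZa : ∀ i, Z (.a i) = u * E i := hfa
    have hZb : ∀ i, Z (.b i) = v * E i := hfb
    have hZc : ∀ i, Z (.c i) = w * E i := hfc
    rw [hsum]
    simp only [D, hZa, hZb, hZc]
    cases x with
    | a k =>
      simp only [Arr.a.injEq, shift_iff, reduceCtorEq, if_false, add_zero, zero_add,
        smul_ite, smul_zero, Finset.sum_sub_distrib, Finset.sum_ite_eq', Finset.mem_univ,
        if_true, hqv, hq4, e2]
      -- The inner idempotents are absorbed, so that both paths become a product of two of `u, v, w`
      -- times the idempotent at their common source; what remains is an identity of exponents in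
      -- `ZMod 5`.
      rw [mul_assoc w, hv', mul_assoc v, hw'', ← mul_assoc, ← mul_assoc, hwv, smul_mul_assoc,
        smul_smul, ← AddChar.map_add_eq_mul, ← AddChar.map_add_eq_mul, sub_eq_zero]
      congr 2
      clear hsum
      revert k; decide
    | b k =>
      -- The arrows `b` occur in the potential with index `i + 1`, so this substitution picks out
      -- the term `i = l` of the sum.
      obtain ⟨k, rfl⟩ : ∃ l, k = l + 1 := ⟨k - 1, by ring⟩
      simp only [Arr.b.injEq, add_left_inj, reduceCtorEq, if_false, add_zero,
        smul_ite, smul_zero, Finset.sum_sub_distrib, Finset.sum_ite_eq', Finset.mem_univ,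
        if_true, hqv, hq4]
      rw [mul_assoc u, hw', mul_assoc w, hu', ← mul_assoc, ← mul_assoc, huw, smul_mul_assoc,
        smul_smul, ← AddChar.map_add_eq_mul, ← AddChar.map_add_eq_mul, sub_eq_zero]
      congr 2
      ring
    | c k =>
      simp only [Arr.c.injEq, shift_iff, reduceCtorEq, if_false, add_zero, zero_add,
        smul_ite, smul_zero, Finset.sum_sub_distrib, Finset.sum_ite_eq', Finset.mem_univ,
        if_true, hqv, hq4, e2]
      rw [mul_assoc u, hv', mul_assoc v, hu'', ← mul_assoc, ← mul_assoc, hvu, smul_mul_assoc,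
        smul_smul, ← AddChar.map_add_eq_mul, ← AddChar.map_add_eq_mul, sub_eq_zero]
      congr 2
      clear hsum
      revert k; decide
  let g : JacQW q →ₐ[ℂ] R := RingQuot.liftAlgHom ℂ ⟨f, by
    rintro _ _ ⟨x⟩
    rw [hrel, map_zero]⟩
  have hg : ∀ x, g (toJacQW q x) = f x := fun x => RingQuot.liftAlgHom_mkAlgHom_apply ℂ f _ _
  refine ⟨g, fun i => (hg _).trans (hfE i), ?_, ?_, ?_⟩
  · rw [jU, map_sum, ← mul_one u, ← h1, Finset.mul_sum]
    exact Finset.sum_congr rfl fun i _ => (hg _).trans (hfA _)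
  · rw [jV, map_sum, ← mul_one v, ← h1, Finset.mul_sum]
    exact Finset.sum_congr rfl fun i _ => (hg _).trans (hfA _)
  · rw [jW, map_sum, ← mul_one w, ← h1, Finset.mul_sum]
    exact Finset.sum_congr rfl fun i _ => (hg _).trans (hfA _)

/-- The element `∑ q^i e_i` of the Jacobi algebra. -/
noncomputable def jG : JacQW q := ∑ i, chi q i • jE q i

theorem jG_pow (k : ℕ) : jG q ^ k = ∑ i, chi q (k * i) • jE q i := by
  induction k with
  | zero => simp [sum_jE]
  | succ k ih =>
    rw [pow_succ, ih, jG, Finset.sum_mul]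
    refine Finset.sum_congr rfl fun i _ => ?_
    rw [Finset.mul_sum, Finset.sum_eq_single i]
    · rw [smul_mul_smul_comm, jE_mul_self, ← AddChar.map_add_eq_mul]
      congr 2
      push_cast
      ring
    · intro j _ hj
      rw [smul_mul_smul_comm, jE_mul_ne q hj.symm, smul_zero]
    · simp

theorem jG_pow_five : jG q ^ 5 = 1 := by
  rw [jG_pow, ← sum_jE q]
  refine Finset.sum_congr rfl fun i _ => ?_
  have : ((5 : ℕ) : ZMod 5) = 0 := rfl
  rw [this, zero_mul, AddChar.map_zero_eq_one, one_smul]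

/-- The vertex idempotents are thus polynomials in `g`, so `g` can replace all of them as a
generator. -/
theorem eigenProj_jG (i : ZMod 5) : eigenProj q (jG q) i = jE q i := by
  simp only [eigenProj, jG_pow, Finset.smul_sum, smul_smul, ZMod.natCast_zmod_val]
  rw [Finset.sum_comm, Finset.sum_eq_single i]
  · rw [← Finset.sum_smul]
    have : ∀ k : ZMod 5, (5⁻¹ : ℂ) * (chi q (-(k * i)) * chi q (k * i)) = 5⁻¹ := by
      intro k
      rw [← AddChar.map_add_eq_mul, neg_add_cancel, AddChar.map_zero_eq_one, mul_one]
    simp [this]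
  · intro j _ hj
    rw [← Finset.sum_smul]
    have : ∀ k : ZMod 5, (5⁻¹ : ℂ) * (chi q (-(k * i)) * chi q (k * j)) =
        5⁻¹ * chi q (k * (j - i)) := by
      intro k
      rw [← AddChar.map_add_eq_mul]
      congr 2
      ring
    simp only [this, ← Finset.mul_sum, chi_sum, sub_eq_zero, if_neg hj, mul_zero, zero_smul]
  · simp

/-- Converse of `eigenProj_mul_qComm`: an element that shifts the vertices by `s` multiplies the
eigenvalue of `g` by `q ^ s`. -/
theorem jG_qComm {z : JacQW q} (s : ZMod 5) (h : ∀ i, jE q (i + s) * z = z * jE q i) :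
    QComm q s (jG q) z := by
  rw [QComm, jG, Finset.sum_mul, Finset.mul_sum, Finset.smul_sum,
    ← Equiv.sum_comp (Equiv.addRight s)]
  refine Finset.sum_congr rfl fun i _ => ?_
  rw [Equiv.coe_addRight, smul_mul_assoc, h, mul_smul_comm, smul_smul, ← AddChar.map_add_eq_mul,
    add_comm]

theorem jE_mul_jU (i : ZMod 5) : jE q (i + 3) * jU q = jU q * jE q i :=
  (jE_mul_sum q 3 (jA_tgt q) i).trans (sum_mul_jE q (jA_src q) i).symm
theorem jE_mul_jV (i : ZMod 5) : jE q (i + 4) * jV q = jV q * jE q i :=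
  (jE_mul_sum q 4 (jB_tgt q) i).trans (sum_mul_jE q (jB_src q) i).symm
theorem jE_mul_jW (i : ZMod 5) : jE q (i + 3) * jW q = jW q * jE q i :=
  (jE_mul_sum q 3 (jC_tgt q) i).trans (sum_mul_jE q (jC_src q) i).symm

instance : IsScalarTower ℂ P (JacQW q) :=
  IsScalarTower.of_algebraMap_eq fun c => by
    change _ = ((jacStructure q (MvPolynomial.C c) : Subalgebra.center ℂ (JacQW q)) : JacQW q)
    rw [← MvPolynomial.algebraMap_eq, AlgHom.commutes]
    rfl

theorem algebraMap_jac (k : Fin 3) : algebraMap P (JacQW q) (MvPolynomial.X k) =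
    ![jU q ^ 5, jV q ^ 5, jW q ^ 5] k := by
  change ((jacStructure q (MvPolynomial.X k) : Subalgebra.center ℂ (JacQW q)) : JacQW q) = _
  rw [jacStructure, MvPolynomial.aeval_X]
  fin_cases k <;> rfl

/-- The exponents in the commutation relations between `g`, `u`, `v`, `w` in the Jacobi algebra,
where `g = ∑ q^i e_i`. -/
def jacExp : Fin 4 → Fin 4 → ZMod 5 := ![![0, 3, 4, 3], ![-3, 0, -1, 4], ![-4, 1, 0, -2],
  ![-3, -4, 2, 0]]

/-- The elements `g`, `u`, `v`, `w` of the Jacobi algebra. -/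
noncomputable def jacGen : Fin 4 → JacQW q := ![jG q, jU q, jV q, jW q]

/-- The fifth powers of `g`, `u`, `v`, `w`. -/
noncomputable def jacPow : Fin 4 → P := ![1, MvPolynomial.X 0, MvPolynomial.X 1, MvPolynomial.X 2]

theorem qComm_self {R : Type*} [Ring R] [Algebra ℂ R] (x : R) : QComm q 0 x x :=
  QComm.of_comm rfl

theorem jac_qrel : QRel (chiAlg q P) (algebraMap P (JacQW q)) jacExp jacPow (jacGen q) := by
  have hgu : QComm q 3 (jG q) (jU q) := jG_qComm q 3 (jE_mul_jU q)
  have hgv : QComm q 4 (jG q) (jV q) := jG_qComm q 4 (jE_mul_jV q)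
  have hgw : QComm q 3 (jG q) (jW q) := jG_qComm q 3 (jE_mul_jW q)
  have hvu : QComm q 1 (jV q) (jU q) := by
    rw [QComm, jV_mul_jU, chi_apply]; congr 1; exact (pow_one q).symm
  have hwv : QComm q 2 (jW q) (jV q) := by
    rw [QComm, jW_mul_jV, chi_apply]; rfl
  have huw : QComm q 4 (jU q) (jW q) := by
    rw [QComm, jU_mul_jW, chi_apply]; rfl
  refine QRel.of_qComm (fun i j => ?_) (fun i => ?_)
  · fin_cases i <;> fin_cases j
    · exact qComm_self q _
    · exact hgu
    · exact hgv
    · exact hgw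
    · exact hgu.symm
    · exact qComm_self q _
    · exact hvu.symm
    · exact huw
    · exact hgv.symm
    · exact hvu
    · exact qComm_self q _
    · exact hwv.symm
    · exact hgw.symm
    · exact huw.symm
    · exact hwv
    · exact qComm_self q _
  · fin_cases i
    · exact (jG_pow_five q).trans (map_one _).symm
    · exact (algebraMap_jac q 0).symm
    · exact (algebraMap_jac q 1).symm
    · exact (algebraMap_jac q 2).symm

/-- Subrings that contain the scalars from a `ℂ`-algebra are closed under multiplication by
complex numbers. -/
theorem smul_mem_of_range {A : Type*} [CommRing A] [Algebra ℂ A] [Algebra A R]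
    [IsScalarTower ℂ A R] {S : Subring R} (hS : Set.range (algebraMap A R) ⊆ S) (c : ℂ) {x : R}
    (hx : x ∈ S) : c • x ∈ S := by
  rw [Algebra.smul_def, IsScalarTower.algebraMap_apply ℂ A R]
  exact S.mul_mem (hS ⟨_, rfl⟩) hx

theorem eigenProj_mem {A : Type*} [CommRing A] [Algebra ℂ A] [Algebra A R]
    [IsScalarTower ℂ A R] {S : Subring R} (hS : Set.range (algebraMap A R) ⊆ S) {x : R}
    (hx : x ∈ S) (i : ZMod 5) : eigenProj q x i ∈ S :=
  smul_mem_of_range hS _ (S.sum_mem fun _ _ => smul_mem_of_range hS _ (S.pow_mem hx _))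

/-- Each arrow is `u`, `v` or `w` times a vertex idempotent, and the idempotents are
eigenprojections of `g`. -/
theorem jac_mem_of_gen {S : Subring (JacQW q)} (hS : Set.range (algebraMap P (JacQW q)) ⊆ S)
    (hG : jG q ∈ S) (hU : jU q ∈ S) (hV : jV q ∈ S) (hW : jW q ∈ S) (z : JacQW q) : z ∈ S := by
  have hE : ∀ i, jE q i ∈ S := fun i => by
    rw [← eigenProj_jG]; exact eigenProj_mem q hS hG i
  let S' : Subalgebra ℂ (JacQW q) :=
    { S with
      algebraMap_mem' := fun c => by
        rw [IsScalarTower.algebraMap_apply ℂ P (JacQW q)]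
        exact hS ⟨_, rfl⟩ }
  refine jac_induction q S' hE (fun i => ?_) (fun i => ?_) (fun i => ?_) z
  · rw [← sum_mul_jE q (jA_src q) i]; exact S.mul_mem hU (hE i)
  · rw [← sum_mul_jE q (jB_src q) i]; exact S.mul_mem hV (hE i)
  · rw [← sum_mul_jE q (jC_src q) i]; exact S.mul_mem hW (hE i)

theorem jacExp_alt : (∀ i, jacExp i i = 0) ∧ ∀ i j, jacExp j i = -jacExp i j := by
  constructor <;> decide

/-- The relations alone give that the monomials span. For independence, the Jacobi algebra is made
to act on the regular representation: the eigenprojections of the operator of `g` serve as vertex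
idempotents, and `exists_jacLift` asks for nothing beyond the commutation relations. In particular
the Jacobi algebra is free of rank 625 over `ℂ[x, y, z]`. -/
theorem jac_isFrame : IsFrame (chiAlg q P) (algebraMap P (JacQW q)) jacExp jacPow (jacGen q) := by
  have hm := model_qrel (chiAlg q P) jacExp jacPow jacExp_alt.1 jacExp_alt.2
  have hg5 : modelOp (chiAlg q P) jacExp jacPow 0 ^ 5 = 1 := by
    rw [hm.pow]; exact map_one _
  have hc := fun i j => hm.qComm i j
  obtain ⟨f, hfE, hfU, hfV, hfW⟩ := exists_jacLift q
    (eigenProj q (modelOp (chiAlg q P) jacExp jacPow 0)) (modelOp (chiAlg q P) jacExp jacPow 1)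
    (modelOp (chiAlg q P) jacExp jacPow 2) (modelOp (chiAlg q P) jacExp jacPow 3)
    (eigenProj_mul hg5) sum_eigenProj (fun i => eigenProj_mul_qComm (hc 0 1) i)
    (fun i => eigenProj_mul_qComm (hc 0 2) i) (fun i => eigenProj_mul_qComm (hc 0 3) i)
    (hc 2 1) (hc 3 2) (hc 1 3)
  refine (jac_qrel q).isFrame_of_hom ?_ jacExp_alt.1 jacExp_alt.2 f.toRingHom ?_ ?_
  · refine eq_top_iff.mpr fun z _ => ?_
    have hs : ∀ i, jacGen q i ∈ Subring.closure
        (Set.range (algebraMap P (JacQW q)) ∪ Set.range (jacGen q)) :=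
      fun i => Subring.subset_closure (Or.inr ⟨i, rfl⟩)
    exact jac_mem_of_gen q (fun x hx => Subring.subset_closure (Or.inl hx)) (hs 0) (hs 1) (hs 2)
      (hs 3) z
  · intro p
    have : f.toRingHom.comp (algebraMap P (JacQW q)) = modelScalar P 4 := by
      refine MvPolynomial.ringHom_ext (fun c => ?_) (fun k => ?_)
      · change f (algebraMap P (JacQW q) (algebraMap ℂ P c)) =
          algebraMap P _ (algebraMap ℂ P c)
        rw [← IsScalarTower.algebraMap_apply, ← IsScalarTower.algebraMap_apply, AlgHom.commutes]
      · change f (algebraMap P (JacQW q) (MvPolynomial.X k)) = _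
        rw [algebraMap_jac]
        fin_cases k
        · exact (map_pow f _ _).trans ((congrArg (· ^ 5) hfU).trans (hm.pow 1))
        · exact (map_pow f _ _).trans ((congrArg (· ^ 5) hfV).trans (hm.pow 2))
        · exact (map_pow f _ _).trans ((congrArg (· ^ 5) hfW).trans (hm.pow 3))
    exact DFunLike.congr_fun this p
  · intro i
    fin_cases i
    · change f (jG q) = _
      rw [jG, map_sum]
      simp only [map_smul, hfE]
      have := sum_chi_eigenProj (q := q) (x := modelOp (chiAlg q P) jacExp jacPow 0) 1
      simp only [one_mul] at this
      exact this.trans (pow_one _)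
    · exact hfU
    · exact hfV
    · exact hfW

end Jac

end QuantumFermat

namespace QuantumFermat

variable (q : ℂ) [Fact (IsPrimitiveRoot q 5)]

/-! ### Changing the generators of the Jacobi algebra -/

section Change

variable {R : Type*} [Ring R]

/-- New generators of a framed algebra that satisfy relations of the same kind form a frame. -/
theorem IsFrame.change {A : Type*} [CommRing A] [Algebra A R] {n : ℕ} {κ : AddChar (ZMod 5) A}
    {N N' : Fin n → Fin n → ZMod 5} {y y' : Fin n → A} {s s' : Fin n → R}
    (h : IsFrame κ (algebraMap A R) N y s) (h' : QRel κ (algebraMap A R) N' y' s')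
    (hs : ∀ i, s i ∈ Subring.closure (Set.range (algebraMap A R) ∪ Set.range s')) :
    IsFrame κ (algebraMap A R) N' y' s' := by
  -- The old frame only supplies the rank; that the new elements generate is then enough.
  refine h'.isFrame_of_equiv (eq_top_iff.mpr fun r _ => ?_) h.basis.equivFun
  obtain ⟨f, rfl⟩ := h.bij.2 r
  refine Subring.sum_mem _ fun e _ => Subring.mul_mem _ (Subring.subset_closure (Or.inl ⟨_, rfl⟩))
    (Subring.list_prod_mem _ fun x hx => ?_)
  obtain ⟨i, rfl⟩ := List.mem_ofFn.mp hx
  exact Subring.pow_mem _ (hs i) _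

variable [Algebra ℂ R]

variable {q} in
theorem QComm.congr {c d : ZMod 5} {x y : R} (h : QComm q c x y) (e : c = d) : QComm q d x y :=
  e ▸ h

variable {q} in
theorem qComm_four {N : Fin 4 → Fin 4 → ZMod 5} (h0 : ∀ i, N i i = 0)
    (hN : ∀ i j, N j i = -N i j) {s : Fin 4 → R} (h01 : QComm q (N 0 1) (s 0) (s 1))
    (h02 : QComm q (N 0 2) (s 0) (s 2)) (h03 : QComm q (N 0 3) (s 0) (s 3))
    (h12 : QComm q (N 1 2) (s 1) (s 2)) (h13 : QComm q (N 1 3) (s 1) (s 3))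
    (h23 : QComm q (N 2 3) (s 2) (s 3)) (i j : Fin 4) : QComm q (N i j) (s i) (s j) := by
  have key : ∀ i j : Fin 4, i < j → QComm q (N i j) (s i) (s j) := by
    intro i j hij
    fin_cases i <;> fin_cases j <;> first | assumption | exact absurd hij (by decide)
  rcases lt_trichotomy i j with h | rfl | h
  · exact key i j h
  · rw [h0]; exact qComm_self q _
  · rw [hN j i]; exact (key j i h).symm

end Change

/-- The relations of the Jacobi algebra can be brought to any form with the same invariants. -/
theorem exists_jac_frame {N : Fin 4 → Fin 4 → ZMod 5} (h0 : ∀ i, N i i = 0)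
    (hN : ∀ i j, N j i = -N i j) {a : ZMod 5} (ha : a ≠ 0) (h1 : N 0 1 = 3 * a)
    (h2 : N 0 2 = 4 * a) (h3 : N 0 3 = 3 * a)
    (hpf : N 0 1 * N 2 3 - N 0 2 * N 1 3 + N 0 3 * N 1 2 = 0) :
    ∃ s, IsFrame (chiAlg q P) (algebraMap P (JacQW q)) N jacPow s := by
  have h5 : (5 : ZMod 5) = 0 := rfl
  obtain ⟨b, hb⟩ : ∃ b : ZMod 5, a * b = 1 := by
    clear h1 h2 h3 hpf
    revert a; decide
  -- The Pfaffian relation with the first row inserted, multiplied by `2 * b` to cancel `a` and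
  -- reduced modulo 5.
  have hrel : N 1 2 + N 2 3 - 3 * N 1 3 = 0 := by
    rw [h1, h2, h3] at hpf
    linear_combination 2 * b * hpf - (6 * (N 2 3 + N 1 2) - 8 * N 1 3) * hb -
      (N 2 3 + N 1 2 - N 1 3) * h5
  have hq := fun i j => (jac_qrel q).qComm i j
  have hgu : QComm q 3 (jG q) (jU q) := hq 0 1
  have hgv : QComm q 4 (jG q) (jV q) := hq 0 2
  have hgw : QComm q 3 (jG q) (jW q) := hq 0 3
  have huv : QComm q (-1) (jU q) (jV q) := hq 1 2
  have huw : QComm q 4 (jU q) (jW q) := hq 1 3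
  have hvw : QComm q (-2) (jV q) (jW q) := hq 2 3
  have hgg := qComm_self q (jG q)
  -- Solves `4 + 3 * j = N 1 3`, where `2` is the inverse of `3`; likewise `k` solves `-2 + 3 * k =
  -- N 2 3`. No freedom remains for `N 1 2`.
  set j : ZMod 5 := 2 * (N 1 3 - 4) with hj
  set k : ZMod 5 := 2 * (2 + N 2 3) with hk
  have hg5 := jG_pow_five q
  let s : Fin 4 → JacQW q := ![jG q ^ a.val, jU q * jG q ^ j.val, jV q * jG q ^ k.val, jW q]
  refine ⟨s, (jac_isFrame q).change (QRel.of_qComm (qComm_four h0 hN ?_ ?_ ?_ ?_ ?_ ?_) ?_) ?_⟩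
  · refine ((hgu.mul_right (hgg.pow_right j.val)).pow_left a.val).congr ?_
    simp only [ZMod.natCast_zmod_val]
    rw [h1]; ring
  · refine ((hgv.mul_right (hgg.pow_right k.val)).pow_left a.val).congr ?_
    simp only [ZMod.natCast_zmod_val]
    rw [h2]; ring
  · refine (hgw.pow_left a.val).congr ?_
    simp only [ZMod.natCast_zmod_val]
    rw [h3]
  · refine ((huv.mul_right (hgu.symm.pow_right k.val)).mul_left
      ((hgv.mul_right (hgg.pow_right k.val)).pow_left j.val)).congr ?_
    simp only [ZMod.natCast_zmod_val]
    rw [hj, hk]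
    -- The exponent `-1 - 3 * k + 4 * j` is determined by the choices of `j` and `k`; the vanishing
    -- Pfaffian says that it is the required one.
    linear_combination -hrel + (N 1 3 - N 2 3 - 9) * h5
  · refine (huw.mul_left (hgw.pow_left j.val)).congr ?_
    simp only [ZMod.natCast_zmod_val]
    rw [hj]
    linear_combination (N 1 3 - 4) * h5
  · refine (hvw.mul_left (hgw.pow_left k.val)).congr ?_
    simp only [ZMod.natCast_zmod_val]
    rw [hk]
    linear_combination (N 2 3 + 2) * h5
  · intro i
    fin_cases i
    · exact (pow_five_pow_val hg5 a).trans (map_one _).symm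
    · refine (hgu.symm.pow_right j.val).mul_pow_five.trans ?_
      rw [pow_five_pow_val hg5, mul_one]
      exact (jac_qrel q).pow 1
    · refine (hgv.symm.pow_right k.val).mul_pow_five.trans ?_
      rw [pow_five_pow_val hg5, mul_one]
      exact (jac_qrel q).pow 2
    · exact (jac_qrel q).pow 3
  · set S := Subring.closure (Set.range (algebraMap P (JacQW q)) ∪ Set.range s)
    have hs : ∀ i, s i ∈ S := fun i => Subring.subset_closure (Or.inr ⟨i, rfl⟩)
    -- Since `a * b = 1` and `g ^ 5 = 1`, the power `b` of `g ^ a` is `g`; afterwards the powers of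
    -- `g` can be divided out of the other generators.
    have hG : jG q ∈ S := by
      have := S.pow_mem (hs 0) b.val
      change (jG q ^ a.val) ^ b.val ∈ S at this
      rwa [← pow_val_mul hg5, hb, show (1 : ZMod 5).val = 1 from rfl, pow_one] at this
    have hinv : ∀ (z : JacQW q) (c : ZMod 5), z * jG q ^ c.val ∈ S → z ∈ S := by
      intro z c hz
      have := S.mul_mem hz (S.pow_mem hG (-c).val)
      rwa [mul_assoc, ← pow_val_add hg5, add_neg_cancel, ZMod.val_zero, pow_zero, mul_one] at this
    intro i
    fin_cases i
    · exact hG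
    · exact hinv _ j (hs 1)
    · exact hinv _ k (hs 2)
    · exact hs 3

/-! ### Matrix algebras as quantum algebras -/

section Clock

theorem eigenProj_map {R R' : Type*} [Ring R] [Algebra ℂ R] [Ring R'] [Algebra ℂ R']
    (f : R →ₐ[ℂ] R') (x : R) (i : ZMod 5) : f (eigenProj q x i) = eigenProj q (f x) i := by
  simp [eigenProj]

theorem chi_smul_one_pow {D : Type*} [Ring D] [Algebra ℂ D] (a : ZMod 5) (k : ℕ) :
    (chi q a • (1 : D)) ^ k = chi q (k * a) • (1 : D) := by
  rw [smul_pow, one_pow, ← AddChar.map_nsmul_eq_pow, nsmul_eq_mul]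

theorem eigenProj_pi {ι D : Type*} [Ring D] [Algebra ℂ D] (g : ι → ZMod 5) (k : ZMod 5) :
    eigenProj q (fun i => chi q (g i) • (1 : D)) k = fun i => if g i = k then 1 else 0 := by
  ext i
  simp only [eigenProj, Pi.smul_apply, Finset.sum_apply, Pi.pow_apply, chi_smul_one_pow,
    smul_smul, ZMod.natCast_zmod_val, ← AddChar.map_add_eq_mul, ← Finset.sum_smul]
  have : ∀ l : ZMod 5, -(l * k) + l * g i = l * (g i - k) := fun l => by ring
  simp only [this, chi_sum, sub_eq_zero]
  split_ifs <;> simp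

/-- The five by five matrices, with indices in `ℤ/5`. -/
abbrev MZ : Type := Matrix (ZMod 5) (ZMod 5) ℂ

/-- The clock matrix with entries `q ^ (c i)`. -/
noncomputable def clockMat (c : ZMod 5) : MZ :=
  Matrix.diagonal fun i => chi q (c * i)

/-- The shift matrix. -/
noncomputable def shiftMat : MZ := Matrix.of fun i j => if i = j + 1 then 1 else 0

theorem shiftMat_pow (k : ℕ) :
    shiftMat ^ k = Matrix.of fun i j : ZMod 5 => if i = j + k then 1 else 0 := by
  induction k with
  | zero => ext i j; simp [Matrix.one_apply]
  | succ k ih =>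
    rw [pow_succ, ih]
    ext i j
    rw [Matrix.mul_apply, Finset.sum_eq_single (j + 1)]
    · simp [shiftMat, add_assoc, add_comm (k : ZMod 5)]
    · intro l _ hl
      simp [shiftMat, hl]
    · simp

theorem shiftMat_pow_five : shiftMat ^ 5 = 1 := by
  rw [shiftMat_pow]
  ext i j
  have : (5 : ZMod 5) = 0 := rfl
  simp [Matrix.one_apply, this]

theorem clockMat_pow_five (c : ZMod 5) : clockMat q c ^ 5 = 1 := by
  rw [clockMat, Matrix.diagonal_pow, ← Matrix.diagonal_one]
  congr 1
  ext i
  have : ((5 : ℕ) : ZMod 5) = 0 := rfl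
  rw [Pi.pow_apply, ← AddChar.map_nsmul_eq_pow, nsmul_eq_mul, this, zero_mul,
    AddChar.map_zero_eq_one]

theorem clockMat_shiftMat (c : ZMod 5) : QComm q c (clockMat q c) shiftMat := by
  rw [QComm, clockMat]
  ext i j
  rw [Matrix.diagonal_mul, Matrix.smul_apply, Matrix.mul_diagonal]
  simp only [shiftMat, Matrix.of_apply]
  split_ifs with h
  · rw [h, mul_one, one_mul, smul_eq_mul, ← AddChar.map_add_eq_mul]
    congr 1
    ring
  · simp

/-- For `c ≠ 0` the diagonal entries of the clock matrix are distinct, so its eigenprojections have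
rank one. -/
theorem eigenProj_clockMat {c : ZMod 5} (hc : c ≠ 0) (j : ZMod 5) :
    eigenProj q (clockMat q c) (c * j) = Matrix.single j j 1 := by
  have h1 : clockMat q c = Matrix.diagonalAlgHom ℂ (fun i => chi q (c * i) • (1 : ℂ)) := by
    simp [clockMat]
  rw [h1, ← eigenProj_map, eigenProj_pi]
  have hinj : ∀ i j : ZMod 5, c * i = c * j ↔ i = j := by
    clear h1
    revert c; decide
  ext i l
  simp only [hinj, Matrix.diagonalAlgHom_apply, Matrix.diagonal_apply, Matrix.single_apply]
  by_cases h1 : i = l <;> by_cases h2 : i = j <;> simp [h1, h2, eq_comm]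
  all_goals grind

/-- Clock eigenprojections give the diagonal matrix units, and powers of the shift move them to all
other positions. -/
theorem mem_of_clock_shift {c : ZMod 5} (hc : c ≠ 0) {S : Subring MZ}
    (hS : Set.range (algebraMap ℂ MZ) ⊆ S) (hZ : clockMat q c ∈ S) (hX : shiftMat ∈ S)
    (m : MZ) : m ∈ S := by
  have hsing : ∀ i j : ZMod 5, Matrix.single i j (1 : ℂ) ∈ S := by
    intro i j
    have h1 : Matrix.single i j (1 : ℂ) =
        shiftMat ^ (i - j).val * eigenProj q (clockMat q c) (c * j) := by
      rw [eigenProj_clockMat q hc, shiftMat_pow]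
      ext k l
      rw [Matrix.mul_apply, Finset.sum_eq_single j]
      · by_cases h1 : j = l
        · simp [Matrix.single_apply, h1, eq_comm]
        · simp [Matrix.single_apply, h1]
      · intro b _ hb
        simp [Matrix.single_apply, hb.symm]
      · simp
    rw [h1]
    exact S.mul_mem (S.pow_mem hX _) (eigenProj_mem q hS hZ _)
  rw [Matrix.matrix_eq_sum_single m]
  refine S.sum_mem fun i _ => S.sum_mem fun j _ => ?_
  have : Matrix.single i j (m i j) = m i j • Matrix.single i j (1 : ℂ) := by
    rw [Matrix.smul_single, smul_eq_mul, mul_one]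
  rw [this]
  exact smul_mem_of_range hS _ (hsing i j)

end Clock

/-- An algebra generated by five by five matrices and two central elements is a quantum algebra,
for any matrix of exponents with vanishing Pfaffian whose upper left entry does not vanish. -/
theorem exists_matrix_frame {R : Type*} [Ring R] [Algebra ℂ R] [Algebra P R] [IsScalarTower ℂ P R]
    (ι : MZ →ₐ[ℂ] R) (v w : R) (hv : ∀ r, v * r = r * v) (hw : ∀ r, w * r = r * w)
    {yv yw : P} (hv5 : v ^ 5 = algebraMap P R yv) (hw5 : w ^ 5 = algebraMap P R yw)
    (hgen : ∀ S : Subring R, Set.range (algebraMap P R) ⊆ S → (∀ m, ι m ∈ S) → v ∈ S → w ∈ S →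
      ∀ r, r ∈ S)
    {κ : Type*} [Fintype κ] (b : Module.Basis κ P R) (hκ : Fintype.card κ = 625)
    {N : Fin 4 → Fin 4 → ZMod 5} (h0 : ∀ i, N i i = 0)
    (hN : ∀ i j, N j i = -N i j) (h01 : N 0 1 ≠ 0)
    (hpf : N 0 1 * N 2 3 - N 0 2 * N 1 3 + N 0 3 * N 1 2 = 0) :
    ∃ s, IsFrame (chiAlg q P) (algebraMap P R) N ![1, 1, yv, yw] s := by
  obtain ⟨d, hd⟩ : ∃ d : ZMod 5, N 0 1 * d = 1 := by
    clear hpf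
    generalize N 0 1 = c at h01
    revert c; decide
  set c := N 0 1 with hc
  have hZX : QComm q c (ι (clockMat q c)) (ι shiftMat) := (clockMat_shiftMat q c).map ι
  set Z := ι (clockMat q c) with hZ
  set X := ι shiftMat with hX
  have hZ5 : Z ^ 5 = 1 := by rw [hZ, ← map_pow, clockMat_pow_five, map_one]
  have hX5 : X ^ 5 = 1 := by rw [hX, ← map_pow, shiftMat_pow_five, map_one]
  have hZZ := qComm_self q Z
  have hXX := qComm_self q X
  -- The Weyl elements: they have fifth power 1, and two of them commute up to `c` times the
  -- determinant of their exponent vectors.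
  let T : ZMod 5 → ZMod 5 → R := fun a b => Z ^ a.val * X ^ b.val
  have hT5 : ∀ a b, T a b ^ 5 = 1 := by
    intro a b
    rw [((hZX.pow_left a.val).pow_right b.val).mul_pow_five, pow_five_pow_val hZ5,
      pow_five_pow_val hX5, one_mul]
  have hZT : ∀ a b, QComm q (c * b) Z (T a b) := fun a b =>
    ((hZZ.pow_right a.val).mul_right (hZX.pow_right b.val)).congr (by
      simp only [ZMod.natCast_zmod_val]; ring)
  have hXT : ∀ a b, QComm q (-(c * a)) X (T a b) := fun a b =>
    ((hZX.symm.pow_right a.val).mul_right (hXX.pow_right b.val)).congr (by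
      simp only [ZMod.natCast_zmod_val]; ring)
  have hTT : ∀ a b a' b', QComm q (c * (a * b' - b * a')) (T a b) (T a' b') := fun a b a' b' =>
    (((hZT a' b').pow_left a.val).mul_left ((hXT a' b').pow_left b.val)).congr (by
      simp only [ZMod.natCast_zmod_val]; ring)
  have hmul : ∀ {z x t : R} {e : ZMod 5}, (∀ r, z * r = r * z) → QComm q e x t →
      QComm q e x (z * t) := by
    intro z x t e hz h
    exact ((QComm.of_comm (hz x).symm).mul_right h).congr (zero_add e)
  have hmul' : ∀ {z x t : R} {e : ZMod 5}, (∀ r, z * r = r * z) → QComm q e x t →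
      QComm q e (z * x) t := by
    intro z x t e hz h
    exact ((QComm.of_comm (hz t)).mul_left h).congr (zero_add e)
  -- The central factors `v`, `w` carry the fifth powers and the Weyl factors carry the exponents.
  -- Since `c * d = 1`, the chosen Weyl elements pair with `Z` and `X` as the first two rows of `N`
  -- prescribe.
  let s : Fin 4 → R := ![Z, X, v * T (-(N 1 2 * d)) (N 0 2 * d), w * T (-(N 1 3 * d)) (N 0 3 * d)]
  refine ⟨s, QRel.isFrame_of_equiv (QRel.of_qComm (qComm_four h0 hN ?_ ?_ ?_ ?_ ?_ ?_) ?_)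
    (eq_top_iff.mpr fun r _ => ?_) (b.reindex (Fintype.equivOfCardEq ?_)).equivFun⟩
  · exact hZX
  · exact hmul hv ((hZT _ _).congr (by linear_combination N 0 2 * hd))
  · exact hmul hw ((hZT _ _).congr (by linear_combination N 0 3 * hd))
  · exact hmul hv ((hXT _ _).congr (by linear_combination N 1 2 * hd))
  · exact hmul hw ((hXT _ _).congr (by linear_combination N 1 3 * hd))
  · refine hmul' hv (hmul hw ((hTT _ _ _ _).congr ?_))
    -- The remaining pairing is `d * (N 0 2 * N 1 3 - N 0 3 * N 1 2)`, and the vanishing of the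
    -- Pfaffian identifies it with `N 2 3`.
    linear_combination (-d) * hpf + (N 2 3 + d * (N 0 2 * N 1 3 - N 0 3 * N 1 2)) * hd
  · intro i
    fin_cases i
    · exact hZ5.trans (map_one _).symm
    · exact hX5.trans (map_one _).symm
    · refine ((Commute.mul_pow (hv _) 5).trans ?_)
      rw [hT5, mul_one]
      exact hv5
    · refine ((Commute.mul_pow (hw _) 5).trans ?_)
      rw [hT5, mul_one]
      exact hw5
  · set S := Subring.closure (Set.range (algebraMap P R) ∪ Set.range s)
    have hs : ∀ i, s i ∈ S := fun i => Subring.subset_closure (Or.inr ⟨i, rfl⟩)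
    have hP : Set.range (algebraMap P R) ⊆ S := fun x hx => Subring.subset_closure (Or.inl hx)
    have hm : ∀ m, ι m ∈ S := by
      intro m
      refine mem_of_clock_shift q h01 (S := S.comap ι.toRingHom) ?_ (hs 0) (hs 1) m
      rintro _ ⟨a, rfl⟩
      change ι (algebraMap ℂ MZ a) ∈ S
      rw [AlgHom.commutes, IsScalarTower.algebraMap_apply ℂ P R]
      exact hP ⟨_, rfl⟩
    have hTm : ∀ a b, T a b = ι (clockMat q c ^ a.val * shiftMat ^ b.val) := by
      intro a b
      simp only [map_mul, map_pow]
      rfl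
    have hT1 : ∀ a b, T a b * T a b ^ 4 = 1 := fun a b => by rw [← pow_succ', hT5]
    -- The Weyl elements are invertible and lie in the generated subring, so `v` and `w` can be
    -- separated from them.
    have hTS : ∀ z a b, z * T a b ∈ S → z ∈ S := by
      intro z a b hz
      have hTmem : T a b ∈ S := by rw [hTm]; exact hm _
      have := S.mul_mem hz (S.pow_mem hTmem 4)
      rwa [mul_assoc, hT1, mul_one] at this
    exact hgen S hP hm (hTS _ _ _ (hs 2)) (hTS _ _ _ (hs 3)) r
  · rw [hκ]
    simp [ZMod.card]

end QuantumFermat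

namespace QuantumFermat

/-! ### The covers of `ℂ³` -/

section Covers

/-- The coordinates `v`, `w` on the first cover. -/
noncomputable def cover1Gen (i : Fin 2) : Cover1 :=
  Ideal.Quotient.mk _ (MvPolynomial.X i)

theorem cover1_mk_C (p : P) : (Ideal.Quotient.mk _ (MvPolynomial.C p) : Cover1) =
    algebraMap P Cover1 p := rfl

theorem cover1Gen_pow (i : Fin 2) : cover1Gen i ^ 5 =
    algebraMap P Cover1 (![MvPolynomial.X 1, MvPolynomial.X 2] i) := by
  rw [cover1Gen, ← map_pow, ← cover1_mk_C, Ideal.Quotient.eq]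
  refine Ideal.subset_span ?_
  fin_cases i
  · exact Or.inl rfl
  · exact Or.inr rfl

theorem cover1_mem {S : Subring Cover1} (hS : Set.range (algebraMap P Cover1) ⊆ S)
    (h : ∀ i, cover1Gen i ∈ S) (c : Cover1) : c ∈ S := by
  obtain ⟨p, rfl⟩ := Ideal.Quotient.mk_surjective c
  induction p using MvPolynomial.induction_on with
  | C p => exact hS ⟨p, rfl⟩
  | add p r hp hr => rw [map_add]; exact S.add_mem hp hr
  | mul_X p i hp => rw [map_mul]; exact S.mul_mem hp (h i)

theorem monic_pow_five_sub {R : Type*} [CommRing R] (a : R) :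
    (Polynomial.X ^ 5 - Polynomial.C a : Polynomial R).Monic :=
  Polynomial.monic_X_pow_sub_C a (by norm_num)

/-- Adjoining a fifth root gives a free module of rank five. -/
theorem exists_root_basis {R : Type} [CommRing R] [Nontrivial R] (a : R) :
    ∃ (κ : Type) (_ : Fintype κ), Fintype.card κ = 5 ∧
      Nonempty (Module.Basis κ R (AdjoinRoot (Polynomial.X ^ 5 - Polynomial.C a : Polynomial R))) :=
  ⟨_, inferInstance, by
    rw [Fintype.card_fin, AdjoinRoot.powerBasis'_dim, Polynomial.natDegree_X_pow_sub_C],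
    ⟨(AdjoinRoot.powerBasis' (monic_pow_five_sub a)).basis⟩⟩

theorem adjoinRoot_pow_five {R : Type*} [CommRing R] (a : R) :
    (AdjoinRoot.root (Polynomial.X ^ 5 - Polynomial.C a : Polynomial R)) ^ 5 =
      algebraMap R _ a := by
  have h := AdjoinRoot.eval₂_root (Polynomial.X ^ 5 - Polynomial.C a : Polynomial R)
  rw [Polynomial.eval₂_sub, Polynomial.eval₂_pow, Polynomial.eval₂_X, Polynomial.eval₂_C,
    sub_eq_zero] at h
  exact h

theorem adjoinRoot_mem {R : Type*} [CommRing R] {f : Polynomial R} {S : Subring (AdjoinRoot f)}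
    (hS : Set.range (algebraMap R (AdjoinRoot f)) ⊆ S) (h : AdjoinRoot.root f ∈ S)
    (c : AdjoinRoot f) : c ∈ S := by
  induction c using AdjoinRoot.induction_on with
  | ih p =>
    induction p using Polynomial.induction_on with
    | C a => exact hS ⟨a, rfl⟩
    | add p r hp hr => rw [map_add]; exact S.add_mem hp hr
    | monomial n a hn =>
      rw [pow_succ, ← mul_assoc, map_mul]
      exact S.mul_mem hn h

/-- The polynomial ring, as the first of two successive extensions by fifth roots. -/
abbrev RootY : Type :=
  AdjoinRoot (Polynomial.X ^ 5 - Polynomial.C (MvPolynomial.X 1 : P))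

/-- The two successive extensions by the fifth roots of `y` and `z`. -/
abbrev RootYZ : Type :=
  AdjoinRoot (Polynomial.X ^ 5 - Polynomial.C (algebraMap P RootY (MvPolynomial.X 2)))

/-- The comparison of the first cover with successive extensions. -/
noncomputable def cover1ToRoot : Cover1 →ₐ[P] RootYZ :=
  Ideal.Quotient.liftₐ _ (MvPolynomial.aeval (R := P)
    ![algebraMap RootY RootYZ (AdjoinRoot.root _), AdjoinRoot.root _]) fun a ha => by
      refine (Ideal.span_le (I := RingHom.ker (MvPolynomial.aeval (R := P)
        ![algebraMap RootY RootYZ (AdjoinRoot.root _), AdjoinRoot.root _]))).mpr ?_ ha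
      rintro _ (rfl | rfl)
      · rw [SetLike.mem_coe, RingHom.mem_ker, map_sub, map_pow, MvPolynomial.aeval_X,
          MvPolynomial.aeval_C, sub_eq_zero]
        change algebraMap RootY RootYZ (AdjoinRoot.root _) ^ 5 = _
        rw [← map_pow, adjoinRoot_pow_five, ← IsScalarTower.algebraMap_apply]
      · rw [SetLike.mem_coe, RingHom.mem_ker, map_sub, map_pow, MvPolynomial.aeval_X,
          MvPolynomial.aeval_C, sub_eq_zero]
        change AdjoinRoot.root _ ^ 5 = _
        rw [adjoinRoot_pow_five, ← IsScalarTower.algebraMap_apply]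

/-- The fifth powers of the coordinates `v`, `w` on the first cover. -/
noncomputable def cover1Pow : Fin 2 → P := ![MvPolynomial.X 1, MvPolynomial.X 2]

theorem commutative_qrel {A C : Type*} [CommRing A] [CommRing C] [Algebra A C] {n : ℕ}
    {y : Fin n → A} {s : Fin n → C} (h : ∀ i, s i ^ 5 = algebraMap A C (y i)) :
    QRel 1 (algebraMap A C) (fun _ _ => 0) y s where
  central := Algebra.commutes
  comm i j := by rw [AddChar.map_zero_eq_one, map_one, one_mul, mul_comm]
  pow := h

/-- Independence of the monomials in `v` and `w` is detected after mapping to the tower of two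
adjunctions of a fifth root, which is free of rank 25. -/
theorem cover1_isFrame :
    IsFrame 1 (algebraMap P Cover1) (fun _ _ => 0) cover1Pow cover1Gen := by
  have h1 : QRel 1 (algebraMap P Cover1) (fun _ _ => 0) cover1Pow cover1Gen :=
    commutative_qrel (A := P) (C := Cover1) cover1Gen_pow
  have h2 : QRel 1 (algebraMap P RootYZ) (fun _ _ => 0) cover1Pow
      (fun i => cover1ToRoot (cover1Gen i)) := by
    refine commutative_qrel fun i => ?_
    rw [← map_pow, cover1Gen_pow, AlgHom.commutes]
    rfl
  have hg : ∀ i, cover1ToRoot (cover1Gen i) =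
      ![algebraMap RootY RootYZ (AdjoinRoot.root _), AdjoinRoot.root _] i :=
    fun i => MvPolynomial.aeval_X _ _
  have : Nontrivial RootY := AdjoinRoot.nontrivial _ (by
    rw [Polynomial.degree_X_pow_sub_C (by norm_num)]
    norm_num)
  obtain ⟨κ, _, hκ, ⟨b⟩⟩ := exists_root_basis (MvPolynomial.X 1 : P)
  obtain ⟨κ', _, hκ', ⟨b'⟩⟩ := exists_root_basis (algebraMap P RootY (MvPolynomial.X 2))
  have h3 : IsFrame 1 (algebraMap P RootYZ) (fun _ _ => 0) cover1Pow
      (fun i => cover1ToRoot (cover1Gen i)) := by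
    refine h2.isFrame_of_equiv (eq_top_iff.mpr fun r _ => ?_)
      ((b.smulTower b').reindex (Fintype.equivOfCardEq (by simp [hκ, hκ', ZMod.card]))).equivFun
    set S := Subring.closure (Set.range (algebraMap P RootYZ) ∪
      Set.range fun i => cover1ToRoot (cover1Gen i))
    have hs : ∀ i, cover1ToRoot (cover1Gen i) ∈ S :=
      fun i => Subring.subset_closure (Or.inr ⟨i, rfl⟩)
    refine adjoinRoot_mem ?_ ?_ r
    · rintro _ ⟨c, rfl⟩
      refine adjoinRoot_mem (S := S.comap (algebraMap RootY RootYZ)) ?_ ?_ c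
      · rintro _ ⟨p, rfl⟩
        change algebraMap RootY RootYZ (algebraMap P RootY p) ∈ S
        rw [← IsScalarTower.algebraMap_apply]
        exact Subring.subset_closure (Or.inl ⟨p, rfl⟩)
      · have := hs 0
        rwa [hg] at this
    · have := hs 1
      rwa [hg] at this
  refine ⟨h1, fun f g hfg => h3.bij.1 ?_, h1.surjective (eq_top_iff.mpr fun r _ => ?_)⟩
  · have := congrArg cover1ToRoot.toRingHom hfg
    rw [map_frameMap, map_frameMap] at this
    have e : cover1ToRoot.toRingHom.comp (algebraMap P Cover1) = algebraMap P RootYZ :=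
      RingHom.ext fun p => cover1ToRoot.commutes p
    rwa [e] at this
  · exact cover1_mem (fun x hx => Subring.subset_closure (Or.inl hx))
      (fun i => Subring.subset_closure (Or.inr ⟨i, rfl⟩)) r

theorem exists_cover1_basis : ∃ (κ : Type) (_ : Fintype κ), Fintype.card κ = 25 ∧
      Nonempty (Module.Basis κ P Cover1) :=
  ⟨_, inferInstance, by simp [ZMod.card], ⟨cover1_isFrame.basis⟩⟩

/-- The first cover is an affine space. -/
noncomputable def cover1Equiv : Cover1 ≃ₐ[ℂ] P :=
  -- The cover has the free coordinates `x, v, w`; in terms of these, `y` and `z` become fifth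
  -- powers.
  let f : MvPolynomial (Fin 2) P →+* P := MvPolynomial.eval₂Hom
    (MvPolynomial.aeval (R := ℂ) ![MvPolynomial.X 0, MvPolynomial.X 1 ^ 5,
      MvPolynomial.X 2 ^ 5] : P →ₐ[ℂ] P).toRingHom ![MvPolynomial.X 1, MvPolynomial.X 2]
  have hf : ∀ a ∈ Ideal.span
      ({MvPolynomial.X 0 ^ 5 - MvPolynomial.C (MvPolynomial.X 1),
        MvPolynomial.X 1 ^ 5 - MvPolynomial.C (MvPolynomial.X 2)} :
        Set (MvPolynomial (Fin 2) P)), f a = 0 := fun a ha => by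
    refine (Ideal.span_le (I := RingHom.ker f)).mpr ?_ ha
    rintro _ (rfl | rfl) <;> simp [f]
  let g : P →ₐ[ℂ] Cover1 := MvPolynomial.aeval
    ![algebraMap P Cover1 (MvPolynomial.X 0), cover1Gen 0, cover1Gen 1]
  let F : Cover1 →+* P := Ideal.Quotient.lift _ f hf
  have hFC : ∀ p, F (algebraMap P Cover1 p) = f (MvPolynomial.C p) := fun p =>
    Ideal.Quotient.lift_mk _ _ _
  have hFX : ∀ i, F (cover1Gen i) = f (MvPolynomial.X i) := fun p =>
    Ideal.Quotient.lift_mk _ _ _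
  AlgEquiv.ofRingEquiv (f := RingEquiv.ofRingHom F g.toRingHom
    (by
      refine MvPolynomial.ringHom_ext (fun c => ?_) (fun i => ?_)
      · change F (g (algebraMap ℂ P c)) = algebraMap ℂ P c
        rw [AlgHom.commutes, IsScalarTower.algebraMap_apply ℂ P Cover1, hFC]
        simp [f]
      · change F (g (MvPolynomial.X i)) = MvPolynomial.X i
        rw [MvPolynomial.aeval_X]
        fin_cases i
        · exact (hFC _).trans (by simp [f])
        · exact (hFX _).trans (by simp [f])
        · exact (hFX _).trans (by simp [f]))
    (by
      refine Ideal.Quotient.ringHom_ext (MvPolynomial.ringHom_ext (fun p => ?_) (fun i => ?_))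
      · change g (F (algebraMap P Cover1 p)) = algebraMap P Cover1 p
        have : (g.toRingHom.comp F).comp (algebraMap P Cover1) = algebraMap P Cover1 := by
          refine MvPolynomial.ringHom_ext (fun c => ?_) (fun i => ?_)
          · change g (F (algebraMap P Cover1 (MvPolynomial.C c))) = _
            rw [hFC, MvPolynomial.eval₂Hom_C]
            change g (MvPolynomial.aeval _ (MvPolynomial.C c)) = _
            rw [MvPolynomial.aeval_C, AlgHom.commutes, IsScalarTower.algebraMap_apply ℂ P Cover1]
            rfl
          · change g (F (algebraMap P Cover1 (MvPolynomial.X i))) = _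
            rw [hFC, MvPolynomial.eval₂Hom_C]
            change g (MvPolynomial.aeval _ (MvPolynomial.X i)) = _
            rw [MvPolynomial.aeval_X]
            fin_cases i
            · exact MvPolynomial.aeval_X _ _
            · change g (MvPolynomial.X 1 ^ 5) = _
              rw [map_pow, MvPolynomial.aeval_X]
              exact cover1Gen_pow 0
            · change g (MvPolynomial.X 2 ^ 5) = _
              rw [map_pow, MvPolynomial.aeval_X]
              exact cover1Gen_pow 1
        exact DFunLike.congr_fun this p
      · change g (F (cover1Gen i)) = cover1Gen i
        rw [hFX, MvPolynomial.eval₂Hom_X']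
        fin_cases i
        · exact MvPolynomial.aeval_X _ _
        · exact MvPolynomial.aeval_X _ _))
    fun c => by
      change F (algebraMap ℂ Cover1 c) = _
      rw [IsScalarTower.algebraMap_apply ℂ P Cover1, hFC]
      simp [f]

/-- The second cover is an affine space. -/
noncomputable def cover2Equiv : Cover2 ≃ₐ[ℂ] P :=
  let φ : P →ₐ[ℂ] P := MvPolynomial.aeval ![MvPolynomial.X 0, MvPolynomial.X 1,
      MvPolynomial.X 2 ^ 5]
  let F : Cover2 →+* P := AdjoinRoot.lift φ.toRingHom (MvPolynomial.X 2) (by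
    rw [Polynomial.eval₂_sub, Polynomial.eval₂_pow, Polynomial.eval₂_X, Polynomial.eval₂_C,
      sub_eq_zero]
    change MvPolynomial.X 2 ^ 5 = φ (MvPolynomial.X 2)
    rw [MvPolynomial.aeval_X]
    rfl)
  let g : P →ₐ[ℂ] Cover2 := MvPolynomial.aeval
    ![algebraMap P Cover2 (MvPolynomial.X 0), algebraMap P Cover2 (MvPolynomial.X 1),
      AdjoinRoot.root _]
  have hFC : ∀ p, F (algebraMap P Cover2 p) = φ p := fun p => AdjoinRoot.lift_of _
  have hFX : F (AdjoinRoot.root _) = MvPolynomial.X 2 := AdjoinRoot.lift_root _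
  AlgEquiv.ofRingEquiv (f := RingEquiv.ofRingHom F g.toRingHom
    (by
      refine MvPolynomial.ringHom_ext (fun c => ?_) (fun i => ?_)
      · change F (g (algebraMap ℂ P c)) = algebraMap ℂ P c
        rw [AlgHom.commutes, IsScalarTower.algebraMap_apply ℂ P Cover2, hFC, AlgHom.commutes]
      · change F (g (MvPolynomial.X i)) = MvPolynomial.X i
        rw [MvPolynomial.aeval_X]
        fin_cases i
        · exact (hFC _).trans (MvPolynomial.aeval_X _ _)
        · exact (hFC _).trans (MvPolynomial.aeval_X _ _)
        · exact hFX)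
    (by
      refine RingHom.ext fun c => ?_
      refine adjoinRoot_mem (S := RingHom.eqLocus (g.toRingHom.comp F) (RingHom.id _)) ?_ ?_ c
      · rintro _ ⟨p, rfl⟩
        have : (g.toRingHom.comp F).comp (algebraMap P Cover2) = algebraMap P Cover2 := by
          refine MvPolynomial.ringHom_ext (fun c => ?_) (fun i => ?_)
          · change g (F (algebraMap P Cover2 (algebraMap ℂ P c))) = _
            rw [hFC, AlgHom.commutes, AlgHom.commutes, IsScalarTower.algebraMap_apply ℂ P Cover2]
            rfl
          · change g (F (algebraMap P Cover2 (MvPolynomial.X i))) = _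
            rw [hFC, MvPolynomial.aeval_X]
            fin_cases i
            · exact MvPolynomial.aeval_X _ _
            · exact MvPolynomial.aeval_X _ _
            · change g (MvPolynomial.X 2 ^ 5) = _
              rw [map_pow, MvPolynomial.aeval_X]
              exact adjoinRoot_pow_five _
        exact DFunLike.congr_fun this p
      · change g (F (AdjoinRoot.root _)) = AdjoinRoot.root _
        rw [hFX]
        exact MvPolynomial.aeval_X _ _))
    fun c => by
      change F (algebraMap ℂ Cover2 c) = _
      rw [IsScalarTower.algebraMap_apply ℂ P Cover2, hFC, AlgHom.commutes]

/-- Matrices over a product are products of matrices. -/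
def matrixPiEquiv (A : Type) [CommRing A] [Algebra ℂ A] (κ : Type) :
    Matrix (Fin 5) (Fin 5) (κ → A) ≃ₐ[ℂ] (κ → Matrix (Fin 5) (Fin 5) A) where
  toFun m k i j := m i j k
  invFun m i j k := m k i j
  left_inv _ := rfl
  right_inv _ := rfl
  map_mul' m m' := by
    ext k i j
    simp only [Matrix.mul_apply, Finset.sum_apply, Pi.mul_apply]
    rfl
  map_add' _ _ := rfl
  commutes' c := by
    ext k i j
    simp only [Matrix.algebraMap_matrix_apply, Pi.algebraMap_apply]
    split_ifs <;> rfl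

/-- Sums of matrix algebras over an algebra isomorphic to `ℂ[x, y, z]`, up to Morita equivalence. -/
theorem morita_tensor {C : Type} [CommRing C] [Algebra ℂ C] (e : C ≃ₐ[ℂ] P) (κ : Type) [Fintype κ]
    [DecidableEq κ] : IsMoritaEquivalent ℂ (C ⊗[ℂ] (κ → M5)) (κ → P) := by
  have e1 : C ⊗[ℂ] (κ → M5) ≃ₐ[ℂ] (κ → C ⊗[ℂ] M5) :=
    Algebra.TensorProduct.piRight ℂ ℂ C fun _ => M5
  have e2 : (κ → C ⊗[ℂ] M5) ≃ₐ[ℂ] (κ → Matrix (Fin 5) (Fin 5) P) :=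
    AlgEquiv.piCongrRight fun _ => (matrixEquivTensor (Fin 5) ℂ C).symm.trans e.mapMatrix
  -- Matrices over a product of polynomial rings are Morita equivalent to that product, and the
  -- tensor product is identified with such a matrix algebra.
  exact IsMoritaEquivalent.symm ℂ (IsMoritaEquivalent.trans ℂ
    (IsMoritaEquivalent.matrix (κ → P) (ι := Fin 5) ℂ)
    (IsMoritaEquivalent.of_algEquiv ℂ (A := Matrix (Fin 5) (Fin 5) (κ → P))
      (B := C ⊗[ℂ] (κ → M5)) ((e1.trans e2).trans (matrixPiEquiv P κ).symm).symm))

theorem morita_J1 : IsMoritaEquivalent ℂ J1 P := by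
  have e : J1 ≃ₐ[ℂ] Matrix (Fin 5) (Fin 5) P :=
    (matrixEquivTensor (Fin 5) ℂ Cover1).symm.trans cover1Equiv.mapMatrix
  exact IsMoritaEquivalent.symm ℂ (IsMoritaEquivalent.trans ℂ
    (IsMoritaEquivalent.matrix P (ι := Fin 5) ℂ)
    (IsMoritaEquivalent.of_algEquiv ℂ (A := Matrix (Fin 5) (Fin 5) P) (B := J1) e.symm))

theorem morita_J2 : IsMoritaEquivalent ℂ J2 (Fin 5 → P) := morita_tensor cover2Equiv _

theorem morita_J3 : IsMoritaEquivalent ℂ J3 (Fin 25 → P) := morita_tensor AlgEquiv.refl _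

end Covers

/-! ### The local models `J_(1)`, `J_(2)`, `J_(3)` as quantum algebras -/

section Models

variable (q : ℂ) [Fact (IsPrimitiveRoot q 5)]

/-- Reindexing of matrices. -/
noncomputable def mzEquiv : MZ ≃ₐ[ℂ] M5 :=
  Matrix.reindexAlgEquiv ℂ ℂ (ZMod.finEquiv 5).symm.toEquiv

theorem tensor_mem {C D : Type*} [CommRing C] [Algebra ℂ C] [Ring D] [Algebra ℂ D]
    {S : Subring (C ⊗[ℂ] D)} (hC : ∀ c : C, c ⊗ₜ (1 : D) ∈ S) (hD : ∀ d : D, (1 : C) ⊗ₜ d ∈ S)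
    (r : C ⊗[ℂ] D) : r ∈ S := by
  induction r using TensorProduct.induction_on with
  | zero => exact S.zero_mem
  | add x y hx hy => exact S.add_mem hx hy
  | tmul c d =>
    have := S.mul_mem (hC c) (hD d)
    rwa [Algebra.TensorProduct.tmul_mul_tmul, mul_one, one_mul] at this

theorem tmul_one_central {C D : Type*} [CommRing C] [Algebra ℂ C] [Ring D] [Algebra ℂ D] (c : C)
    (r : C ⊗[ℂ] D) : c ⊗ₜ[ℂ] (1 : D) * r = r * c ⊗ₜ (1 : D) := by
  induction r using TensorProduct.induction_on with
  | zero => simp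
  | add x y hx hy => rw [mul_add, add_mul, hx, hy]
  | tmul c d => simp [mul_comm]

theorem one_tmul_central {C D : Type*} [CommRing C] [Algebra ℂ C] [Ring D] [Algebra ℂ D] {d : D}
    (hd : ∀ d', d * d' = d' * d) (r : C ⊗[ℂ] D) : (1 : C) ⊗ₜ[ℂ] d * r = r * (1 : C) ⊗ₜ d := by
  induction r using TensorProduct.induction_on with
  | zero => simp
  | add x y hx hy => rw [mul_add, add_mul, hx, hy]
  | tmul c d' => simp [hd]

/-- The diagonal embedding of matrices. -/
noncomputable def diagMat (C : Type*) [CommRing C] [Algebra ℂ C] (κ : Type*) :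
    MZ →ₐ[ℂ] C ⊗[ℂ] (κ → M5) :=
  Algebra.TensorProduct.includeRight.comp
    ((Pi.constAlgHom ℂ κ M5).comp mzEquiv.toAlgHom)

theorem pi_mem {C : Type*} [CommRing C] [Algebra ℂ C] {κ : Type*} [Fintype κ] [DecidableEq κ]
    {S : Subring (C ⊗[ℂ] (κ → M5))} (hM : ∀ m, diagMat C κ m ∈ S)
    (hs : ∀ k : κ, (1 : C) ⊗ₜ[ℂ] (Pi.single k 1 : κ → M5) ∈ S) (d : κ → M5) :
    (1 : C) ⊗ₜ[ℂ] d ∈ S := by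
  have hd : d = ∑ k, Pi.single k 1 * (fun _ => d k : κ → M5) := by
    ext1 i
    rw [Finset.sum_apply, Finset.sum_eq_single i]
    · simp
    · intro k _ hk
      simp [hk.symm]
    · simp
  rw [hd, TensorProduct.tmul_sum]
  refine S.sum_mem fun k _ => ?_
  have h1 := S.mul_mem (hs k) (hM (mzEquiv.symm (d k)))
  have h2 : diagMat C κ (mzEquiv.symm (d k)) = (1 : C) ⊗ₜ[ℂ] (fun _ => d k : κ → M5) := by
    change (1 : C) ⊗ₜ[ℂ] (fun _ => mzEquiv (mzEquiv.symm (d k)) : κ → M5) = _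
    rw [AlgEquiv.apply_symm_apply]
  rwa [h2, Algebra.TensorProduct.tmul_mul_tmul, mul_one] at h1

/-- The central element with the value `q ^ g(k)` in the component `k`. -/
noncomputable def piChi {κ : Type*} (g : κ → ZMod 5) : κ → M5 := fun k => chi q (g k) • 1

theorem piChi_central {κ : Type*} (g : κ → ZMod 5) (d : κ → M5) :
    piChi q g * d = d * piChi q g := by
  ext1 k
  simp [piChi]

theorem piChi_pow {κ : Type*} (g : κ → ZMod 5) : piChi q g ^ 5 = 1 := by
  ext1 k
  have : ((5 : ℕ) : ZMod 5) = 0 := rfl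
  rw [Pi.pow_apply, piChi, chi_smul_one_pow, this, zero_mul, AddChar.map_zero_eq_one, one_smul]
  rfl

/-- The eigenprojections of the central element with values `q ^ g(i)` are the indicators of the
level sets of `g`. One such element can therefore separate five summands, and two can separate
twenty-five. -/
theorem eigenProj_piChi_mem {C : Type} [CommRing C] [Algebra P C] [Algebra ℂ C]
    [IsScalarTower ℂ P C] {κ : Type} [Fintype κ] {S : Subring (C ⊗[ℂ] (κ → M5))}
    (hS : Set.range (algebraMap P (C ⊗[ℂ] (κ → M5))) ⊆ S) {g : κ → ZMod 5}
    (h : (1 : C) ⊗ₜ[ℂ] piChi q g ∈ S) (k : ZMod 5) :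
    (1 : C) ⊗ₜ[ℂ] (fun i => if g i = k then 1 else 0 : κ → M5) ∈ S := by
  have h1 := eigenProj_mem q hS h k
  have h2 := eigenProj_map q (Algebra.TensorProduct.includeRight : (κ → M5) →ₐ[ℂ] C ⊗[ℂ] (κ → M5))
    (piChi q g) k
  have h3 : eigenProj q (piChi q g) k = fun i => if g i = k then 1 else 0 := eigenProj_pi q g k
  rw [h3] at h2
  rw [Algebra.TensorProduct.includeRight_apply, Algebra.TensorProduct.includeRight_apply] at h2
  rwa [h2]

variable {N : Fin 4 → Fin 4 → ZMod 5} (h0 : ∀ i, N i i = 0)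
    (hN : ∀ i j, N j i = -N i j) (h01 : N 0 1 ≠ 0)
    (hpf : N 0 1 * N 2 3 - N 0 2 * N 1 3 + N 0 3 * N 1 2 = 0)

include h0 hN h01 hpf

theorem exists_J1_frame : ∃ s, IsFrame (chiAlg q P) (algebraMap P J1) N
    ![1, 1, MvPolynomial.X 1, MvPolynomial.X 2] s := by
  obtain ⟨κ, _, hκ, ⟨b⟩⟩ := exists_cover1_basis
  refine exists_matrix_frame q (Algebra.TensorProduct.includeRight.comp mzEquiv.toAlgHom)
    (cover1Gen 0 ⊗ₜ 1) (cover1Gen 1 ⊗ₜ 1) (tmul_one_central _) (tmul_one_central _) ?_ ?_ ?_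
    (b.smulTower (Algebra.TensorProduct.basis Cover1 (Matrix.stdBasis ℂ (Fin 5) (Fin 5))))
    (by simp [hκ]) h0 hN h01 hpf
  · rw [Algebra.TensorProduct.tmul_pow, one_pow, cover1Gen_pow]; rfl
  · rw [Algebra.TensorProduct.tmul_pow, one_pow, cover1Gen_pow]; rfl
  · intro S hS hm hv hw r
    refine tensor_mem (fun c => ?_) (fun d => ?_) r
    · refine cover1_mem (S := S.comap (Algebra.TensorProduct.includeLeftRingHom)) ?_ ?_ c
      · rintro _ ⟨p, rfl⟩
        exact hS ⟨p, rfl⟩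
      · intro i
        fin_cases i
        · exact hv
        · exact hw
    · have := hm (mzEquiv.symm d)
      change (1 : Cover1) ⊗ₜ[ℂ] (mzEquiv (mzEquiv.symm d)) ∈ S at this
      rwa [AlgEquiv.apply_symm_apply] at this

theorem exists_J2_frame : ∃ s, IsFrame (chiAlg q P) (algebraMap P J2) N
    ![1, 1, 1, MvPolynomial.X 2] s := by
  obtain ⟨κ, _, hκ, ⟨b⟩⟩ := exists_root_basis (MvPolynomial.X 2 : P)
  let g : Fin 5 → ZMod 5 := (ZMod.finEquiv 5).toEquiv
  refine exists_matrix_frame q (diagMat Cover2 (Fin 5))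
    -- The third generator comes from a central element that takes the five fifth roots of unity on
    -- the five summands; it has fifth power 1 and stands in for a root `v` that is split.
    (1 ⊗ₜ piChi q g) (AdjoinRoot.root _ ⊗ₜ 1) (one_tmul_central (piChi_central q g))
    (tmul_one_central _) ?_ ?_ ?_
    (b.smulTower (Algebra.TensorProduct.basis Cover2
      (Pi.basis fun _ : Fin 5 => Matrix.stdBasis ℂ (Fin 5) (Fin 5))))
    (by simp [hκ]) h0 hN h01 hpf
  · rw [Algebra.TensorProduct.tmul_pow, one_pow, piChi_pow, map_one]; rfl
  · rw [Algebra.TensorProduct.tmul_pow, one_pow, adjoinRoot_pow_five]; rfl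
  · intro S hS hm hv hw r
    refine tensor_mem (fun c => ?_) (pi_mem hm fun k => ?_) r
    · refine adjoinRoot_mem (S := S.comap (Algebra.TensorProduct.includeLeftRingHom
        (R := ℂ) (A := Cover2) (B := Fin 5 → M5))) ?_ hw c
      rintro _ ⟨p, rfl⟩
      exact hS ⟨p, rfl⟩
    · have h1 := eigenProj_piChi_mem q hS hv (g k)
      have h2 : (fun i => if g i = g k then 1 else 0 : Fin 5 → M5) = Pi.single k 1 := by
        ext1 i
        simp [g, Pi.single_apply]
      rwa [h2] at h1

theorem exists_J3_frame : ∃ s, IsFrame (chiAlg q P) (algebraMap P J3) N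
    ![1, 1, 1, 1] s := by
  -- The summands are indexed by pairs; each of the two central elements reads one component, and
  -- the product of their eigenprojections isolates a single summand.
  let e : Fin 25 ≃ ZMod 5 × ZMod 5 := Fintype.equivOfCardEq (by simp [ZMod.card])
  refine exists_matrix_frame q (diagMat P (Fin 25))
    (1 ⊗ₜ piChi q fun i => (e i).1) (1 ⊗ₜ piChi q fun i => (e i).2)
    (one_tmul_central (piChi_central q _)) (one_tmul_central (piChi_central q _)) ?_ ?_ ?_
    (Algebra.TensorProduct.basis P
      (Pi.basis fun _ : Fin 25 => Matrix.stdBasis ℂ (Fin 5) (Fin 5)))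
    (by simp) h0 hN h01 hpf
  · rw [Algebra.TensorProduct.tmul_pow, one_pow, piChi_pow, map_one]; rfl
  · rw [Algebra.TensorProduct.tmul_pow, one_pow, piChi_pow, map_one]; rfl
  · intro S hS hm hv hw r
    refine tensor_mem (fun c => hS ⟨c, rfl⟩) (pi_mem hm fun k => ?_) r
    have h1 := S.mul_mem (eigenProj_piChi_mem q hS hv (e k).1)
      (eigenProj_piChi_mem q hS hw (e k).2)
    have h2 : (fun i => if (e i).1 = (e k).1 then 1 else 0 : Fin 25 → M5) *
        (fun i => if (e i).2 = (e k).2 then 1 else 0 : Fin 25 → M5) = Pi.single k 1 := by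
      ext1 i
      have : i = k ↔ (e i).1 = (e k).1 ∧ (e i).2 = (e k).2 := by
        rw [← Prod.ext_iff, e.apply_eq_iff_eq]
      by_cases ha : (e i).1 = (e k).1 <;> by_cases hb : (e i).2 = (e k).2 <;>
        simp [Pi.single_apply, this, ha, hb]
    rwa [Algebra.TensorProduct.tmul_mul_tmul, one_mul, h2] at h1

end Models

end QuantumFermat

namespace QuantumFermat

/-! ### A criterion for presheaves of rings to be sheaves -/

theorem mem_holo_of_local {E : Type} [NormedAddCommGroup E] [NormedSpace ℂ E] {V : Opens E}
    {f : V → ℂ} (h : ∀ x : V, ∃ (U : Opens E) (hU : U ≤ V), (x : E) ∈ U ∧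
      (fun y : U => f ⟨y, hU y.2⟩) ∈ holo U) : f ∈ holo V := by
  classical
  -- A global function is required as representative; its values outside `V` are irrelevant and set
  -- to zero.
  refine ⟨fun x => if hx : x ∈ V then f ⟨x, hx⟩ else 0, fun x hx => ?_, fun x => dif_pos x.2⟩
  obtain ⟨U, hU, hxU, G, hG, hGf⟩ := h ⟨x, hx⟩
  refine DifferentiableAt.differentiableWithinAt ?_
  refine ((hG x hxU).differentiableAt (U.2.mem_nhds hxU)).congr_of_eventuallyEq ?_
  filter_upwards [U.2.mem_nhds hxU] with y hy
  rw [dif_pos (hU hy)]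
  exact (hGf ⟨y, hy⟩).symm

/-- A presheaf of rings whose sections are described by coordinate functions that satisfy local
conditions is a sheaf. -/
theorem isSheaf_of_coords {T : TopCat.{0}} (F : TopCat.Presheaf RingCat.{0} T) {Y E : Type}
    (D : Opens T → Set Y) (hmono : ∀ {U V : Opens T}, U ≤ V → D U ⊆ D V)
    (hsup : ∀ {ι : Type} (U : ι → Opens T), ∀ y ∈ D (iSup U), ∃ i, y ∈ D (U i))
    (hinf : ∀ U V y, y ∈ D U → y ∈ D V → y ∈ D (U ⊓ V))
    (κ : ∀ W : Opens T, F.obj (op W) → E → D W → ℂ)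
    (hκ : ∀ {W₁ W₂ : Opens T} (h : W₁ ≤ W₂) (s : F.obj (op W₂)) (e : E) (y : Y) (hy : y ∈ D W₁),
      κ W₁ ((F.map (homOfLE h).op).hom s) e ⟨y, hy⟩ = κ W₂ s e ⟨y, hmono h hy⟩)
    (hinj : ∀ W, Function.Injective (κ W))
    (hloc : ∀ {ι : Type} (U : ι → Opens T) (f : E → D (iSup U) → ℂ),
      (∀ i, ∃ s, κ (U i) s = fun e (y : D (U i)) => f e ⟨y, hmono (le_iSup U i) y.2⟩) →
        ∃ s, κ (iSup U) s = f) : F.IsSheaf := by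
  rw [TopCat.Presheaf.isSheaf_iff_isSheafUniqueGluing]
  intro ι U sf hsf
  -- Some member of the cover is chosen at each point; compatibility on overlaps makes the resulting
  -- function independent of the choice.
  choose idx hidx using fun y : D (iSup U) => hsup U y y.2
  let f : E → D (iSup U) → ℂ := fun e y => κ (U (idx y)) (sf (idx y)) e ⟨y, hidx y⟩
  have hf : ∀ (i : ι) (e : E) (y : Y) (hy : y ∈ D (U i)),
      f e ⟨y, hmono (le_iSup U i) hy⟩ = κ (U i) (sf i) e ⟨y, hy⟩ := by
    intro i e y hy
    set j := idx ⟨y, hmono (le_iSup U i) hy⟩ with hj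
    have hyj : y ∈ D (U j) := hidx ⟨y, hmono (le_iSup U i) hy⟩
    have hyij := hinf (U i) (U j) y hy hyj
    have h1 := hκ (inf_le_left : U i ⊓ U j ≤ U i) (sf i) e y hyij
    have h2 := hκ (inf_le_right : U i ⊓ U j ≤ U j) (sf j) e y hyij
    have h3 : (F.map (homOfLE (inf_le_left : U i ⊓ U j ≤ U i)).op).hom (sf i) =
      (F.map (homOfLE (inf_le_right : U i ⊓ U j ≤ U j)).op).hom (sf j) := hsf i j
    change κ (U j) (sf j) e ⟨y, hyj⟩ = _
    rw [← h2, ← h3, h1]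
  have hres : ∀ (s : F.obj (op (iSup U))) (i : ι), F.map (Opens.leSupr U i).op s = sf i ↔
      ∀ e y (hy : y ∈ D (U i)), κ (iSup U) s e ⟨y, hmono (le_iSup U i) hy⟩ =
        κ (U i) (sf i) e ⟨y, hy⟩ := by
    intro s i
    rw [← (hinj (U i)).eq_iff]
    constructor
    · intro h e y hy
      rw [← h]
      exact (hκ (le_iSup U i) s e y hy).symm
    · intro h
      ext e ⟨y, hy⟩
      rw [← h]
      exact hκ (le_iSup U i) s e y hy
  obtain ⟨s, hs⟩ := hloc U f fun i => ⟨sf i, by ext e ⟨y, hy⟩; exact (hf i e y hy).symm⟩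
  refine ⟨s, fun i => (hres s i).mpr fun e y hy => ?_, fun s' hs' => hinj _ ?_⟩
  · rw [hs, hf]
  · ext e y
    obtain ⟨i, hi⟩ := hsup U y y.2
    rw [hs]
    exact ((hres s' i).mp (hs' i) e y hi).trans (hf i e y hi).symm

/-! ### The sheaves `J_(i)` -/

section SheafJ

theorem basis_repr_map {D : AlgCat.{0} P} {ι : Type} (b : Module.Basis ι P D) {V₁ V₂ : Opens C3}
    (h : V₁ ≤ V₂) (s : holo V₂ ⊗[P] D) (e : ι) :
    (Algebra.TensorProduct.basis (holo V₁) b).repr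
      (Algebra.TensorProduct.map (holoResC3 h) (AlgHom.id P D) s) e =
      holoResC3 h ((Algebra.TensorProduct.basis (holo V₂) b).repr s e) := by
  induction s using TensorProduct.induction_on with
  | zero => simp
  | add x y hx hy => simp only [map_add, Finsupp.add_apply, hx, hy]
  | tmul f d =>
    rw [Algebra.TensorProduct.map_tmul, AlgHom.id_apply, Algebra.TensorProduct.basis_repr_tmul,
      Algebra.TensorProduct.basis_repr_tmul]
    simp only [Finsupp.smul_apply, Finsupp.mapRange_apply, smul_eq_mul, map_mul]
    congr 1
    exact ((holoResC3 h).commutes _).symm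

/-- The sheaf associated with an algebra that is free of finite rank over `ℂ[x, y, z]`. -/
theorem assocSheaf_isSheaf {D : AlgCat.{0} P} {ι : Type} [Finite ι] (b : Module.Basis ι P D) :
    (assocSheaf D).IsSheaf := by
  have := Fintype.ofFinite ι
  refine isSheaf_of_coords (assocSheaf D) (Y := C3) (E := ι) (fun V => (V : Set C3))
    (fun h => h) (fun U y hy => TopologicalSpace.Opens.mem_iSup.mp hy) (fun U V y h1 h2 => ⟨h1, h2⟩)
    (fun W s e y => ((Algebra.TensorProduct.basis (holo (E := C3) W) b).repr s e).1 y) ?_ ?_ ?_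
  · intro W₁ W₂ h s e y hy
    have := basis_repr_map b h s e
    exact congrFun (congrArg Subtype.val this) ⟨y, hy⟩
  · intro W s s' hss
    refine (Algebra.TensorProduct.basis (holo (E := C3) W) b).repr.injective
      (Finsupp.ext fun e => Subtype.ext ?_)
    exact congrFun hss e
  · intro κ U f hf
    have hmem : ∀ e, f e ∈ holo (E := C3) (iSup U) := by
      intro e
      refine mem_holo_of_local fun x => ?_
      obtain ⟨i, hi⟩ := TopologicalSpace.Opens.mem_iSup.mp x.2
      refine ⟨U i, le_iSup U i, hi, ?_⟩
      obtain ⟨s, hs⟩ := hf i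
      have := ((Algebra.TensorProduct.basis (holo (E := C3) (U i)) b).repr s e).2
      have h2 := congrFun hs e
      exact Eq.mp (congrArg (fun g => g ∈ holo (E := C3) (U i)) h2) this
    refine ⟨(Algebra.TensorProduct.basis (holo (E := C3) (iSup U)) b).equivFun.symm
      fun e => ⟨f e, hmem e⟩, ?_⟩
    ext e y
    have := congrFun ((Algebra.TensorProduct.basis (holo (E := C3) (iSup U))
      b).equivFun.apply_symm_apply fun e => ⟨f e, hmem e⟩) e
    exact congrFun (congrArg Subtype.val this) y

theorem sheafJ_isSheaf (q : ℂ) [Fact (IsPrimitiveRoot q 5)] (i : Fin 4) :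
    (sheafJ q i).IsSheaf := by
  obtain ⟨κ₁, _, _, ⟨b₁⟩⟩ := exists_cover1_basis
  obtain ⟨κ₂, _, _, ⟨b₂⟩⟩ := exists_root_basis (MvPolynomial.X 2 : P)
  fin_cases i
  · exact assocSheaf_isSheaf (D := AlgCat.of P (JacQW q)) (jac_isFrame q).basis
  · exact assocSheaf_isSheaf (D := AlgCat.of P J1) (b₁.smulTower
      (Algebra.TensorProduct.basis Cover1 (Matrix.stdBasis ℂ (Fin 5) (Fin 5))))
  · exact assocSheaf_isSheaf (D := AlgCat.of P J2) (b₂.smulTower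
      (Algebra.TensorProduct.basis Cover2
        (Pi.basis fun _ : Fin 5 => Matrix.stdBasis ℂ (Fin 5) (Fin 5))))
  · exact assocSheaf_isSheaf (D := AlgCat.of P J3) (Algebra.TensorProduct.basis P
      (Pi.basis fun _ : Fin 25 => Matrix.stdBasis ℂ (Fin 5) (Fin 5)))

end SheafJ

/-! ### The Fermat algebra as a quantum algebra -/

section Fermat

variable (q : ℂ) [Fact (IsPrimitiveRoot q 5)]

/-- The exponents of the quantum parameters. -/
def fermatExp : Fin 5 → Fin 5 → ZMod 5 := ![![0, 1, -1, 1, -1], ![-1, 0, 1, -1, 1],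
  ![1, -1, 0, 1, -1], ![-1, 1, -1, 0, 1], ![1, -1, 1, -1, 0]]

theorem fermatExp_self : ∀ i, fermatExp i i = 0 := by decide

theorem fermatExp_swap : ∀ i j, fermatExp j i = -fermatExp i j := by decide

theorem qParam_eq (i j : Fin 5) : qParam q i j = chi q (fermatExp i j) := by
  have h1 : chi q 1 = q := by rw [chi_apply]; exact pow_one q
  have h2 : chi q (-1) = q⁻¹ := by rw [AddChar.map_neg_eq_inv, h1]
  have h0 : chi q 0 = 1 := AddChar.map_zero_eq_one _
  fin_cases i <;> fin_cases j <;> first | exact h1.symm | exact h2.symm | exact h0.symm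

theorem fermat_qComm (i j : Fin 5) : QComm q (fermatExp i j) (gen q i) (gen q j) := by
  rw [QComm, ← qParam_eq]
  exact gen_comm q i j

instance : IsScalarTower ℂ S5 (FermatAlg q) :=
  IsScalarTower.of_algebraMap_eq fun c => by
    change _ = ((fermatStructure q (MvPolynomial.C c) : Subalgebra.center ℂ (FermatAlg q)) :
      FermatAlg q)
    rw [← MvPolynomial.algebraMap_eq, AlgHom.commutes]
    rfl

theorem algebraMap_fermat (k : Fin 5) :
    algebraMap S5 (FermatAlg q) (MvPolynomial.X k) = gen q k ^ 5 := by
  change ((fermatStructure q (MvPolynomial.X k) : Subalgebra.center ℂ (FermatAlg q)) :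
      FermatAlg q) = _
  rw [fermatStructure, MvPolynomial.aeval_X]

theorem fermat_mem {S : Subring (FermatAlg q)} (hS : Set.range (algebraMap S5 (FermatAlg q)) ⊆ S)
    (h : ∀ k, gen q k ∈ S) (b : FermatAlg q) : b ∈ S := by
  obtain ⟨x, rfl⟩ : ∃ x, toFermat q x = b := RingQuot.mkAlgHom_surjective ℂ _ b
  induction x using FreeAlgebra.induction with
  | grade0 r =>
    rw [AlgHom.commutes, IsScalarTower.algebraMap_apply ℂ S5 (FermatAlg q)]
    exact hS ⟨_, rfl⟩
  | grade1 j => exact h j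
  | mul a b ha hb => rw [map_mul]; exact S.mul_mem ha hb
  | add a b ha hb => rw [map_add]; exact S.add_mem ha hb

theorem exists_fermatLift {R : Type*} [Ring R] [Algebra ℂ R] (T : Fin 5 → R)
    (hT : ∀ i j, QComm q (fermatExp i j) (T i) (T j)) (hs : ∑ k, T k ^ 5 = 0) :
    ∃ f : FermatAlg q →ₐ[ℂ] R, ∀ k, f (gen q k) = T k := by
  let F : FreeAlgebra ℂ (Fin 5) →ₐ[ℂ] R := FreeAlgebra.lift ℂ T
  have hF : ∀ k, F (FreeAlgebra.ι ℂ k) = T k := fun k => FreeAlgebra.lift_ι_apply _ _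
  have hrel : ∀ ⦃x y⦄, FermatRel q x y → F x = F y := by
    intro x y h
    induction h with
    | comm i j =>
      rw [map_mul, map_smul, map_mul, hF, hF, qParam_eq]
      exact hT i j
    | fermat =>
      simp only [map_sum, map_pow, hF, map_zero, hs]
  exact ⟨RingQuot.liftAlgHom ℂ ⟨F, hrel⟩, fun k =>
    (RingQuot.liftAlgHom_mkAlgHom_apply ℂ F hrel _).trans (hF _)⟩

variable (A : Type) [CommRing A] [Algebra ℂ A] [Algebra S5 A] [IsScalarTower ℂ S5 A]

/-- The values of the homogeneous coordinates. -/
noncomputable def coordVal (k : Fin 5) : A := algebraMap S5 A (MvPolynomial.X k)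

/-- The generators of the base change of the Fermat algebra. -/
noncomputable def genT (k : Fin 5) : A ⊗[S5] FermatAlg q := 1 ⊗ₜ gen q k

theorem fermat_qrel : QRel (chiAlg q A) (algebraMap A (A ⊗[S5] FermatAlg q)) fermatExp
    (coordVal A) (genT q A) where
  central := Algebra.commutes
  comm i j := by
    have h1 := fermat_qComm q i j
    unfold QComm at h1
    rw [genT, genT, Algebra.TensorProduct.tmul_mul_tmul, Algebra.TensorProduct.tmul_mul_tmul,
      mul_one, h1, ← algebraMap_smul S5 (chi q _), ← TensorProduct.smul_tmul, chiAlg_apply,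
      Algebra.TensorProduct.algebraMap_apply, Algebra.TensorProduct.tmul_mul_tmul, mul_one,
      one_mul, Algebra.smul_def, mul_one, ← IsScalarTower.algebraMap_apply]
    rfl
  pow k := by
    rw [genT, Algebra.TensorProduct.tmul_pow, one_pow, ← algebraMap_fermat,
      Algebra.algebraMap_eq_smul_one, ← TensorProduct.smul_tmul, Algebra.smul_def, mul_one]
    rfl

theorem fermat_tensor_mem {S : Subring (A ⊗[S5] FermatAlg q)}
    (hS : Set.range (algebraMap A (A ⊗[S5] FermatAlg q)) ⊆ S) (h : ∀ k, genT q A k ∈ S)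
    (r : A ⊗[S5] FermatAlg q) : r ∈ S := by
  induction r using TensorProduct.induction_on with
  | zero => exact S.zero_mem
  | add x y hx hy => exact S.add_mem hx hy
  | tmul a b =>
    have hb : (1 : A) ⊗ₜ[S5] b ∈ S := by
      refine fermat_mem q (S := S.comap (Algebra.TensorProduct.includeRight
        (R := S5) (A := A) (B := FermatAlg q)).toRingHom) ?_ h b
      rintro _ ⟨p, rfl⟩
      change (1 : A) ⊗ₜ[S5] algebraMap S5 (FermatAlg q) p ∈ S
      rw [Algebra.algebraMap_eq_smul_one, ← TensorProduct.smul_tmul]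
      exact hS ⟨_, rfl⟩
    have := S.mul_mem (hS ⟨a, rfl⟩) hb
    rwa [Algebra.TensorProduct.algebraMap_apply, Algebra.TensorProduct.tmul_mul_tmul, mul_one,
      one_mul] at this

variable {A}

/-- The regular representation with fifth powers `x_k` satisfies the Fermat relation as soon as the
coordinates sum to zero in `A`. The Fermat algebra then acts on it, which makes the monomials
independent. -/
theorem fermat_isFrame (hA : ∑ k, coordVal A k = 0) :
    IsFrame (chiAlg q A) (algebraMap A (A ⊗[S5] FermatAlg q)) fermatExp (coordVal A)
      (genT q A) := by
  have hm := model_qrel (chiAlg q A) fermatExp (coordVal A) fermatExp_self fermatExp_swap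
  obtain ⟨f, hf⟩ := exists_fermatLift q (modelOp (chiAlg q A) fermatExp (coordVal A))
    (fun i j => hm.qComm i j) (by
      simp only [hm.pow, ← map_sum, hA, map_zero])
  let M := (Fin 5 → ZMod 5) → A
  have hfS : ∀ p : S5, f (algebraMap S5 (FermatAlg q) p) = algebraMap S5 (Module.End A M) p := by
    have : f.toRingHom.comp (algebraMap S5 (FermatAlg q)) = algebraMap S5 (Module.End A M) := by
      refine MvPolynomial.ringHom_ext (fun c => ?_) (fun k => ?_)
      · change f (algebraMap S5 (FermatAlg q) (algebraMap ℂ S5 c)) =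
          algebraMap S5 _ (algebraMap ℂ S5 c)
        rw [← IsScalarTower.algebraMap_apply, ← IsScalarTower.algebraMap_apply, AlgHom.commutes]
      · change f (algebraMap S5 (FermatAlg q) (MvPolynomial.X k)) = _
        rw [algebraMap_fermat, map_pow, hf, hm.pow]
        refine LinearMap.ext fun v => ?_
        change coordVal A k • v = (MvPolynomial.X k : S5) • v
        rw [coordVal, algebraMap_smul]
    exact DFunLike.congr_fun this
  let fS : FermatAlg q →ₐ[S5] Module.End A M := { f with commutes' := hfS }
  let Φ : A ⊗[S5] FermatAlg q →ₐ[A] Module.End A M :=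
    Algebra.TensorProduct.lift (Algebra.ofId A _) fS fun a b => Algebra.commutes a (fS b)
  refine (fermat_qrel q A).isFrame_of_hom (eq_top_iff.mpr fun r _ => ?_) fermatExp_self
    fermatExp_swap Φ.toRingHom (fun a => ?_) (fun k => ?_)
  · exact fermat_tensor_mem q A (fun x hx => Subring.subset_closure (Or.inl hx))
      (fun k => Subring.subset_closure (Or.inr ⟨k, rfl⟩)) r
  · exact Φ.commutes a
  · change Φ ((1 : A) ⊗ₜ gen q k) = _
    refine (Algebra.TensorProduct.lift_tmul _ _ _ _ _).trans ?_
    rw [map_one, one_mul]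
    exact hf k

end Fermat

end QuantumFermat

namespace QuantumFermat

/-- The coordinates with respect to the monomials of a frame. -/
noncomputable def IsFrame.addEquiv {A R : Type*} [CommRing A] [Ring R] {n : ℕ}
    {κ : AddChar (ZMod 5) A} {α : A →+* R} {N : Fin n → Fin n → ZMod 5} {y : Fin n → A}
    {s : Fin n → R} (h : IsFrame κ α N y s) : ((Fin n → ZMod 5) → A) ≃+ R :=
  AddEquiv.ofBijective (AddMonoidHom.mk' (frameMap α s) (frameMap_add α s)) h.bij

theorem IsFrame.addEquiv_apply {A R : Type*} [CommRing A] [Ring R] {n : ℕ}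
    {κ : AddChar (ZMod 5) A} {α : A →+* R} {N : Fin n → Fin n → ZMod 5} {y : Fin n → A}
    {s : Fin n → R} (h : IsFrame κ α N y s) (g : (Fin n → ZMod 5) → A) :
    h.addEquiv g = frameMap α s g := rfl

/-! ### The sections of `𝒜` in coordinates -/

section SecA

variable (q : ℂ) [Fact (IsPrimitiveRoot q 5)]

instance (V : Opens H) : IsScalarTower ℂ S5 (holo V) :=
  IsScalarTower.of_algebraMap_eq fun c => by
    change _ = MvPolynomial.aeval (coordH V) (MvPolynomial.C c)
    rw [MvPolynomial.aeval_C]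

theorem coordVal_holo (V : Opens H) (k : Fin 5) : coordVal (holo V) k = coordH V k :=
  MvPolynomial.aeval_X _ _

theorem sum_coordVal (V : Opens H) : ∑ k, coordVal (holo V) k = 0 := by
  simp only [coordVal_holo]
  refine Subtype.ext (funext fun v => ?_)
  have hv : ∑ k, (v.1 : Fin 5 → ℂ) k = 0 := v.1.2
  rw [AddSubmonoidClass.coe_finsetSum, Finset.sum_apply]
  exact hv

noncomputable instance (W : Opens X) : Ring (conePull q W) := inferInstance

noncomputable instance (W : Opens X) : NonAssocSemiring (conePull q W) :=
  Semiring.toNonAssocSemiring (self := Ring.toSemiring)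

noncomputable instance {E : Type} [NormedAddCommGroup E] [NormedSpace ℂ E] (V : Opens E) :
    CommRing (holo V) := inferInstance

/-- The scalars of the pullback of the graded algebra to a cone. -/
noncomputable def coneScalar (W : Opens X) : holo (cone W) →+* conePull q W :=
  algebraMap (holo (cone W)) (conePull q W)

/-- The map `b ↦ 1 ⊗ b` to the pullback of the graded algebra to a cone. -/
noncomputable def coneIncl (W : Opens X) : FermatAlg q →+* conePull q W :=
  (Algebra.TensorProduct.includeRight (R := S5) (A := holo (cone W)) (B := FermatAlg q)).toRingHom

/-- The generators of the pullback of the graded algebra to a cone. -/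
noncomputable def coneGen (W : Opens X) (k : Fin 5) : conePull q W := coneIncl q W (gen q k)

theorem tmul_eq (W : Opens X) (f : holo (cone W)) (b : FermatAlg q) :
    f ⊗ₜ[S5] b = coneScalar q W f * coneIncl q W b := by
  change _ = (f ⊗ₜ[S5] (1 : FermatAlg q)) * ((1 : holo (cone W)) ⊗ₜ[S5] b)
  rw [Algebra.TensorProduct.tmul_mul_tmul, mul_one, one_mul]

theorem coneIncl_smul (W : Opens X) (c : ℂ) (b : FermatAlg q) :
    coneIncl q W (c • b) = coneScalar q W (algebraMap ℂ _ c) * coneIncl q W b := by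
  rw [← tmul_eq]
  change (1 : holo (cone W)) ⊗ₜ[S5] (c • b) = _
  rw [← algebraMap_smul S5 c b, ← TensorProduct.smul_tmul, Algebra.smul_def, mul_one,
    ← IsScalarTower.algebraMap_apply]

/-- Restriction to a smaller cone. -/
noncomputable def coneRes {W₁ W₂ : Opens X} (h : W₁ ≤ W₂) : conePull q W₂ →+* conePull q W₁ :=
  (conePullRes q h).toRingHom

theorem coneRes_incl {W₁ W₂ : Opens X} (h : W₁ ≤ W₂) (b : FermatAlg q) :
    coneRes q h (coneIncl q W₂ b) = coneIncl q W₁ b := by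
  refine (Algebra.TensorProduct.map_tmul _ _ _ _).trans ?_
  rw [map_one]
  rfl

theorem coneRes_scalar {W₁ W₂ : Opens X} (h : W₁ ≤ W₂) (f : holo (cone W₂)) :
    coneRes q h (coneScalar q W₂ f) = coneScalar q W₁ (holoResH (cone_mono h) f) := by
  refine (Algebra.TensorProduct.map_tmul _ _ _ _).trans ?_
  rw [map_one]
  rfl

/-- The pullback of the graded algebra to a cone is a quantum algebra. -/
theorem cone_isFrame (W : Opens X) :
    IsFrame (chiAlg q (holo (cone W))) (coneScalar q W) fermatExp
      (coordVal (holo (cone W))) (coneGen q W) :=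
  fermat_isFrame q (sum_coordVal _)

theorem map_frameMap' {A A' R R' : Type*} [CommRing A] [CommRing A'] [Ring R] [Ring R'] {n : ℕ}
    {α : A →+* R} {α' : A' →+* R'} {s : Fin n → R} {s' : Fin n → R'} (f : R →+* R') (φ : A → A')
    (hα : ∀ a, f (α a) = α' (φ a)) (hs : ∀ k, f (s k) = s' k) (g : (Fin n → ZMod 5) → A) :
    f (frameMap α s g) = frameMap α' s' fun e => φ (g e) := by
  rw [map_frameMap, frameMap, frameMap, funext hs]
  simp only [RingHom.comp_apply, hα]

/-- Combinations of monomials in the pullback of the graded algebra to a cone. -/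
noncomputable def coneMap (W : Opens X) : ((Fin 5 → ZMod 5) → holo (cone W)) ≃+ conePull q W :=
  (cone_isFrame q W).addEquiv

theorem coneMap_apply (W : Opens X) (g : (Fin 5 → ZMod 5) → holo (cone W)) :
    coneMap q W g = frameMap (coneScalar q W) (coneGen q W) g :=
  (cone_isFrame q W).addEquiv_apply g

theorem coneMap_res {W₁ W₂ : Opens X} (h : W₁ ≤ W₂) (g : (Fin 5 → ZMod 5) → holo (cone W₂)) :
    coneRes q h (coneMap q W₂ g) = coneMap q W₁ fun e => holoResH (cone_mono h) (g e) := by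
  rw [coneMap_apply, coneMap_apply]
  exact map_frameMap' _ _ (coneRes_scalar q h) (fun k => coneRes_incl q h _) g

/-! ### Weights and homogeneous combinations of monomials -/

/-- The total exponent of a monomial. -/
def weight {n : ℕ} (e : Fin n → ZMod 5) : ℕ := ∑ k, (e k).val

/-- The coefficients of a combination of monomials that is homogeneous of degree `M`. -/
def IsWeight {W : Opens X} (M : ℕ) (g : (Fin 5 → ZMod 5) → holo (cone W)) : Prop :=
  ∀ (e : Fin 5 → ZMod 5) (τ : ℂ) (v v' : cone W), (v' : H) = τ ^ 5 • (v : H) →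
    τ ^ weight e * (g e).1 v' = τ ^ M * (g e).1 v

section WeightGroup

variable {R : Type*} [Ring R] {W : Opens X} (α : holo (cone W) →+* R) (s : Fin 5 → R)

/-- The homogeneous combinations of monomials. -/
def weightGroup (M : ℕ) : AddSubgroup R where
  carrier := {r | ∃ g, IsWeight M g ∧ frameMap α s g = r}
  add_mem' := by
    rintro _ _ ⟨g, hg, rfl⟩ ⟨g', hg', rfl⟩
    refine ⟨g + g', fun e τ v v' h => ?_, frameMap_add _ _ _ _⟩
    have h1 := hg e τ v v' h
    have h2 := hg' e τ v v' h
    change τ ^ weight e * ((g e).1 v' + (g' e).1 v') = τ ^ M * ((g e).1 v + (g' e).1 v)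
    rw [mul_add, mul_add, h1, h2]
  zero_mem' := ⟨0, fun e τ v v' h => by simp, by simp [frameMap]⟩
  neg_mem' := by
    rintro _ ⟨g, hg, rfl⟩
    refine ⟨-g, fun e τ v v' h => ?_, by simp [frameMap]⟩
    have h1 := hg e τ v v' h
    change τ ^ weight e * -(g e).1 v' = τ ^ M * -(g e).1 v
    linear_combination -h1

variable {α s}

theorem weight_add_single {n : ℕ} (e : Fin n → ZMod 5) (k : Fin n) :
    weight (e + Pi.single k 1) + (if e k = 4 then 5 else 0) = weight e + 1 := by
  unfold weight
  rw [← Finset.add_sum_erase _ _ (Finset.mem_univ k),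
    ← Finset.add_sum_erase _ (fun j => (e j).val) (Finset.mem_univ k)]
  have h1 : ∑ j ∈ Finset.univ.erase k, ((e + Pi.single k 1 : Fin n → ZMod 5) j).val =
      ∑ j ∈ Finset.univ.erase k, (e j).val := by
    refine Finset.sum_congr rfl fun j hj => ?_
    simp [Finset.ne_of_mem_erase hj]
  rw [h1]
  have h2 : ∀ a : ZMod 5, (a + 1).val + (if a = 4 then 5 else 0) = a.val + 1 := by decide
  have h3 := h2 (e k)
  rw [Pi.add_apply, Pi.single_eq_same]
  omega

theorem mem_weightGroup {κ : AddChar (ZMod 5) (holo (cone W))} {N : Fin 5 → Fin 5 → ZMod 5}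
    {y : Fin 5 → holo (cone W)} (hs : IsFrame κ α N y s) {M : ℕ}
    {g : (Fin 5 → ZMod 5) → holo (cone W)} :
    frameMap α s g ∈ weightGroup α s M ↔ IsWeight M g := by
  constructor
  · rintro ⟨g', hg', h⟩
    rwa [← hs.bij.1 h]
  · intro h
    exact ⟨g, h, rfl⟩

/-- Scaling each `t_k` by `τ` scales `x_k` by `τ ^ 5`. Multiplication by `t_k` raises the total
exponent by one, except when the exponent of `t_k` falls from 4 to 0; the loss of 5 is then made up
by the coefficient `x_k`. -/
theorem gen_mul_mem (hs : QRel (chiAlg q (holo (cone W))) α fermatExp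
    (coordVal (holo (cone W))) s) {M : ℕ} (k : Fin 5) {r : R}
    (hr : r ∈ weightGroup α s M) : s k * r ∈ weightGroup α s (M + 1) := by
  classical
  obtain ⟨g, hg, rfl⟩ := hr
  rw [frameMap, Finset.mul_sum]
  refine AddSubgroup.sum_mem _ fun e _ => ?_
  rw [← mul_assoc, ← hs.central, mul_assoc, hs.mul_mono, ← mul_assoc, ← map_mul,
    ← frameMap_single]
  refine ⟨_, fun e' τ v v' h => ?_, rfl⟩
  by_cases he : e' = e + Pi.single k 1
  · subst he
    rw [Pi.single_eq_same]
    have h1 := hg e τ v v' h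
    have h2 : ∀ x : cone W, (shiftCoeff (chiAlg q (holo (cone W))) fermatExp
        (coordVal (holo (cone W))) k e).1 x =
        chi q (∑ j, if j < k then fermatExp k j * e j else 0) *
          (if e k = 4 then (x.1 : Fin 5 → ℂ) k else 1) := by
      intro x
      rw [shiftCoeff, wrap, coordVal_holo, chiAlg_apply]
      split_ifs <;> rfl
    have h3 : ∀ x : cone W, (g e * shiftCoeff (chiAlg q (holo (cone W))) fermatExp
        (coordVal (holo (cone W))) k e).1 x = (g e).1 x *
        (chi q (∑ j, if j < k then fermatExp k j * e j else 0) *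
          (if e k = 4 then (x.1 : Fin 5 → ℂ) k else 1)) := fun x => by rw [← h2]; rfl
    rw [h3, h3]
    generalize chi q (∑ j, if j < k then fermatExp k j * e j else 0) = c
    have hw := weight_add_single e k
    have hv : (v'.1 : Fin 5 → ℂ) k = τ ^ 5 * (v.1 : Fin 5 → ℂ) k := by rw [h]; rfl
    generalize weight (e + Pi.single k 1) = w1 at hw
    generalize weight e = w2 at hw h1
    generalize (g e).1 v = a at h1
    generalize (g e).1 v' = a' at h1
    split_ifs at hw ⊢ with h4
    · rw [hv]
      have : τ ^ w1 * τ ^ 5 = τ ^ w2 * τ := by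
        rw [← pow_add, hw, pow_succ]
      rw [pow_succ]
      linear_combination (a' * c * (v.1 : Fin 5 → ℂ) k) * this +
        (τ * c * (v.1 : Fin 5 → ℂ) k) * h1
    · rw [add_zero] at hw
      rw [hw, pow_succ, pow_succ]
      linear_combination (τ * c) * h1
  · rw [Pi.single_eq_of_ne he]
    change τ ^ _ * 0 = τ ^ _ * 0
    simp

theorem const_mul_mem {M : ℕ} (c : ℂ) {r : R} (hr : r ∈ weightGroup α s M) :
    α (algebraMap ℂ _ c) * r ∈ weightGroup α s M := by
  obtain ⟨g, hg, rfl⟩ := hr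
  rw [← frameMap_smul]
  refine ⟨_, fun e τ v v' h => ?_, rfl⟩
  have h1 := hg e τ v v' h
  change τ ^ _ * (c * (g e).1 v') = τ ^ _ * (c * (g e).1 v)
  linear_combination c * h1

theorem homogNeg_mul_mem {n : ℕ} {f : holo (cone W)} (hf : HomogNeg n f)
    {r : R} (hr : r ∈ weightGroup α s (5 * n)) : α f * r ∈ weightGroup α s 0 := by
  obtain ⟨g, hg, rfl⟩ := hr
  rw [← frameMap_smul]
  refine ⟨_, fun e τ v v' h => ?_, rfl⟩
  have h1 := hg e τ v v' h
  have h2 := hf v v' _ h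
  rw [← pow_mul] at h2
  change τ ^ _ * (f.1 v' * (g e).1 v') = τ ^ 0 * (f.1 v * (g e).1 v)
  rw [← h2]
  linear_combination f.1 v' * h1

theorem one_mem_weightGroup : (1 : R) ∈ weightGroup α s 0 := by
  classical
  refine ⟨Pi.single 0 1, fun e τ v v' h => ?_, by
    rw [← mono_eq_frameMap, mono_zero]⟩
  by_cases he : e = 0
  · subst he
    simp [weight]
  · simp [he]

end WeightGroup

theorem degreePart_mul_mem {W : Opens X} {M N : ℕ} {b : FermatAlg q} (hb : b ∈ degreePart q N)
    {r : conePull q W} (hr : r ∈ weightGroup (coneScalar q W) (coneGen q W) M) :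
    coneIncl q W b * r ∈ weightGroup (coneScalar q W) (coneGen q W) (M + N) := by
  unfold degreePart at hb
  induction hb using Submodule.pow_induction_on_left' generalizing r M with
  | algebraMap c =>
    rw [Algebra.algebraMap_eq_smul_one, coneIncl_smul, mul_assoc, map_one, one_mul]
    exact const_mul_mem c hr
  | add x y i _ _ hx hy =>
    rw [map_add, add_mul]
    exact add_mem (hx hr) (hy hr)
  | mem_mul m hm i x hx ih =>
    rw [map_mul, mul_assoc, Nat.succ_eq_add_one, ← add_assoc]
    have ih' := ih hr
    generalize coneIncl q W x * r = t at ih'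
    induction hm using Submodule.span_induction with
    | mem y hy =>
      obtain ⟨k, rfl⟩ := hy
      exact gen_mul_mem q (cone_isFrame q W).toQRel k ih'
    | zero => rw [map_zero, zero_mul]; exact zero_mem _
    | add y z _ _ hy hz => rw [map_add, add_mul]; exact add_mem hy hz
    | smul c y _ hy => rw [coneIncl_smul, mul_assoc]; exact const_mul_mem c hy

theorem closure_mul_mem {R : Type*} [Ring R] {S : Set R} {G : AddSubgroup R}
    (h : ∀ x ∈ S, ∀ r ∈ G, x * r ∈ G) {x : R} (hx : x ∈ Subring.closure S) {r : R} (hr : r ∈ G) :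
    x * r ∈ G := by
  induction hx using Subring.closure_induction generalizing r with
  | mem x hx => exact h x hx r hr
  | zero => rw [zero_mul]; exact zero_mem _
  | one => rwa [one_mul]
  | add x y _ _ hx hy => rw [add_mul]; exact add_mem (hx hr) (hy hr)
  | neg x _ hx => rw [neg_mul]; exact neg_mem (hx hr)
  | mul x y _ _ hx hy => rw [mul_assoc]; exact hx (hy hr)

/-- The group of combinations of weight zero is only known to be additive at this stage, whereas
`secA` is generated as a ring. Its generators act on the group by left multiplication, hence so does
the whole ring, and applying it to `1` gives the inclusion. -/
theorem secA_mul_mem {W : Opens X} {r s : conePull q W} (hr : r ∈ secA q W)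
    (hs : s ∈ weightGroup (coneScalar q W) (coneGen q W) 0) :
    r * s ∈ weightGroup (coneScalar q W) (coneGen q W) 0 := by
  refine closure_mul_mem ?_ hr hs
  rintro _ ⟨n, f, b, hf, hb, rfl⟩ s hs
  have h1 := degreePart_mul_mem q hb hs
  rw [zero_add] at h1
  rw [tmul_eq, mul_assoc]
  exact homogNeg_mul_mem hf h1

theorem mono_mem_pow {R : Type*} [Ring R] [Algebra ℂ R] {n : ℕ} (V : Submodule ℂ R)
    (s : Fin n → R) (hs : ∀ i, s i ∈ V) (e : Fin n → ZMod 5) : mono s e ∈ V ^ weight e := by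
  induction n with
  | zero => simp [mono, weight, Submodule.one_le.mp le_rfl]
  | succ n ih =>
    rw [mono_succ, weight, Fin.sum_univ_succ, pow_add]
    exact Submodule.mul_mem_mul (Submodule.pow_mem_pow _ (hs 0) _)
      (ih (fun i => s i.succ) (fun i => hs _) fun i => e i.succ)

theorem IsWeight.homogNeg {W : Opens X} {g : (Fin 5 → ZMod 5) → holo (cone W)} (hg : IsWeight 0 g)
    {e : Fin 5 → ZMod 5} {n : ℕ} (he : weight e = 5 * n) : HomogNeg n (g e) := by
  intro v v' c h
  -- Weights are tested on scalars of the form `τ ^ 5`, and every complex number has this form.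
  obtain ⟨τ, rfl⟩ := IsAlgClosed.exists_pow_nat_eq c (n := 5) (by norm_num)
  have := hg e τ v v' h
  rw [he, pow_mul, pow_zero, one_mul] at this
  exact this

/-- Scaling by `τ = q` fixes the points of the cone, since `q ^ 5 = 1`, but multiplies the condition
on the coefficient by a nontrivial root of unity. -/
theorem IsWeight.eq_zero (q : ℂ) [Fact (IsPrimitiveRoot q 5)] {W : Opens X} {g : (Fin 5 → ZMod 5) → holo (cone W)} (hg : IsWeight 0 g)
    {e : Fin 5 → ZMod 5} (he : ¬ 5 ∣ weight e) : g e = 0 := by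
  refine Subtype.ext (funext fun v => ?_)
  have h1 := hg e q v v (by rw [prim_pow, one_smul])
  rw [pow_zero, one_mul] at h1
  have h2 : q ^ weight e ≠ 1 := fun h =>
    he ((Fact.out : IsPrimitiveRoot q 5).dvd_of_pow_eq_one _ h)
  have h3 : (q ^ weight e - 1) * (g e).1 v = 0 := by linear_combination h1
  exact (mul_eq_zero.mp h3).resolve_left (sub_ne_zero.mpr h2)

theorem frameMap_mem {A R : Type*} [CommRing A] [Ring R] {n : ℕ} {α : A →+* R} {s : Fin n → R}
    {S : Subring R} {g : (Fin n → ZMod 5) → A} (h : ∀ e, α (g e) * mono s e ∈ S) :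
    frameMap α s g ∈ S := S.sum_mem fun e _ => h e

theorem scalar_mono_mem {W : Opens X} {e : Fin 5 → ZMod 5} {n : ℕ} (he : weight e = 5 * n)
    {f : holo (cone W)} (hf : HomogNeg n f) :
    coneScalar q W f * mono (coneGen q W) e ∈ secA q W := by
  have h : f ⊗ₜ[S5] mono (gen q) e ∈ secA q W := by
    refine Subring.subset_closure ⟨n, f, mono (gen q) e, hf, ?_, rfl⟩
    rw [← he]
    exact mono_mem_pow (Submodule.span ℂ (Set.range (gen q))) (gen q)
      (fun i => Submodule.subset_span (Set.mem_range_self i)) e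
  rwa [tmul_eq, map_mono] at h

theorem mem_weightGroup_of_mem_secA {W : Opens X} {r : conePull q W} (h : r ∈ secA q W) :
    r ∈ weightGroup (coneScalar q W) (coneGen q W) 0 := by
  have h1 := secA_mul_mem q h one_mem_weightGroup
  rwa [mul_one] at h1

theorem isWeight_of_mem_weightGroup {W : Opens X} {M : ℕ}
    {g : (Fin 5 → ZMod 5) → holo (cone W)} (h : frameMap (coneScalar q W) (coneGen q W) g ∈
      weightGroup (coneScalar q W) (coneGen q W) M) : IsWeight M g :=
  (mem_weightGroup (cone_isFrame q W)).mp h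

theorem isWeight_of_mem_secA {W : Opens X} {g : (Fin 5 → ZMod 5) → holo (cone W)}
    (h : frameMap (coneScalar q W) (coneGen q W) g ∈ secA q W) : IsWeight 0 g :=
  isWeight_of_mem_weightGroup q (mem_weightGroup_of_mem_secA q h)

theorem IsWeight.mem_secA {W : Opens X} {g : (Fin 5 → ZMod 5) → holo (cone W)}
    (h : IsWeight 0 g) : frameMap (coneScalar q W) (coneGen q W) g ∈ secA q W := by
  refine frameMap_mem fun e => ?_
  rcases Classical.em (5 ∣ weight e) with ⟨n, hn⟩ | he
  · exact scalar_mono_mem q hn (h.homogNeg hn)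
  · rw [h.eq_zero q he, map_zero, zero_mul]
    exact Subring.zero_mem _

/-- The sections of `𝒜` are the invariant combinations of monomials. -/
theorem coneMap_mem_secA {W : Opens X} {g : (Fin 5 → ZMod 5) → holo (cone W)} :
    coneMap q W g ∈ secA q W ↔ IsWeight 0 g := by
  rw [coneMap_apply]
  exact ⟨isWeight_of_mem_secA q, IsWeight.mem_secA q⟩

/-! ### The sheaf property of `𝒜` -/

theorem cone_iSup {ι : Type} (U : ι → Opens X) {v : H} (hv : v ∈ cone (iSup U)) :
    ∃ i, v ∈ cone (U i) := by
  obtain ⟨h0, hv⟩ := hv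
  obtain ⟨i, hi⟩ := TopologicalSpace.Opens.mem_iSup.mp hv
  exact ⟨i, h0, hi⟩

theorem X.mk_eq_of_smul {v v' : H} (hv : v ≠ 0) (hv' : v' ≠ 0) {c : ℂ} (h : v' = c • v) :
    X.mk v' hv' = X.mk v hv := by
  have hc : c ≠ 0 := by
    rintro rfl
    exact hv' (by rw [h, zero_smul])
  refine (Projectivization.mk_eq_mk_iff ℂ v' v hv' hv).mpr ⟨Units.mk0 c hc, ?_⟩
  rw [h]
  rfl

/-- In terms of the monomials `t^e`, a section is a family of holomorphic functions on the cone with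
prescribed homogeneity. Both conditions are local on `X`. -/
theorem sheafA_isSheaf : (sheafA q).IsSheaf := by
  refine isSheaf_of_coords (sheafA q) (Y := H) (E := Fin 5 → ZMod 5) (fun W => (cone W : Set H))
    (fun h => cone_mono h) (fun U y hy => cone_iSup U hy)
    (fun U V y h1 h2 => ⟨h1.1, h1.2, h2.2⟩)
    (fun W s e y => ((coneMap q W).symm s.1 e).1 y) ?_ ?_ ?_
  · intro W₁ W₂ h s e y hy
    have h1 := coneMap_res q h ((coneMap q W₂).symm s.1)
    rw [AddEquiv.apply_symm_apply] at h1
    have h2 := (AddEquiv.symm_apply_eq _).mpr h1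
    exact congrFun (congrArg Subtype.val (congrFun h2 e)) ⟨y, hy⟩
  · intro W s s' hss
    refine Subtype.ext ((coneMap q W).symm.injective (funext fun e => Subtype.ext ?_))
    exact congrFun hss e
  · intro ι U f hf
    have hf' : ∀ i, ∃ g : (Fin 5 → ZMod 5) → holo (cone (U i)), IsWeight 0 g ∧ ∀ e y,
        (g e).1 y = f e ⟨y.1, cone_mono (le_iSup U i) y.2⟩ := by
      intro i
      obtain ⟨s, hs⟩ := hf i
      refine ⟨(coneMap q (U i)).symm s.1, ?_, fun e y => congrFun (congrFun hs e) y⟩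
      have h1 := (coneMap_mem_secA q (g := (coneMap q (U i)).symm s.1)).mp
      exact h1 (((coneMap q (U i)).apply_symm_apply s.1).symm ▸ s.2)
    have hmem : ∀ e, f e ∈ holo (cone (iSup U)) := by
      intro e
      refine mem_holo_of_local fun x => ?_
      obtain ⟨i, hi⟩ := cone_iSup U x.2
      obtain ⟨g, -, hg⟩ := hf' i
      refine ⟨cone (U i), cone_mono (le_iSup U i), hi, ?_⟩
      have := (g e).2
      rwa [funext (hg e)] at this
    have hw : IsWeight 0 fun e => (⟨f e, hmem e⟩ : holo (cone (iSup U))) := by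
      intro e τ v v' h
      obtain ⟨i, hi⟩ := cone_iSup U v.2
      -- A cone contains whole punctured lines, so homogeneity can be tested inside one member of
      -- the cover.
      have hi' : v'.1 ∈ cone (U i) := by
        refine ⟨v'.2.1, ?_⟩
        rw [X.mk_eq_of_smul v.2.1 v'.2.1 h]
        exact hi.2
      obtain ⟨g, hg, hgf⟩ := hf' i
      have := hg e τ ⟨v, hi⟩ ⟨v', hi'⟩ h
      rwa [hgf, hgf] at this
    refine ⟨⟨_, (coneMap_mem_secA q).mpr hw⟩, ?_⟩
    ext e y
    exact congrFun (congrArg Subtype.val (congrFun ((coneMap q (iSup U)).symm_apply_apply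
      fun e => (⟨f e, hmem e⟩ : holo (cone (iSup U)))) e)) y

noncomputable instance (W : Opens X) : Ring (secA q W) := inferInstance

/-- Functions as sections of `𝒜`. -/
noncomputable def secAUnit (W : Opens X) : secO W →+* secA q W := ((unitA q).app (op W)).hom

theorem coe_secAUnit (W : Opens X) (f : secO W) :
    (secAUnit q W f : conePull q W) = coneScalar q W f.1 := rfl

/-- Restriction of sections of `𝒜`. -/
noncomputable def secARes {W₁ W₂ : Opens X} (hW : W₁ ≤ W₂) : secA q W₂ →+* secA q W₁ :=
  ((sheafA q).map (homOfLE hW).op).hom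

theorem coe_secARes {W₁ W₂ : Opens X} (hW : W₁ ≤ W₂) (r : secA q W₂) :
    (secARes q hW r : conePull q W₁) = coneRes q hW r := rfl

end SecA

attribute [irreducible] coneScalar coneIncl coneRes

end QuantumFermat

namespace QuantumFermat

/-! ### Dehomogenization of quantum algebras -/

section Dehomogenize

/-- The exponents of the commutation relations between the quotients `t_{π k} / t_{π 4}`. -/
def dehomExp (N : Fin 5 → Fin 5 → ZMod 5) (π : Equiv.Perm (Fin 5)) (k l : Fin 4) : ZMod 5 :=
  -- The factors 4 represent the exponent `-1`, as `t⁻¹` is `t ^ 4` up to a scalar; the contribution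
  -- of `t_{π 4}` with itself is zero and omitted.
  N (π k.castSucc) (π l.castSucc) + N (π k.castSucc) (π 4) * 4 + 4 * N (π 4) (π l.castSucc)

variable (q : ℂ) [Fact (IsPrimitiveRoot q 5)]

variable {q} in
theorem QComm.algebraMap_mul {A R : Type*} [CommRing A] [Ring R] [Algebra ℂ R] [Algebra A R]
    {c : ZMod 5} {x y : R} (h : QComm q c x y) (a b : A) :
    QComm q c (algebraMap A R a * x) (algebraMap A R b * y) := by
  unfold QComm at *
  rw [mul_assoc, ← mul_assoc x, ← Algebra.commutes b x, mul_assoc _ x, h, mul_assoc (algebraMap A R b),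
    ← mul_assoc y, ← Algebra.commutes a y, mul_assoc _ y, ← mul_assoc, ← mul_assoc, ← map_mul,
    ← map_mul, mul_comm b a, mul_smul_comm]

variable {A B R : Type*} [CommRing A] [Algebra ℂ A] [CommRing B] [Algebra ℂ B] [Ring R]
  {β : A →+* R} {N : Fin 5 → Fin 5 → ZMod 5} {x : Fin 5 → A} {T : Fin 5 → R}

/-- The quotients `t_{π k} / t_{π 4}`, up to a scalar factor. -/
def dehomGen (β : A →+* R) (T : Fin 5 → R) (π : Equiv.Perm (Fin 5)) (c : Fin 4 → A) (k : Fin 4) :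
    R := β (c k) * (T (π k.castSucc) * T (π 4) ^ 4)

/-- The scalar factors, extended by one. -/
def dehomCoeff (c : Fin 4 → A) : Fin 5 → A := Fin.snoc (α := fun _ => A) c 1

/-- The exponents of the denominators. -/
def dehomDenom : Fin 5 → ℕ := ![4, 4, 4, 4, 0]

/-- The generators `t_{π k} / t_{π 4}` and `t_{π 4}`. -/
def dehomGenAll (β : A →+* R) (T : Fin 5 → R) (π : Equiv.Perm (Fin 5)) (c : Fin 4 → A)
    (k : Fin 5) : R := β (dehomCoeff c k) * (T (π k) * T (π 4) ^ dehomDenom k)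

theorem dehomGenAll_castSucc (π : Equiv.Perm (Fin 5)) (c : Fin 4 → A) (k : Fin 4) :
    dehomGenAll β T π c k.castSucc = dehomGen β T π c k := by
  have h : ∀ k : Fin 4, dehomDenom k.castSucc = 4 := by decide
  rw [dehomGenAll, dehomGen, dehomCoeff, Fin.snoc_castSucc, h]

theorem dehomGenAll_last (π : Equiv.Perm (Fin 5)) (c : Fin 4 → A) :
    dehomGenAll β T π c (Fin.last 4) = T (π 4) := by
  rw [dehomGenAll, dehomCoeff, Fin.snoc_last, map_one, one_mul]
  change T (π 4) * T (π 4) ^ 0 = _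
  rw [pow_zero, mul_one]

/-- Adding `t_{π 4}` to the four quotients gives a monomial change of the five original generators,
so that the full system can be treated as a frame over `A`. The factor `1` and the denominator
exponent `0` at the end leave `t_{π 4}` itself unchanged. -/
theorem dehomGenAll_qrel (h : QRel (chiAlg q A) β N x T) (h0 : ∀ i, N i i = 0)
    (π : Equiv.Perm (Fin 5)) (c : Fin 4 → A) :
    QRel (chiAlg q A) β (fun k l => N (π k) (π l) + N (π k) (π 4) * dehomDenom l +
        dehomDenom k * N (π 4) (π l))
      (fun k => dehomCoeff c k ^ 5 * (x (π k) * x (π 4) ^ dehomDenom k))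
      (dehomGenAll β T π c) := by
  let _ : Algebra A R := β.toAlgebra' h.central
  let _ : Algebra ℂ R := (β.comp (algebraMap ℂ A)).toAlgebra' fun c r => h.central _ r
  have _ : IsScalarTower ℂ A R := IsScalarTower.of_algebraMap_eq fun c => rfl
  have hq : ∀ i j, QComm q (N i j) (T i) (T j) := fun i j => QRel.qComm (A := A) h i j
  refine QRel.of_qComm (A := A) (fun i j => ?_) fun i => ?_
  · refine QComm.algebraMap_mul ?_ _ _
    refine (((hq _ _).mul_right ((hq _ _).pow_right _)).mul_left
      (((hq (π 4) (π j)).mul_right ((hq _ _).pow_right _)).pow_left _)).congr ?_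
    rw [h0]
    ring
  · have h1 : (T (π i) * T (π 4) ^ dehomDenom i) ^ 5 =
        β (x (π i) * x (π 4) ^ dehomDenom i) := by
      rw [((hq (π i) (π 4)).pow_right (dehomDenom i)).mul_pow_five, ← pow_mul, mul_comm _ 5, pow_mul,
        h.pow, h.pow, map_mul, map_pow]
    rw [dehomGenAll, Commute.mul_pow (h.central _ _), h1, ← map_pow, ← map_mul]
    rfl

variable {φ : B →+* A}

/-- The relations between the quotients of the generators. -/
theorem dehomGen_qrel (h : QRel (chiAlg q A) β N x T) (h0 : ∀ i, N i i = 0)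
    (π : Equiv.Perm (Fin 5)) (hφC : ∀ c : ℂ, φ (algebraMap ℂ B c) = algebraMap ℂ A c)
    {c : Fin 4 → A} {y : Fin 4 → B}
    (hy : ∀ k, c k ^ 5 * (x (π k.castSucc) * x (π 4) ^ 4) = φ (y k)) :
    QRel (chiAlg q B) (β.comp φ) (dehomExp N π) y (dehomGen β T π c) := by
  have hd : ∀ k : Fin 4, dehomDenom k.castSucc = 4 := by decide
  have hall := dehomGenAll_qrel q h h0 π c
  refine ⟨fun a r => h.central _ r, fun k l => ?_, fun k => ?_⟩
  · have h1 := hall.comm k.castSucc l.castSucc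
    rw [dehomGenAll_castSucc, dehomGenAll_castSucc, hd, hd, chiAlg_apply] at h1
    rw [RingHom.comp_apply, chiAlg_apply, hφC]
    exact h1
  · have h1 := hall.pow k.castSucc
    rw [dehomGenAll_castSucc, hd, dehomCoeff, Fin.snoc_castSucc] at h1
    rw [h1, hy]
    rfl

/-- Multiplying a quotient by `t_{π 4}` completes the denominator `t_{π 4} ^ 4` to the scalar `x_{π
4}`, which `d` cancels together with `c`. -/
theorem gen_eq_dehomGen (h : QRel (chiAlg q A) β N x T) {π : Equiv.Perm (Fin 5)} {c d : Fin 4 → A}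
    (k : Fin 4) (hd : d k * (c k * x (π 4)) = 1) :
    T (π k.castSucc) = β (d k) * dehomGen β T π c k * T (π 4) := by
  have h1 : dehomGen β T π c k * T (π 4) = β (c k * x (π 4)) * T (π k.castSucc) := by
    rw [dehomGen, mul_assoc, mul_assoc, ← pow_succ, h.pow, ← h.central, ← mul_assoc, ← map_mul]
  rw [mul_assoc, h1, ← mul_assoc, ← map_mul, hd, map_one, one_mul]

/-- The quotients of the generators are independent over the scalars. -/
theorem dehomGen_injective (h : IsFrame (chiAlg q A) β N x T) (h0 : ∀ i, N i i = 0)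
    (π : Equiv.Perm (Fin 5)) (hφ : Function.Injective φ) {c d : Fin 4 → A}
    (hd : ∀ k, d k * (c k * x (π 4)) = 1) :
    Function.Injective (frameMap (β.comp φ) (dehomGen β T π c)) := by
  let _ : Algebra A R := β.toAlgebra' h.central
  have hall := dehomGenAll_qrel q h.toQRel h0 π c
  -- The five original generators are recovered from the quotients and `t_{π 4}`, so the new system
  -- is a frame over `A`.
  have hf := IsFrame.change (A := A) h hall (fun i => by
    obtain ⟨k, rfl⟩ := π.surjective i
    have hm : ∀ k, dehomGenAll β T π c k ∈
      Subring.closure (Set.range (algebraMap A R) ∪ Set.range (dehomGenAll β T π c)) :=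
      fun k => Subring.subset_closure (Or.inr ⟨k, rfl⟩)
    have hm4 := hm (Fin.last 4)
    rw [dehomGenAll_last] at hm4
    refine Fin.lastCases ?_ (fun k => ?_) k
    · exact hm4
    · have hk := hm k.castSucc
      rw [dehomGenAll_castSucc] at hk
      rw [gen_eq_dehomGen q h.toQRel k (hd k)]
      exact Subring.mul_mem _ (Subring.mul_mem _ (Subring.subset_closure (Or.inl ⟨d k, rfl⟩)) hk)
        hm4)
  -- Monomials in the quotients are the members of this basis whose last exponent is zero.
  have hmono : ∀ e : Fin 4 → ZMod 5, mono (dehomGen β T π c) e =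
      hf.basis (Fin.snoc (α := fun _ => ZMod 5) e 0) := by
    intro e
    rw [IsFrame.basis_apply, mono_castSucc (dehomGenAll β T π c)]
    have h1 : (Fin.snoc (α := fun _ => ZMod 5) e 0 : Fin 5 → ZMod 5) (Fin.last 4) = 0 :=
      Fin.snoc_last _ _
    have h2 : (fun i : Fin 4 => (Fin.snoc (α := fun _ => ZMod 5) e 0 : Fin 5 → ZMod 5) i.castSucc) =
        e := funext fun i => Fin.snoc_castSucc _ _ _
    rw [h1, h2, ZMod.val_zero, pow_zero, mul_one]
    exact congrArg (mono · e) (funext fun k => (dehomGenAll_castSucc π c k).symm)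
  have hli : LinearIndependent A (mono (dehomGen β T π c)) := by
    have h1 := hf.basis.linearIndependent.comp
      (fun e : Fin 4 → ZMod 5 => Fin.snoc (α := fun _ => ZMod 5) e 0) fun e e' he => by
        funext k
        have := congrFun he k.castSucc
        simpa using this
    have h2 : mono (dehomGen β T π c) = hf.basis ∘
        (fun e : Fin 4 → ZMod 5 => Fin.snoc (α := fun _ => ZMod 5) e 0) := funext hmono
    rwa [h2]
  intro f g hfg
  funext e
  apply hφ
  -- Independence over `A` gives equality of the images under `φ`; injectivity of `φ` then gives
  -- equality over `B`.
  have h2 := Fintype.linearIndependent_iff.mp hli (fun e => φ (f e) - φ (g e)) (by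
    rw [← sub_eq_zero.mpr hfg, frameMap, frameMap, ← Finset.sum_sub_distrib]
    refine Finset.sum_congr rfl fun e _ => ?_
    rw [sub_smul, Algebra.smul_def, Algebra.smul_def]
    rfl) e
  exact sub_eq_zero.mp h2

/-- The subring generated by the scalars of degree zero and the quotients of the generators. -/
def dehomRing (β : A →+* R) (φ : B →+* A) (T : Fin 5 → R) (π : Equiv.Perm (Fin 5))
    (c : Fin 4 → A) : Subring R :=
  Subring.closure (Set.range (β.comp φ) ∪ Set.range (dehomGen β T π c))

/-- Passing `t_{π 4}` over a quotient costs only a root of unity, and scalars are central. Powers of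
`t_{π 4}` can therefore always be collected on the right. -/
theorem gen_mul_dehomRing (h : QRel (chiAlg q A) β N x T) (h0 : ∀ i, N i i = 0)
    (π : Equiv.Perm (Fin 5)) (hφC : ∀ c : ℂ, φ (algebraMap ℂ B c) = algebraMap ℂ A c)
    {c : Fin 4 → A} {r : R} (hr : r ∈ dehomRing β φ T π c) :
    ∃ r' ∈ dehomRing β φ T π c, T (π 4) * r = r' * T (π 4) := by
  have hall := dehomGenAll_qrel q h h0 π c
  unfold dehomRing at hr
  induction hr using Subring.closure_induction with
  | mem y hy =>
    rcases hy with ⟨a, rfl⟩ | ⟨k, rfl⟩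
    · exact ⟨_, Subring.subset_closure (Or.inl ⟨a, rfl⟩), (h.central _ _).symm⟩
    · have h1 := hall.comm (Fin.last 4) k.castSucc
      rw [dehomGenAll_last, dehomGenAll_castSucc, chiAlg_apply, ← hφC, ← mul_assoc] at h1
      exact ⟨_, Subring.mul_mem _ (Subring.subset_closure (Or.inl ⟨_, rfl⟩))
        (Subring.subset_closure (Or.inr ⟨k, rfl⟩)), h1⟩
  | zero => exact ⟨0, Subring.zero_mem _, by simp⟩
  | one => exact ⟨1, Subring.one_mem _, by simp⟩
  | add y z _ _ hy hz =>
    obtain ⟨y', hy', ey⟩ := hy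
    obtain ⟨z', hz', ez⟩ := hz
    exact ⟨y' + z', Subring.add_mem _ hy' hz', by rw [mul_add, add_mul, ey, ez]⟩
  | neg y _ hy =>
    obtain ⟨y', hy', ey⟩ := hy
    exact ⟨-y', Subring.neg_mem _ hy', by rw [mul_neg, neg_mul, ey]⟩
  | mul y z _ _ hy hz =>
    obtain ⟨y', hy', ey⟩ := hy
    obtain ⟨z', hz', ez⟩ := hz
    exact ⟨y' * z', Subring.mul_mem _ hy' hz', by rw [← mul_assoc, ey, mul_assoc, ez, mul_assoc]⟩

theorem gen_mem_dehomRing_mul (h : QRel (chiAlg q A) β N x T) (π : Equiv.Perm (Fin 5))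
    {c d : Fin 4 → A} (hd : ∀ k, d k * (c k * x (π 4)) = 1) (hdφ : ∀ k, ∃ b, φ b = d k)
    (i : Fin 5) : ∃ r ∈ dehomRing β φ T π c, T i = r * T (π 4) := by
  obtain ⟨k, rfl⟩ := π.surjective i
  refine Fin.lastCases ?_ (fun k => ?_) k
  · exact ⟨1, Subring.one_mem _, (one_mul _).symm⟩
  · obtain ⟨b, hb⟩ := hdφ k
    refine ⟨β (d k) * dehomGen β T π c k, Subring.mul_mem _ (Subring.subset_closure
      (Or.inl ⟨b, by rw [RingHom.comp_apply, hb]⟩)) (Subring.subset_closure (Or.inr ⟨k, rfl⟩)),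
      gen_eq_dehomGen q h k (hd k)⟩

/-- Restriction of the target of a system of generators to a subring. -/
theorem QRel.isFrame_subring {A R : Type*} [CommRing A] [Ring R] {n : ℕ} {κ : AddChar (ZMod 5) A}
    {α : A →+* R} {N : Fin n → Fin n → ZMod 5} {y : Fin n → A} {s : Fin n → R}
    (h : QRel κ α N y s) (hinj : Function.Injective (frameMap α s)) {S : Subring R}
    {α' : A →+* S} (hα : ∀ a, (α' a : R) = α a) {s' : Fin n → S} (hs : ∀ i, (s' i : R) = s i)
    (hS : S ≤ Subring.closure (Set.range α ∪ Set.range s)) : IsFrame κ α' N y s' := by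
  have hmap : ∀ f, S.subtype (frameMap α' s' f) = frameMap α s f := fun f =>
    map_frameMap' S.subtype id hα hs f
  refine ⟨⟨fun a r => Subtype.ext ?_, fun i j => Subtype.ext ?_, fun i => Subtype.ext ?_⟩,
    fun f g hfg => hinj ?_, fun r => ?_⟩
  · rw [Subring.coe_mul, Subring.coe_mul, hα, h.central]
  · simp only [Subring.coe_mul, hα, hs, h.comm i j]
  · rw [Subring.coe_pow, hα, hs, h.pow]
  · rw [← hmap, ← hmap, hfg]
  · obtain ⟨f, hf⟩ := h.closure_le_frameSpan (hS r.2)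
    exact ⟨f, Subtype.ext ((hmap f).trans hf)⟩

end Dehomogenize

end QuantumFermat

namespace QuantumFermat

/-! ### The topology of `X` and its strata -/

theorem isOpen_X_iff {S : Set X} :
    IsOpen S ↔ IsOpen {v : {v : H // v ≠ 0} | X.mk v.1 v.2 ∈ S} := Iff.rfl

theorem X.exists_mk (p : X) : ∃ (v : H) (hv : v ≠ 0), (v : Fin 5 → ℂ) = p.coord ∧ X.mk v hv = p :=
  ⟨Projectivization.rep p, Projectivization.rep_nonzero p, rfl, Projectivization.mk_rep p⟩

theorem X.coord_mk (v : H) (hv : v ≠ 0) :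
    ∃ c : ℂ, c ≠ 0 ∧ (X.mk v hv).coord = c • (v : Fin 5 → ℂ) := by
  obtain ⟨a, ha⟩ := Projectivization.exists_smul_eq_mk_rep ℂ v hv
  exact ⟨a, a.ne_zero, (congrArg Subtype.val ha).symm⟩

theorem X.coord_mk_ne_zero (v : H) (hv : v ≠ 0) (k : Fin 5) :
    (X.mk v hv).coord k ≠ 0 ↔ (v : Fin 5 → ℂ) k ≠ 0 := by
  obtain ⟨c, hc, h⟩ := X.coord_mk v hv
  rw [h, Pi.smul_apply, smul_eq_mul, mul_ne_zero_iff]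
  exact ⟨fun h => h.2, fun h => ⟨hc, h⟩⟩

theorem X.sum_coord (p : X) : ∑ k, p.coord k = 0 := (Projectivization.rep p : H).2

theorem X.coord_ne_zero (p : X) : ∃ k, p.coord k ≠ 0 := by
  by_contra! h
  exact Projectivization.rep_nonzero p (Subtype.ext (funext h))

theorem continuous_H_coord (k : Fin 5) : Continuous fun v : H => (v : Fin 5 → ℂ) k :=
  (continuous_apply k).comp continuous_subtype_val

theorem isOpen_coord_ne_zero (k : Fin 5) : IsOpen {p : X | p.coord k ≠ 0} := by
  rw [isOpen_X_iff]
  simp only [Set.mem_ofPred_eq, X.coord_mk_ne_zero]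
  exact isOpen_ne_fun ((continuous_H_coord k).comp continuous_subtype_val) continuous_const

/-- At least `n` coordinates are nonzero exactly when all coordinates in some set of at least `n`
indices are nonzero, and each of these conditions is open. -/
theorem isOpen_le_ncard (n : ℕ) : IsOpen {p : X | n ≤ {k : Fin 5 | p.coord k ≠ 0}.ncard} := by
  have h : {p : X | n ≤ {k : Fin 5 | p.coord k ≠ 0}.ncard} =
      ⋃ T : {T : Finset (Fin 5) // n ≤ T.card}, ⋂ k ∈ T.1, {p : X | p.coord k ≠ 0} := by
    ext p
    simp only [Set.mem_ofPred_eq, Set.mem_iUnion, Set.mem_iInter]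
    constructor
    · intro h
      classical
      refine ⟨⟨{k : Fin 5 | p.coord k ≠ 0}.toFinset, ?_⟩, fun k hk => by simpa using hk⟩
      rwa [← Set.ncard_eq_toFinset_card']
    · rintro ⟨T, hT⟩
      refine T.2.trans ?_
      rw [← Set.ncard_coe_finset]
      exact Set.ncard_le_ncard (fun k hk => hT k hk) (Set.toFinite _)
  rw [h]
  exact isOpen_iUnion fun T => isOpen_biInter_finset fun k _ => isOpen_coord_ne_zero k

theorem stratum_isLocallyClosed (i : Fin 4) : IsLocallyClosed (stratum i) := by
  have h : stratum i = {p : X | (i : ℕ) + 2 ≤ {k : Fin 5 | p.coord k ≠ 0}.ncard} ∩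
      {p : X | (i : ℕ) + 3 ≤ {k : Fin 5 | p.coord k ≠ 0}.ncard}ᶜ := by
    ext p
    simp only [stratum, Set.mem_inter_iff, Set.mem_compl_iff, Set.mem_ofPred_eq]
    omega
  rw [h]
  exact (isOpen_le_ncard _).isLocallyClosed.inter (isOpen_le_ncard _).isClosed_compl.isLocallyClosed

/-- A single nonzero coordinate cannot sum to zero; this is why the strata start with two nonzero
coordinates. -/
theorem two_le_ncard (p : X) : 2 ≤ {k : Fin 5 | p.coord k ≠ 0}.ncard := by
  obtain ⟨k, hk⟩ := p.coord_ne_zero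
  have hl : ∃ l, l ≠ k ∧ p.coord l ≠ 0 := by
    by_contra! h
    have := p.sum_coord
    rw [Finset.sum_eq_single k (fun l _ hl => h l hl) (by simp)] at this
    exact hk this
  obtain ⟨l, hlk, hl⟩ := hl
  rw [← Set.ncard_pair hlk]
  refine Set.ncard_le_ncard ?_ (Set.toFinite _)
  rintro _ (rfl | rfl)
  · exact hl
  · exact hk

theorem existsUnique_stratum (p : X) : ∃! i : Fin 4, p ∈ stratum i := by
  have h1 := two_le_ncard p
  have h2 : {k : Fin 5 | p.coord k ≠ 0}.ncard ≤ 5 := by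
    have := Set.ncard_le_ncard (Set.subset_univ {k : Fin 5 | p.coord k ≠ 0}) (Set.toFinite _)
    rwa [Set.ncard_univ, Nat.card_eq_fintype_card, Fintype.card_fin] at this
  refine ⟨⟨{k : Fin 5 | p.coord k ≠ 0}.ncard - 2, by omega⟩, ?_, fun j hj => Fin.ext ?_⟩
  · change _ = _ - 2 + 2
    omega
  · change _ = _ + 2 at hj
    change _ = _ - 2
    omega

/-! ### Affine charts -/

/-- The affine coordinates `v_{π (j + 1)} / v_{π 4} - c_j`, where `π` is an ordering of the
homogeneous coordinates. -/
noncomputable def chartFun (π : Equiv.Perm (Fin 5)) (c : Fin 3 → ℂ) (v : Fin 5 → ℂ) : C3 :=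
  fun j => v (π j.succ.castSucc) / v (π 4) - c j

/-- The quotients `v_{π k} / v_{π 4}` in terms of the affine coordinates. -/
noncomputable def affCoord (c : Fin 3 → ℂ) (a : C3) : Fin 4 → ℂ :=
  -- The five quotients by `v_{π 4}`, including the quotient 1, sum to zero, so the quotient at `π
  -- 0` is determined by the other three.
  Fin.cons (α := fun _ => ℂ) (-1 - ∑ j, (a j + c j)) fun j => a j + c j

theorem affCoord_succ (c : Fin 3 → ℂ) (a : C3) (j : Fin 3) : affCoord c a j.succ = a j + c j :=
  Fin.cons_succ (α := fun _ => ℂ) _ _ _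

theorem sum_affCoord (c : Fin 3 → ℂ) (a : C3) : ∑ k, affCoord c a k = -1 := by
  rw [Fin.sum_univ_succ]
  simp only [affCoord_succ]
  change -1 - ∑ j, (a j + c j) + _ = _
  ring

theorem differentiable_affCoord (c : Fin 3 → ℂ) (k : Fin 4) :
    Differentiable ℂ fun a => affCoord c a k := by
  refine Fin.cases ?_ (fun j => ?_) k
  · change Differentiable ℂ fun a : C3 => -1 - ∑ j, (a j + c j)
    fun_prop
  · simp only [affCoord_succ]
    fun_prop

variable (π : Equiv.Perm (Fin 5)) (c : Fin 3 → ℂ)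

theorem chartFun_smul {t : ℂ} (ht : t ≠ 0) (v : Fin 5 → ℂ) :
    chartFun π c (t • v) = chartFun π c v := by
  funext j
  simp only [chartFun, Pi.smul_apply, smul_eq_mul]
  rw [mul_div_mul_left _ _ ht]

theorem sum_perm (v : Fin 5 → ℂ) : ∑ k, v k = ∑ k : Fin 4, v (π k.castSucc) + v (π 4) := by
  rw [← Equiv.sum_comp π, Fin.sum_univ_castSucc]
  rfl

theorem affCoord_chartFun {v : Fin 5 → ℂ} (hv : ∑ k, v k = 0) (h4 : v (π 4) ≠ 0) (k : Fin 4) :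
    affCoord c (chartFun π c v) k = v (π k.castSucc) / v (π 4) := by
  have hs : ∀ j : Fin 3, affCoord c (chartFun π c v) j.succ = v (π j.succ.castSucc) / v (π 4) := by
    intro j
    rw [affCoord_succ, chartFun]
    ring
  refine Fin.cases ?_ hs k
  have h1 := sum_affCoord c (chartFun π c v)
  rw [Fin.sum_univ_succ] at h1
  simp only [hs] at h1
  rw [sum_perm π, Fin.sum_univ_succ] at hv
  rw [eq_div_iff h4]
  have h2 : (∑ j : Fin 3, v (π j.succ.castSucc) / v (π 4)) * v (π 4) =
      ∑ j : Fin 3, v (π j.succ.castSucc) := by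
    rw [Finset.sum_mul]
    exact Finset.sum_congr rfl fun j _ => div_mul_cancel₀ _ h4
  linear_combination v (π 4) * h1 - hv - h2

/-- The homogeneous coordinates of a point with given affine coordinates. -/
noncomputable def chartInvFun (a : C3) : Fin 5 → ℂ := fun i =>
  (Fin.snoc (α := fun _ => ℂ) (affCoord c a) 1 : Fin 5 → ℂ) (π.symm i)

theorem chartInvFun_castSucc (a : C3) (k : Fin 4) :
    chartInvFun π c a (π k.castSucc) = affCoord c a k := by
  rw [chartInvFun, Equiv.symm_apply_apply]
  exact Fin.snoc_castSucc _ _ _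

theorem chartInvFun_last (a : C3) : chartInvFun π c a (π 4) = 1 := by
  rw [chartInvFun, Equiv.symm_apply_apply]
  exact Fin.snoc_last _ _

/-- The vector in `H` with given affine coordinates. -/
noncomputable def chartInv (a : C3) : H := ⟨chartInvFun π c a, by
  change ∑ k, chartInvFun π c a k = 0
  rw [sum_perm π, chartInvFun_last]
  simp only [chartInvFun_castSucc, sum_affCoord]
  ring⟩

theorem chartInv_ne_zero (a : C3) : chartInv π c a ≠ 0 := fun h => by
  have h1 := chartInvFun_last π c a
  have h2 : chartInvFun π c a = 0 := congrArg Subtype.val h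
  rw [h2] at h1
  exact zero_ne_one h1

theorem perm_ext {v v' : Fin 5 → ℂ} (h : ∀ k : Fin 4, v (π k.castSucc) = v' (π k.castSucc))
    (h4 : v (π 4) = v' (π 4)) : v = v' := by
  funext i
  obtain ⟨k, rfl⟩ := π.surjective i
  exact Fin.lastCases h4 h k

theorem chartInv_chartFun {v : H} (h4 : (v : Fin 5 → ℂ) (π 4) ≠ 0) :
    chartInv π c (chartFun π c v) = ((v : Fin 5 → ℂ) (π 4))⁻¹ • v := by
  refine Subtype.ext (perm_ext π (fun k => ?_) ?_)
  · refine (chartInvFun_castSucc π c _ k).trans ?_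
    rw [affCoord_chartFun π c v.2 h4, div_eq_inv_mul]
    rfl
  · refine (chartInvFun_last π c _).trans ?_
    exact (inv_mul_cancel₀ h4).symm

theorem chartFun_chartInv (a : C3) : chartFun π c (chartInv π c a) = a := by
  funext j
  change chartInvFun π c a _ / chartInvFun π c a _ - c j = _
  rw [chartInvFun_castSucc, chartInvFun_last, affCoord_succ]
  ring

/-- A linear left inverse of the inclusion of `H` recovers the map from its five coordinates. -/
theorem differentiable_to_H {f : C3 → H} (h : ∀ k, Differentiable ℂ fun a => (f a : Fin 5 → ℂ) k) :
    Differentiable ℂ f := by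
  obtain ⟨g, hg⟩ := LinearMap.exists_leftInverse_of_injective H.subtype H.ker_subtype
  have h1 : f = fun a => g.toContinuousLinearMap (f a : Fin 5 → ℂ) :=
    funext fun a => (LinearMap.congr_fun hg (f a)).symm
  rw [h1]
  exact g.toContinuousLinearMap.differentiable.comp (differentiable_pi.mpr h)

theorem differentiable_chartInv : Differentiable ℂ (chartInv π c) := by
  refine differentiable_to_H fun i => ?_
  obtain ⟨k, rfl⟩ := π.surjective i
  refine Fin.lastCases ?_ (fun k => ?_) k
  · have h : (fun a => (chartInv π c a : Fin 5 → ℂ) (π (Fin.last 4))) = fun _ => 1 :=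
      funext fun a => chartInvFun_last π c a
    rw [h]
    exact differentiable_const _
  · have h : (fun a => (chartInv π c a : Fin 5 → ℂ) (π k.castSucc)) = fun a => affCoord c a k :=
      funext fun a => chartInvFun_castSucc π c a k
    rw [h]
    exact differentiable_affCoord c k

theorem differentiable_H_coord (k : Fin 5) : Differentiable ℂ fun v : H => (v : Fin 5 → ℂ) k :=
  ((ContinuousLinearMap.proj (R := ℂ) (φ := fun _ : Fin 5 => ℂ) k).comp H.subtypeL).differentiable

theorem differentiableOn_chartFun :
    DifferentiableOn ℂ (fun v : H => chartFun π c v) {v : H | (v : Fin 5 → ℂ) (π 4) ≠ 0} := by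
  refine differentiableOn_pi.mpr fun j => ?_
  have h : DifferentiableOn ℂ (fun v : H => (v : Fin 5 → ℂ) (π j.succ.castSucc) /
      (v : Fin 5 → ℂ) (π 4)) {v : H | (v : Fin 5 → ℂ) (π 4) ≠ 0} := by
    intro v hv
    simp only [div_eq_mul_inv]
    exact ((differentiable_H_coord _ v).mul
      ((differentiable_H_coord _ v).inv hv)).differentiableWithinAt
  exact h.sub_const _

/-- The open subset of `X` that is given by conditions on the affine coordinates. -/
noncomputable def chartOpens (Ω : Opens C3) : Opens X where
  carrier := {p | p.coord (π 4) ≠ 0 ∧ chartFun π c p.coord ∈ Ω}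
  is_open' := by
    rw [isOpen_X_iff]
    have h1 : IsOpen ({v : H | (v : Fin 5 → ℂ) (π 4) ≠ 0} ∩
        (fun v : H => chartFun π c v) ⁻¹' Ω) :=
      (differentiableOn_chartFun π c).continuousOn.isOpen_inter_preimage
        (isOpen_ne_fun (continuous_H_coord _) continuous_const) Ω.2
    convert h1.preimage (continuous_subtype_val (p := fun v : H => v ≠ 0)) using 1
    ext v
    obtain ⟨t, ht, h⟩ := X.coord_mk v.1 v.2
    simp only [Set.mem_ofPred_eq, X.coord_mk_ne_zero, h, chartFun_smul π c ht]
    rfl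

theorem mk_mem_chartOpens {Ω : Opens C3} {v : H} (hv : v ≠ 0) :
    X.mk v hv ∈ chartOpens π c Ω ↔ (v : Fin 5 → ℂ) (π 4) ≠ 0 ∧ chartFun π c v ∈ Ω := by
  obtain ⟨t, ht, h⟩ := X.coord_mk v hv
  change (X.mk v hv).coord (π 4) ≠ 0 ∧ chartFun π c (X.mk v hv).coord ∈ Ω ↔ _
  rw [X.coord_mk_ne_zero, h, chartFun_smul π c ht]

/-- The chart. -/
noncomputable def chartMap (Ω : Opens C3) (x : chartOpens π c Ω) : C3 := chartFun π c x.1.coord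

theorem chartMap_mk {Ω : Opens C3} (x : chartOpens π c Ω) {v : H} (hv : v ≠ 0)
    (h : X.mk v hv = x) : chartMap π c Ω x = chartFun π c v := by
  obtain ⟨t, ht, h'⟩ := X.coord_mk v hv
  rw [chartMap, ← h, h', chartFun_smul π c ht]

theorem mk_chartInv_chartMap {Ω : Opens C3} (x : chartOpens π c Ω) :
    X.mk (chartInv π c (chartMap π c Ω x)) (chartInv_ne_zero π c _) = x := by
  obtain ⟨v, hv, hvc, hx⟩ := X.exists_mk x.1
  have h4 : (v : Fin 5 → ℂ) (π 4) ≠ 0 := by rw [hvc]; exact x.2.1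
  refine (X.mk_eq_of_smul (c := ((v : Fin 5 → ℂ) (π 4))⁻¹) hv (chartInv_ne_zero π c _) ?_).trans hx
  rw [chartMap_mk π c x hv hx, chartInv_chartFun π c h4]

theorem mk_chartInv_mem {Ω : Opens C3} {a : C3} (ha : a ∈ Ω) :
    X.mk (chartInv π c a) (chartInv_ne_zero π c a) ∈ chartOpens π c Ω := by
  rw [mk_mem_chartOpens]
  refine ⟨?_, ?_⟩
  · change chartInvFun π c a (π 4) ≠ 0
    rw [chartInvFun_last]
    exact one_ne_zero
  · rwa [chartFun_chartInv]

/-- The inverse lifts to the continuous section `chartInv` of the cone. The image of an open set is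
the preimage of a cone under this section, intersected with `Ω`, hence open. -/
theorem chartMap_isOpenEmbedding (Ω : Opens C3) :
    Topology.IsOpenEmbedding (chartMap π c Ω) := by
  refine Topology.IsOpenEmbedding.of_continuous_injective_isOpenMap ?_ ?_ ?_
  · refine continuous_def.mpr fun S hS => ?_
    have h : chartMap π c Ω ⁻¹' S = Subtype.val ⁻¹' (chartOpens π c ⟨S, hS⟩ : Set X) := by
      ext x
      exact ⟨fun h => ⟨x.2.1, h⟩, fun h => h.2⟩
    rw [h]
    exact (chartOpens π c ⟨S, hS⟩).2.preimage continuous_subtype_val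
  · intro x x' h
    refine Subtype.ext ?_
    rw [← mk_chartInv_chartMap π c x, ← mk_chartInv_chartMap π c x']
    congr 2
  · intro T hT
    obtain ⟨T', hT', rfl⟩ := isOpen_induced_iff.mp hT
    have h : chartMap π c Ω '' (Subtype.val ⁻¹' T') =
        (Ω : Set C3) ∩ chartInv π c ⁻¹' (cone ⟨T', hT'⟩ : Set H) := by
      ext a
      constructor
      · rintro ⟨x, hx, rfl⟩
        refine ⟨x.2.2, chartInv_ne_zero π c _, ?_⟩
        rw [mk_chartInv_chartMap]
        exact hx
      · rintro ⟨ha, _, h⟩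
        refine ⟨⟨_, mk_chartInv_mem π c ha⟩, h, ?_⟩
        rw [chartMap_mk π c _ (chartInv_ne_zero π c a) rfl, chartFun_chartInv]
    rw [h]
    exact Ω.2.inter ((cone _).2.preimage (differentiable_chartInv π c).continuous)

/-! ### Pullback of holomorphic functions -/

/-- An open subset of `X` and its image under the affine coordinates. -/
structure IsChartPair (W : Opens X) (V : Opens C3) : Prop where
  ne_zero : ∀ v ∈ cone W, (v : Fin 5 → ℂ) (π 4) ≠ 0
  fst : ∀ v ∈ cone W, chartFun π c v ∈ V
  snd : ∀ a ∈ V, chartInv π c a ∈ cone W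

variable {π c}

/-- The pullback of holomorphic functions along the affine coordinates, as functions on the cone. -/
noncomputable def pull {W : Opens X} {V : Opens C3} (h : IsChartPair π c W V) :
    holo V →+* holo (cone W) where
  toFun f := ⟨fun v => f.1 ⟨chartFun π c v.1, h.fst v.1 v.2⟩, by
    obtain ⟨F, hF, hf⟩ := f.2
    exact ⟨fun v => F (chartFun π c v), hF.comp ((differentiableOn_chartFun π c).mono
      fun v hv => h.ne_zero v hv) fun v hv => h.fst v hv, fun v => hf ⟨_, h.fst v.1 v.2⟩⟩⟩
  map_one' := rfl
  map_mul' _ _ := rfl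
  map_zero' := rfl
  map_add' _ _ := rfl

theorem pull_apply {W : Opens X} {V : Opens C3} (h : IsChartPair π c W V) (f : holo V)
    (v : cone W) : (pull h f).1 v = f.1 ⟨chartFun π c v.1, h.fst v.1 v.2⟩ := rfl

theorem pull_homogNeg {W : Opens X} {V : Opens C3} (h : IsChartPair π c W V) (f : holo V) :
    HomogNeg 0 (pull h f) := by
  intro v v' t ht
  rw [pow_zero, one_mul, pull_apply, pull_apply]
  have ht0 : t ≠ 0 := by
    rintro rfl
    exact v'.2.1 (by rw [ht, zero_smul])
  have h1 : chartFun π c v'.1 = chartFun π c v.1 := by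
    rw [ht]
    exact chartFun_smul π c ht0 _
  simp only [h1]

/-- The pullback of holomorphic functions along the affine coordinates. -/
noncomputable def pullEquiv {W : Opens X} {V : Opens C3} (h : IsChartPair π c W V) :
    holo V ≃+* secO W where
  toFun f := ⟨pull h f, pull_homogNeg h f⟩
  invFun g := ⟨fun a => g.1.1 ⟨chartInv π c a.1, h.snd a.1 a.2⟩, by
    obtain ⟨G, hG, hg⟩ := g.1.2
    exact ⟨fun a => G (chartInv π c a), hG.comp (differentiable_chartInv π c).differentiableOn
      fun a ha => h.snd a ha, fun a => hg ⟨_, h.snd a.1 a.2⟩⟩⟩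
  left_inv f := by
    refine Subtype.ext (funext fun a => ?_)
    exact congrArg f.1 (Subtype.ext (chartFun_chartInv π c a.1) :
      (⟨chartFun π c (chartInv π c a.1), h.fst _ (h.snd a.1 a.2)⟩ : V) = a)
  right_inv g := by
    refine Subtype.ext (Subtype.ext (funext fun v => ?_))
    have h1 := g.2 v ⟨chartInv π c (chartFun π c v.1), h.snd _ (h.fst v.1 v.2)⟩ _
      (chartInv_chartFun π c (h.ne_zero v.1 v.2))
    rw [pow_zero, one_mul] at h1
    exact h1
  map_mul' _ _ := rfl
  map_add' _ _ := rfl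

end QuantumFermat

namespace QuantumFermat

/-! ### The order of the homogeneous coordinates -/

/-- The conditions on commutation exponents under which the local models have a frame. -/
def GoodExp (i : Fin 4) (N : Fin 4 → Fin 4 → ZMod 5) : Prop :=
  N 0 1 ≠ 0 ∧ N 0 1 * N 2 3 - N 0 2 * N 1 3 + N 0 3 * N 1 2 = 0 ∧
    (i = 0 → ∃ a : ZMod 5, a ≠ 0 ∧ N 0 1 = 3 * a ∧ N 0 2 = 4 * a ∧ N 0 3 = 3 * a)

instance (i : Fin 4) (N : Fin 4 → Fin 4 → ZMod 5) : Decidable (GoodExp i N) := by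
  unfold GoodExp
  infer_instance

/-- The last index of `π` gives the denominator, the first the eliminated coordinate, and the middle
ones list the nonvanishing coordinates before the vanishing ones. The order also has to make `N 0 1`
nonzero and, if `i = 0`, to make the first row proportional to that of `g` in the Jacobi algebra.
The form is invariant under cyclic shifts of the indices, and the whole statement is a finite check.
-/
theorem exists_order : ∀ (i : Fin 4) (S : Finset (Fin 5)), S.card = i + 2 →
    ∃ π : Equiv.Perm (Fin 5), π 4 ∈ S ∧ π 0 ∈ S ∧
      (∀ j : Fin 3, π j.succ.castSucc ∈ S ↔ (j : ℕ) < i) ∧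
        GoodExp i (dehomExp fermatExp π) := by
  decide +kernel

theorem dehomExp_self {N : Fin 5 → Fin 5 → ZMod 5} (h0 : ∀ i, N i i = 0)
    (hN : ∀ i j, N j i = -N i j) (π : Equiv.Perm (Fin 5)) (k : Fin 4) : dehomExp N π k k = 0 := by
  rw [dehomExp, h0, hN (π k.castSucc) (π 4)]
  ring

theorem dehomExp_swap {N : Fin 5 → Fin 5 → ZMod 5} (hN : ∀ i j, N j i = -N i j)
    (π : Equiv.Perm (Fin 5)) (k l : Fin 4) : dehomExp N π l k = -dehomExp N π k l := by
  rw [dehomExp, dehomExp, hN (π k.castSucc) (π l.castSucc), hN (π k.castSucc) (π 4),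
    hN (π 4) (π l.castSucc)]
  ring

/-! ### Frames of the local models -/

section LocalModel

variable (q : ℂ) [Fact (IsPrimitiveRoot q 5)]

/-- The fifth powers of the generators of the local models. -/
noncomputable def modelPow (i : Fin 4) : Fin 4 → P :=
  Fin.cons (α := fun _ => P) 1 fun j => if (j : ℕ) < i then 1 else MvPolynomial.X j

theorem modelPow_eq (i : Fin 4) : modelPow i = ![![1, MvPolynomial.X 0, MvPolynomial.X 1,
    MvPolynomial.X 2], ![1, 1, MvPolynomial.X 1, MvPolynomial.X 2], ![1, 1, 1, MvPolynomial.X 2],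
    ![1, 1, 1, 1]] i := by
  funext k
  fin_cases i <;> fin_cases k <;> rfl

theorem exists_localModel_frame {i : Fin 4} {N : Fin 4 → Fin 4 → ZMod 5} (h0 : ∀ k, N k k = 0)
    (hN : ∀ k l, N l k = -N k l) (h : GoodExp i N) : ∃ s : Fin 4 → localModel q i,
      IsFrame (chiAlg q P) (algebraMap P (localModel q i)) N (modelPow i) s := by
  obtain ⟨h01, hpf, hi⟩ := h
  rw [modelPow_eq]
  fin_cases i
  · obtain ⟨a, ha, h1, h2, h3⟩ := hi rfl
    exact exists_jac_frame q h0 hN ha h1 h2 h3 hpf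
  · exact exists_J1_frame q h0 hN h01 hpf
  · exact exists_J2_frame q h0 hN h01 hpf
  · exact exists_J3_frame q h0 hN h01 hpf

instance (V : Opens C3) : IsScalarTower ℂ P (holo V) :=
  IsScalarTower.of_algebraMap_eq fun c => by
    change _ = MvPolynomial.aeval (coordC3 V) (MvPolynomial.C c)
    rw [MvPolynomial.aeval_C]

/-- Base change of frames. -/
theorem IsFrame.baseChange {A D : Type} [CommRing A] [Algebra ℂ A] [Algebra P A]
    [IsScalarTower ℂ P A] [Ring D] [Algebra P D] {n : ℕ} {N : Fin n → Fin n → ZMod 5}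
    {y : Fin n → P} {s : Fin n → D} (h : IsFrame (chiAlg q P) (algebraMap P D) N y s) :
    IsFrame (chiAlg q A) (Algebra.TensorProduct.includeLeftRingHom : A →+* A ⊗[P] D) N
      (fun k => algebraMap P A (y k)) fun k => (1 : A) ⊗ₜ[P] s k := by
  have hP : ∀ (p : P) (d : D), (1 : A) ⊗ₜ[P] (algebraMap P D p * d) =
      (algebraMap P A p ⊗ₜ[P] 1) * ((1 : A) ⊗ₜ[P] d) := by
    intro p d
    rw [← Algebra.smul_def, ← TensorProduct.smul_tmul, Algebra.smul_def,
      Algebra.TensorProduct.tmul_mul_tmul, one_mul]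
  refine ⟨⟨fun a r => Algebra.commutes a r, fun i j => ?_, fun i => ?_⟩, ?_⟩
  · rw [Algebra.TensorProduct.tmul_mul_tmul, h.comm, mul_one, hP,
      Algebra.TensorProduct.tmul_mul_tmul, mul_one, chiAlg_apply, chiAlg_apply,
      ← IsScalarTower.algebraMap_apply]
    rw [Algebra.TensorProduct.tmul_mul_tmul, mul_one]
    change _ = (algebraMap ℂ A (chi q (N i j)) ⊗ₜ[P] (1 : D)) * _
    rw [Algebra.TensorProduct.tmul_mul_tmul, mul_one]
  · have := hP (y i) 1
    rw [mul_one, ← Algebra.TensorProduct.one_def, mul_one] at this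
    rw [Algebra.TensorProduct.tmul_pow, one_pow, h.pow, this]
    rfl
  · let b := Algebra.TensorProduct.basis A h.basis
    have hb : ∀ f, frameMap (Algebra.TensorProduct.includeLeftRingHom : A →+* A ⊗[P] D)
        (fun k => (1 : A) ⊗ₜ[P] s k) f = b.equivFun.symm f := by
      intro f
      rw [Module.Basis.equivFun_symm_apply, frameMap]
      refine Finset.sum_congr rfl fun e _ => ?_
      have h1 := map_mono (R := D) (R' := A ⊗[P] D) (Algebra.TensorProduct.includeRight
        (R := P) (A := A) (B := D)).toRingHom s e
      have h2 : mono (fun k => (1 : A) ⊗ₜ[P] s k) e = 1 ⊗ₜ mono s e := h1.symm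
      rw [h2, Algebra.TensorProduct.basis_apply, h.basis_apply, TensorProduct.smul_tmul',
        smul_eq_mul, mul_one]
      change (f e ⊗ₜ[P] (1 : D)) * _ = _
      rw [Algebra.TensorProduct.tmul_mul_tmul, mul_one, one_mul]
    rw [funext hb]
    exact b.equivFun.symm.bijective

end LocalModel

/-! ### Fifth roots of the affine coordinates -/

/-- The functions `affCoord` on an open subset of `ℂ³`. -/
noncomputable def affFun (c : Fin 3 → ℂ) (V : Opens C3) (k : Fin 4) : holo V :=
  ⟨fun a => affCoord c a.1 k, fun a => affCoord c a k,
    (differentiable_affCoord c k).differentiableOn, fun _ => rfl⟩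

/-- A neighbourhood of the origin on which the affine coordinates that do not vanish at the origin
have fifth roots. -/
noncomputable def rootOpens (c : Fin 3 → ℂ) : Opens C3 where
  carrier := ⋂ k : Fin 4, {a | affCoord c 0 k ≠ 0 →
    affCoord c a k / affCoord c 0 k ∈ Complex.slitPlane}
  is_open' := isOpen_iInter_of_finite fun k => by
    by_cases h : affCoord c 0 k = 0
    · simp [h]
    · simp only [ne_eq, h, not_false_eq_true, forall_true_left]
      exact Complex.isOpen_slitPlane.preimage
        ((differentiable_affCoord c k).continuous.div_const _)

theorem mem_rootOpens {c : Fin 3 → ℂ} {a : C3} : a ∈ rootOpens c ↔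
    ∀ k, affCoord c 0 k ≠ 0 → affCoord c a k / affCoord c 0 k ∈ Complex.slitPlane :=
  Set.mem_iInter

theorem zero_mem_rootOpens (c : Fin 3 → ℂ) : (0 : C3) ∈ rootOpens c := by
  rw [mem_rootOpens]
  intro k hk
  rw [div_self hk]
  exact Complex.one_mem_slitPlane

/-- Divided by its value at the origin, the function stays in the slit plane, where the principal
power with exponent `-1/5` is holomorphic. The opposite power provides the inverse. -/
theorem exists_root {c : Fin 3 → ℂ} {k : Fin 4} (hk : affCoord c 0 k ≠ 0) :
    ∃ ρ : (holo (rootOpens c))ˣ, (ρ : holo (rootOpens c)) ^ 5 * affFun c _ k = 1 := by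
  -- The constant `b` makes up for the normalization by the value at the origin.
  obtain ⟨b, hb⟩ := IsAlgClosed.exists_pow_nat_eq (affCoord c 0 k)⁻¹ (n := 5) (by norm_num)
  have hb0 : b ≠ 0 := by
    rintro rfl
    rw [zero_pow (by norm_num)] at hb
    exact inv_ne_zero hk hb.symm
  have hu : ∀ a ∈ rootOpens c, affCoord c a k / affCoord c 0 k ∈ Complex.slitPlane :=
    fun a ha => mem_rootOpens.mp ha k hk
  have hdiv : Differentiable ℂ fun a => affCoord c a k / affCoord c 0 k := by
    simp only [div_eq_mul_inv]
    exact (differentiable_affCoord c k).mul_const _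
  have hd : ∀ z : ℂ, DifferentiableOn ℂ (fun a => (affCoord c a k / affCoord c 0 k) ^ z)
      (rootOpens c) := fun z a ha =>
    DifferentiableAt.differentiableWithinAt (DifferentiableAt.comp
      (g := fun w : ℂ => w ^ z) (f := fun a => affCoord c a k / affCoord c 0 k) a
      (differentiableAt_id.cpow (differentiableAt_const z) (hu a ha))
      (hdiv a))
  let ρ : holo (rootOpens c) := ⟨fun a => b * (affCoord c a.1 k / affCoord c 0 k) ^ (-(1 / 5) : ℂ),
    _, (differentiableOn_const b).mul (hd _), fun _ => rfl⟩
  let ρ' : holo (rootOpens c) := ⟨fun a => b⁻¹ * (affCoord c a.1 k / affCoord c 0 k) ^ (1 / 5 : ℂ),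
    _, (differentiableOn_const b⁻¹).mul (hd _), fun _ => rfl⟩
  have h1 : ρ * ρ' = 1 := by
    refine Subtype.ext (funext fun a => ?_)
    have ha := Complex.slitPlane_ne_zero (hu a.1 a.2)
    change (b * (affCoord c a.1 k / affCoord c 0 k) ^ (-(1 / 5) : ℂ)) *
      (b⁻¹ * (affCoord c a.1 k / affCoord c 0 k) ^ (1 / 5 : ℂ)) = 1
    rw [Complex.cpow_neg]
    have := (Complex.cpow_ne_zero_iff_of_exponent_ne_zero (y := (1 / 5 : ℂ)) (by norm_num)).mpr ha
    field_simp
  refine ⟨⟨ρ, ρ', h1, by rw [mul_comm, h1]⟩, ?_⟩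
  refine Subtype.ext (funext fun a => ?_)
  have ha := Complex.slitPlane_ne_zero (hu a.1 a.2)
  change (b * (affCoord c a.1 k / affCoord c 0 k) ^ (-(1 / 5) : ℂ)) ^ 5 * affCoord c a.1 k = 1
  have h2 : ((affCoord c a.1 k / affCoord c 0 k) ^ (-(1 / 5) : ℂ)) ^ 5 =
      (affCoord c a.1 k / affCoord c 0 k)⁻¹ := by
    rw [← Complex.cpow_mul_nat, ← Complex.cpow_neg_one]
    norm_num
  rw [mul_pow, hb, h2]
  have h3 : affCoord c a.1 k ≠ 0 := fun h => ha (by rw [h, zero_div])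
  field_simp

/-- Functions that do not vanish at the origin are rescaled to 1. For the others `c j = 0`, so the
function already is the coordinate and the factor 1 suffices. -/
theorem exists_units {i : Fin 4} {c : Fin 3 → ℂ} (h0 : affCoord c 0 0 ≠ 0)
    (hc : ∀ j : Fin 3, c j ≠ 0 ↔ (j : ℕ) < i) : ∃ ρ : Fin 4 → (holo (rootOpens c))ˣ,
      ∀ k, (ρ k : holo (rootOpens c)) ^ 5 * affFun c _ k =
        algebraMap P (holo (rootOpens c)) (modelPow i k) := by
  have h : ∀ k, ∃ ρ : (holo (rootOpens c))ˣ, (ρ : holo (rootOpens c)) ^ 5 * affFun c _ k =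
      algebraMap P (holo (rootOpens c)) (modelPow i k) := by
    intro k
    refine Fin.cases ?_ (fun j => ?_) k
    · obtain ⟨ρ, hρ⟩ := exists_root h0
      refine ⟨ρ, hρ.trans ?_⟩
      exact (map_one _).symm
    · have hs : affCoord c 0 j.succ = c j := by rw [affCoord_succ]; simp
      by_cases hj : (j : ℕ) < i
      · obtain ⟨ρ, hρ⟩ := exists_root (c := c) (k := j.succ) (by rw [hs]; exact (hc j).mpr hj)
        refine ⟨ρ, hρ.trans ?_⟩
        have : modelPow i j.succ = 1 := by
          refine (Fin.cons_succ (α := fun _ => P) _ _ _).trans ?_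
          rw [if_pos hj]
        rw [this, map_one]
      · refine ⟨1, ?_⟩
        have : modelPow i j.succ = MvPolynomial.X j := by
          refine (Fin.cons_succ (α := fun _ => P) _ _ _).trans ?_
          rw [if_neg hj]
        rw [this, algebraMap_C3, Units.val_one, one_pow, one_mul]
        refine Subtype.ext (funext fun a => ?_)
        have hcj : c j = 0 := by
          by_contra h
          exact hj ((hc j).mp h)
        change affCoord c a.1 j.succ = a.1 j
        rw [affCoord_succ, hcj, add_zero]
  exact ⟨fun k => (h k).choose, fun k => (h k).choose_spec⟩

end QuantumFermat

namespace QuantumFermat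

variable (q : ℂ) [Fact (IsPrimitiveRoot q 5)] {π : Equiv.Perm (Fin 5)} {c : Fin 3 → ℂ}
  {W : Opens X} {V : Opens C3}

/-! ### The sections of `𝒜` over a chart -/

/-- The inverse of the homogeneous coordinate that does not vanish on a chart. -/
noncomputable def invCoord (h : IsChartPair π c W V) : holo (cone W) :=
  ⟨fun v => ((v.1 : Fin 5 → ℂ) (π 4))⁻¹, fun v => ((v : Fin 5 → ℂ) (π 4))⁻¹, fun v hv =>
    ((differentiable_H_coord (π 4) v).inv (h.ne_zero v hv)).differentiableWithinAt, fun _ => rfl⟩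

theorem invCoord_mul (h : IsChartPair π c W V) :
    invCoord h * coordVal (holo (cone W)) (π 4) = 1 := by
  rw [coordVal_holo]
  exact Subtype.ext (funext fun v => inv_mul_cancel₀ (h.ne_zero v.1 v.2))

theorem pull_affFun (h : IsChartPair π c W V) (k : Fin 4) :
    pull h (affFun c V k) = coordVal (holo (cone W)) (π k.castSucc) * invCoord h := by
  rw [coordVal_holo]
  refine Subtype.ext (funext fun v => ?_)
  exact (affCoord_chartFun π c v.1.2 (h.ne_zero v.1 v.2) k).trans (div_eq_mul_inv _ _)

/-- The scalar factors of the generators of `𝒜` over a chart. -/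
noncomputable def chartCoeff (h : IsChartPair π c W V) (ρ : Fin 4 → (holo V)ˣ) (k : Fin 4) :
    holo (cone W) := pull h (ρ k) * invCoord h

theorem pull_inv_mul_chartCoeff (h : IsChartPair π c W V) (ρ : Fin 4 → (holo V)ˣ) (k : Fin 4) :
    pull h ((ρ k)⁻¹ : (holo V)ˣ) * (chartCoeff h ρ k * coordVal (holo (cone W)) (π 4)) = 1 := by
  rw [chartCoeff, mul_assoc (pull h _), invCoord_mul, mul_one, ← map_mul, Units.inv_mul, map_one]

/-- With the factor `ρ / x_{π 4}`, the fifth power of the generator becomes `ρ ^ 5` times `x_{π k} /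
x_{π 4}`, which is the pullback of an affine coordinate. -/
theorem chartCoeff_pow (h : IsChartPair π c W V) {ρ : Fin 4 → (holo V)ˣ} {y : Fin 4 → holo V}
    (hy : ∀ k, (ρ k : holo V) ^ 5 * affFun c V k = y k) (k : Fin 4) :
    chartCoeff h ρ k ^ 5 * (coordVal (holo (cone W)) (π k.castSucc) *
      coordVal (holo (cone W)) (π 4) ^ 4) = pull h (y k) := by
  rw [← hy, map_mul, map_pow, pull_affFun, chartCoeff]
  have h1 := invCoord_mul h
  generalize coordVal (holo (cone W)) (π 4) = x at h1
  have h2 : (invCoord h * x) ^ 4 = 1 := by rw [h1, one_pow]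
  linear_combination (pull h (ρ k) ^ 5 * coordVal (holo (cone W)) (π k.castSucc) * invCoord h) * h2

theorem pull_algebraMap (h : IsChartPair π c W V) (z : ℂ) :
    pull h (algebraMap ℂ (holo V) z) = algebraMap ℂ (holo (cone W)) z := rfl

/-- The subring of the pullback that is generated by the functions on a chart and the generators
of `𝒜`. -/
noncomputable def chartRing (h : IsChartPair π c W V) (ρ : Fin 4 → (holo V)ˣ) :
    Subring (conePull q W) :=
  dehomRing (coneScalar q W) (pull h) (coneGen q W) π (chartCoeff h ρ)

theorem coneScalar_mem_chartRing (h : IsChartPair π c W V) (ρ : Fin 4 → (holo V)ˣ)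
    {f : holo (cone W)} (hf : HomogNeg 0 f) : coneScalar q W f ∈ chartRing q h ρ := by
  have h1 : pull h ((pullEquiv h).symm ⟨f, hf⟩) = f :=
    congrArg Subtype.val ((pullEquiv h).apply_symm_apply ⟨f, hf⟩)
  exact Subring.subset_closure (Or.inl ⟨(pullEquiv h).symm ⟨f, hf⟩, congrArg (coneScalar q W) h1⟩)

theorem coneIncl_gen_mem (h : IsChartPair π c W V) (ρ : Fin 4 → (holo V)ˣ) {b : FermatAlg q}
    (hb : b ∈ Submodule.span ℂ (Set.range (gen q))) :
    ∃ r ∈ chartRing q h ρ, coneIncl q W b = r * coneGen q W (π 4) := by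
  induction hb using Submodule.span_induction with
  | mem y hy =>
    obtain ⟨k, rfl⟩ := hy
    exact gen_mem_dehomRing_mul q (cone_isFrame q W).toQRel π (pull_inv_mul_chartCoeff h ρ)
      (fun k => ⟨_, rfl⟩) k
  | zero => exact ⟨0, Subring.zero_mem _, by rw [map_zero, zero_mul]⟩
  | add y z _ _ hy hz =>
    obtain ⟨r, hr, er⟩ := hy
    obtain ⟨s, hs, es⟩ := hz
    exact ⟨r + s, Subring.add_mem _ hr hs, by rw [map_add, er, es, add_mul]⟩
  | smul z y _ hy =>
    obtain ⟨r, hr, er⟩ := hy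
    refine ⟨coneScalar q W (algebraMap ℂ _ z) * r, Subring.mul_mem _
      (coneScalar_mem_chartRing q h ρ (pull_homogNeg h (algebraMap ℂ _ z))) hr, ?_⟩
    rw [coneIncl_smul, er, mul_assoc]

theorem gen_mul_chartRing (h : IsChartPair π c W V) (ρ : Fin 4 → (holo V)ˣ) {r : conePull q W}
    (hr : r ∈ chartRing q h ρ) :
    ∃ r' ∈ chartRing q h ρ, coneGen q W (π 4) * r = r' * coneGen q W (π 4) :=
  gen_mul_dehomRing (φ := pull h) (c := chartCoeff h ρ) q (cone_isFrame q W).toQRel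
    fermatExp_self π (pull_algebraMap h) hr

theorem mul_mul_pow_of_mul_eq {R : Type*} [Ring R] {r r' s x : R} (h : x * r = r' * x) (i : ℕ) :
    s * x * (r * x ^ i) = s * r' * x ^ (i + 1) := by
  rw [mul_assoc, ← mul_assoc x, h, pow_succ', mul_assoc, mul_assoc]

/-- Each generator is an element of the chart ring times `t_{π 4}`, and `gen_mul_chartRing` moves
these factors to the right, where `N` of them accumulate. -/
theorem coneIncl_degreePart_mem (h : IsChartPair π c W V) (ρ : Fin 4 → (holo V)ˣ)
    {b : FermatAlg q} {N : ℕ} (hb : b ∈ degreePart q N) :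
    ∃ r ∈ chartRing q h ρ, coneIncl q W b = r * coneGen q W (π 4) ^ N := by
  unfold degreePart at hb
  induction hb using Submodule.pow_induction_on_left' with
  | algebraMap z =>
    refine ⟨coneScalar q W (algebraMap ℂ _ z),
      coneScalar_mem_chartRing q h ρ (pull_homogNeg h (algebraMap ℂ _ z)), ?_⟩
    rw [Algebra.algebraMap_eq_smul_one, coneIncl_smul, map_one, pow_zero]
  | add x y i _ _ hx hy =>
    obtain ⟨r, hr, er⟩ := hx
    obtain ⟨s, hs, es⟩ := hy
    exact ⟨r + s, Subring.add_mem (chartRing q h ρ) hr hs, by rw [map_add, er, es, add_mul]⟩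
  | mem_mul m hm i x hx ih =>
    obtain ⟨r, hr, er⟩ := ih
    obtain ⟨s, hs, es⟩ := coneIncl_gen_mem q h ρ hm
    obtain ⟨r', hr', er'⟩ := gen_mul_chartRing q h ρ hr
    refine ⟨s * r', Subring.mul_mem (chartRing q h ρ) hs hr', ?_⟩
    exact ((map_mul (coneIncl q W) m x).trans (congrArg₂ (· * ·) es er)).trans
      (mul_mul_pow_of_mul_eq er' i)

/-- In degree `5 n` the accumulated power of `t_{π 4}` is the scalar `x_{π 4} ^ n`. Its product with
a coefficient of degree `-n` is constant along lines, hence a function on the chart. -/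
theorem secA_le_chartRing (h : IsChartPair π c W V) (ρ : Fin 4 → (holo V)ˣ) :
    secA q W ≤ chartRing q h ρ := by
  refine Subring.closure_le.mpr ?_
  rintro _ ⟨n, f, b, hf, hb, rfl⟩
  obtain ⟨r, hr, er⟩ := coneIncl_degreePart_mem q h ρ hb
  have hfr := (cone_isFrame q W).toQRel
  have h1 : coneIncl q W b = coneScalar q W (coordVal (holo (cone W)) (π 4) ^ n) * r := by
    rw [er, pow_mul, hfr.pow, ← map_pow, hfr.central]
  rw [tmul_eq, h1, ← mul_assoc, ← map_mul]
  refine Subring.mul_mem _ (coneScalar_mem_chartRing q h ρ fun v v' t ht => ?_) hr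
  have h2 := hf v v' t ht
  rw [coordVal_holo]
  change t ^ 0 * (f.1 v' * (v'.1 : Fin 5 → ℂ) (π 4) ^ n) = f.1 v * (v.1 : Fin 5 → ℂ) (π 4) ^ n
  have h3 : (v'.1 : Fin 5 → ℂ) (π 4) = t * (v.1 : Fin 5 → ℂ) (π 4) := by rw [ht]; rfl
  rw [h3, ← h2]
  ring

/-- Functions on a chart as sections of `𝒜`. -/
noncomputable def chartScalar (h : IsChartPair π c W V) : holo V →+* secA q W :=
  (secAUnit q W).comp (pullEquiv h : holo V →+* secO W)

theorem coe_chartScalar (h : IsChartPair π c W V) (f : holo V) :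
    (chartScalar q h f : conePull q W) = coneScalar q W (pull h f) :=
  coe_secAUnit q W (pullEquiv h f)

theorem dehomGen_mem_secA (h : IsChartPair π c W V) (ρ : Fin 4 → (holo V)ˣ) (k : Fin 4) :
    dehomGen (coneScalar q W) (coneGen q W) π (chartCoeff h ρ) k ∈ secA q W := by
  have h1 : dehomGen (coneScalar q W) (coneGen q W) π (chartCoeff h ρ) k =
      chartCoeff h ρ k ⊗ₜ[S5] (gen q (π k.castSucc) * gen q (π 4) ^ 4) := by
    rw [tmul_eq, map_mul, map_pow]
    rfl
  rw [h1]
  have hg : ∀ j, gen q j ∈ Submodule.span ℂ (Set.range (gen q)) :=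
    fun j => Submodule.subset_span (Set.mem_range_self j)
  have hb : gen q (π k.castSucc) * gen q (π 4) ^ 4 ∈ degreePart q (5 * 1) := by
    rw [degreePart, show 5 * 1 = 4 + 1 from rfl, pow_succ']
    exact Submodule.mul_mem_mul (hg _) (Submodule.pow_mem_pow _ (hg _) 4)
  refine Subring.subset_closure ⟨1, _, _, fun v v' t ht => ?_, hb, rfl⟩
  have h2 := pull_homogNeg h (ρ k : holo V) v v' t ht
  rw [pow_zero, one_mul] at h2
  change t ^ 1 * ((pull h (ρ k : holo V)).1 v' * ((v'.1 : Fin 5 → ℂ) (π 4))⁻¹) =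
    (pull h (ρ k : holo V)).1 v * ((v.1 : Fin 5 → ℂ) (π 4))⁻¹
  have h3 : (v'.1 : Fin 5 → ℂ) (π 4) = t * (v.1 : Fin 5 → ℂ) (π 4) := by rw [ht]; rfl
  have ht0 : t ≠ 0 := by
    rintro rfl
    exact v'.2.1 (by rw [ht, zero_smul])
  rw [h2, h3, mul_inv]
  field_simp

/-- The generators of `𝒜` over a chart. -/
noncomputable def chartGen (h : IsChartPair π c W V) (ρ : Fin 4 → (holo V)ˣ) (k : Fin 4) :
    secA q W := ⟨_, dehomGen_mem_secA q h ρ k⟩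

/-- Over a chart, `𝒜` is a quantum algebra. -/
theorem chart_isFrame (h : IsChartPair π c W V) {ρ : Fin 4 → (holo V)ˣ} {y : Fin 4 → holo V}
    (hy : ∀ k, (ρ k : holo V) ^ 5 * affFun c V k = y k) :
    IsFrame (chiAlg q (holo V)) (chartScalar q h) (dehomExp fermatExp π) y (chartGen q h ρ) := by
  have hinj : Function.Injective (pull h) := fun f g hfg =>
    (pullEquiv h).injective (Subtype.ext hfg)
  have h1 := dehomGen_qrel q (cone_isFrame q W).toQRel fermatExp_self π (pull_algebraMap h)
    (chartCoeff_pow h hy)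
  have h2 := dehomGen_injective q (cone_isFrame q W) fermatExp_self π hinj
    (pull_inv_mul_chartCoeff h ρ)
  exact h1.isFrame_subring h2 (coe_chartScalar q h) (fun k => rfl) (secA_le_chartRing q h ρ)

end QuantumFermat

namespace QuantumFermat

/-! ### Analytic charts -/

section Chart

variable (π : Equiv.Perm (Fin 5)) (c : Fin 3 → ℂ) (Ω : Opens C3)

/-- The domain of a chart, as an open subset of the topological space `X`. -/
noncomputable abbrev chartDomain : Opens (TopCat.of X) := chartOpens π c Ω

/-- The chart as a morphism of topological spaces. -/
noncomputable def chartHom :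
    (Opens.toTopCat (TopCat.of X)).obj (chartDomain π c Ω) ⟶ TopCat.of C3 :=
  TopCat.ofHom ⟨chartMap π c Ω, (chartMap_isOpenEmbedding π c Ω).continuous⟩

theorem chartHom_isOpenEmbedding : Topology.IsOpenEmbedding (chartHom π c Ω) :=
  chartMap_isOpenEmbedding π c Ω

theorem isChartPair (V : Opens ((Opens.toTopCat (TopCat.of X)).obj (chartDomain π c Ω))) :
    IsChartPair π c ((chartDomain π c Ω).isOpenEmbedding.functor.obj V)
      ((chartHom_isOpenEmbedding π c Ω).functor.obj V) where
  ne_zero := by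
    rintro v ⟨hv, x, hx, hxv⟩
    have h : X.mk v hv ∈ chartOpens π c Ω := by
      have h' : (x.1 : X) = X.mk v hv := hxv
      rw [← h']
      exact x.2
    exact ((mk_mem_chartOpens π c hv).mp h).1
  fst := by
    rintro v ⟨hv, x, hx, hxv⟩
    exact ⟨x, hx, chartMap_mk π c x hv hxv.symm⟩
  snd := by
    rintro _ ⟨x, hx, rfl⟩
    exact ⟨chartInv_ne_zero π c _, x, hx, (mk_chartInv_chartMap π c x).symm⟩

theorem chartImage_le (V : Opens ((Opens.toTopCat (TopCat.of X)).obj (chartDomain π c Ω))) :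
    (chartHom_isOpenEmbedding π c Ω).functor.obj V ≤ Ω := by
  rintro _ ⟨x, hx, rfl⟩
  exact x.2.2

/-- The analytic chart given by affine coordinates. -/
noncomputable def analyticChart {p : X} (hp : p ∈ chartOpens π c Ω)
    (h0 : chartFun π c p.coord = 0) : AnalyticChart p where
  U := chartDomain π c Ω
  mem := hp
  map := chartHom π c Ω
  isOpenEmbedding := chartHom_isOpenEmbedding π c Ω
  map_center := h0
  comorphism := NatIso.ofComponents
    (fun V => (pullEquiv (isChartPair π c Ω V.unop)).toRingCatIso) fun _ => rfl
  comorphism_apply V f v x hx hvx := by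
    have h : chartMap π c Ω x = chartFun π c v.1 := chartMap_mk π c x v.2.1 hvx
    exact congrArg f.1 (Subtype.ext h.symm)

end Chart

/-! ### The local isomorphisms -/

section LocalIso

variable (q : ℂ) [Fact (IsPrimitiveRoot q 5)] {π : Equiv.Perm (Fin 5)} {c : Fin 3 → ℂ}
  {W W₁ W₂ : Opens X} {V V₁ V₂ : Opens C3}

theorem secARes_chartScalar (h₁ : IsChartPair π c W₁ V₁) (h₂ : IsChartPair π c W₂ V₂)
    (hW : W₁ ≤ W₂) (hV : V₁ ≤ V₂) (f : holo V₂) :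
    secARes q hW (chartScalar q h₂ f) = chartScalar q h₁ (holoRes hV f) :=
  Subtype.ext ((coe_secARes q hW (chartScalar q h₂ f)).trans
    ((congrArg (coneRes q hW) (coe_chartScalar q h₂ f)).trans
      ((coneRes_scalar q hW (pull h₂ f)).trans (coe_chartScalar q h₁ (holoRes hV f)).symm)))

theorem map_dehomGen {A A' R R' : Type*} [CommRing A] [CommRing A'] [Ring R] [Ring R']
    {β : A →+* R} {β' : A' →+* R'} {T : Fin 5 → R} {T' : Fin 5 → R'} (f : R →+* R') (φ : A → A')
    (hβ : ∀ a, f (β a) = β' (φ a)) (hT : ∀ k, f (T k) = T' k) (π : Equiv.Perm (Fin 5))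
    (c : Fin 4 → A) (k : Fin 4) :
    f (dehomGen β T π c k) = dehomGen β' T' π (fun k => φ (c k)) k := by
  simp only [dehomGen, map_mul, map_pow, hβ, hT]

theorem chartCoeff_res (h₁ : IsChartPair π c W₁ V₁) (h₂ : IsChartPair π c W₂ V₂)
    (hW : W₁ ≤ W₂) (hV : V₁ ≤ V₂) {ρ₁ : Fin 4 → (holo V₁)ˣ} {ρ₂ : Fin 4 → (holo V₂)ˣ}
    (hρ : ∀ k, (ρ₁ k : holo V₁) = holoRes hV (ρ₂ k)) (k : Fin 4) :
    holoResH (cone_mono hW) (chartCoeff h₂ ρ₂ k) = chartCoeff h₁ ρ₁ k := by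
  rw [chartCoeff, chartCoeff, hρ]
  rfl

theorem coneRes_gen (hW : W₁ ≤ W₂) (k : Fin 5) :
    coneRes q hW (coneGen q W₂ k) = coneGen q W₁ k := coneRes_incl q hW (gen q k)

theorem coneRes_dehomGen (hW : W₁ ≤ W₂) (b : Fin 4 → holo (cone W₂)) (k : Fin 4) :
    coneRes q hW (dehomGen (coneScalar q W₂) (coneGen q W₂) π b k) =
      dehomGen (coneScalar q W₁) (coneGen q W₁) π (fun k => holoResH (cone_mono hW) (b k)) k :=
  map_dehomGen (coneRes q hW) _ (coneRes_scalar q hW) (coneRes_gen q hW) π b k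

theorem coe_chartGen (h : IsChartPair π c W V) (ρ : Fin 4 → (holo V)ˣ) (k : Fin 4) :
    (chartGen q h ρ k : conePull q W) =
      dehomGen (coneScalar q W) (coneGen q W) π (chartCoeff h ρ) k := rfl

theorem secARes_chartGen (h₁ : IsChartPair π c W₁ V₁) (h₂ : IsChartPair π c W₂ V₂)
    (hW : W₁ ≤ W₂) (hV : V₁ ≤ V₂) {ρ₁ : Fin 4 → (holo V₁)ˣ} {ρ₂ : Fin 4 → (holo V₂)ˣ}
    (hρ : ∀ k, (ρ₁ k : holo V₁) = holoRes hV (ρ₂ k)) (k : Fin 4) :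
    secARes q hW (chartGen q h₂ ρ₂ k) = chartGen q h₁ ρ₁ k := by
  refine Subtype.ext ?_
  rw [coe_secARes, coe_chartGen, coe_chartGen, coneRes_dehomGen]
  exact congrArg (fun b => dehomGen (coneScalar q W₁) (coneGen q W₁) π b k)
    (funext (chartCoeff_res h₁ h₂ hW hV hρ))

variable {D : AlgCat.{0} P} {y : Fin 4 → P} {s : Fin 4 → D}

noncomputable instance (D : AlgCat.{0} P) (V : Opens C3) : Ring (holo V ⊗[P] D) := inferInstance

noncomputable instance (D : AlgCat.{0} P) (V : Opens C3) : NonAssocSemiring (holo V ⊗[P] D) :=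
  Semiring.toNonAssocSemiring (self := Ring.toSemiring)

/-- Naturality of the isomorphisms between framed algebras. -/
theorem frameEquiv_natural {A A' R R' S S' : Type*} [CommRing A] [CommRing A'] [Ring R] [Ring R']
    [Ring S] [Ring S'] {n : ℕ} {κ : AddChar (ZMod 5) A} {κ' : AddChar (ZMod 5) A'}
    {N : Fin n → Fin n → ZMod 5} {y : Fin n → A} {y' : Fin n → A'} {α : A →+* R} {β : A →+* S}
    {α' : A' →+* R'} {β' : A' →+* S'} {s : Fin n → R} {t : Fin n → S} {s' : Fin n → R'}
    {t' : Fin n → S'} (hs : IsFrame κ α N y s) (ht : IsFrame κ β N y t)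
    (hs' : IsFrame κ' α' N y' s') (ht' : IsFrame κ' β' N y' t') (f : R →+* R') (g : S →+* S')
    (φ : A → A') (hα : ∀ a, f (α a) = α' (φ a)) (hf : ∀ i, f (s i) = s' i)
    (hβ : ∀ a, g (β a) = β' (φ a)) (hg : ∀ i, g (t i) = t' i) (r : R) :
    frameEquiv hs' ht' (f r) = g (frameEquiv hs ht r) := by
  have h : (frameEquiv hs' ht' : R' →+* S').comp f = g.comp (frameEquiv hs ht : R →+* S) := by
    refine frame_hom_ext hs.bij.2 (fun a => ?_) fun i => ?_
    · change frameEquiv hs' ht' (f (α a)) = g (frameEquiv hs ht (α a))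
      rw [hα, frameEquiv_scalar, frameEquiv_scalar, hβ]
    · change frameEquiv hs' ht' (f (s i)) = g (frameEquiv hs ht (s i))
      rw [hf, frameEquiv_gen, frameEquiv_gen, hg]
  exact RingHom.congr_fun h r

/-- The isomorphism between the sections of `𝒜` over a chart and those of a sheaf associated with
a framed algebra. -/
noncomputable def localEquiv (h : IsChartPair π c W V) {ρ : Fin 4 → (holo V)ˣ}
    (hy : ∀ k, (ρ k : holo V) ^ 5 * affFun c V k = algebraMap P (holo V) (y k))
    (hs : IsFrame (chiAlg q P) (algebraMap P D) (dehomExp fermatExp π) y s) :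
    secA q W ≃+* holo V ⊗[P] D :=
  frameEquiv (chart_isFrame q h hy) (hs.baseChange q (A := holo V))

theorem localEquiv_chartScalar (h : IsChartPair π c W V) {ρ : Fin 4 → (holo V)ˣ}
    (hy : ∀ k, (ρ k : holo V) ^ 5 * affFun c V k = algebraMap P (holo V) (y k))
    (hs : IsFrame (chiAlg q P) (algebraMap P D) (dehomExp fermatExp π) y s) (f : holo V) :
    localEquiv q h hy hs (chartScalar q h f) = f ⊗ₜ 1 :=
  frameEquiv_scalar _ _ _

/-- Restriction of sections of an associated sheaf. -/
noncomputable def assocRes (D : AlgCat.{0} P) (hV : V₁ ≤ V₂) : holo V₂ ⊗[P] D →+* holo V₁ ⊗[P] D :=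
  (Algebra.TensorProduct.map (holoResC3 hV) (AlgHom.id P D)).toRingHom

theorem assocRes_tmul (hV : V₁ ≤ V₂) (f : holo V₂) (d : D) :
    assocRes D hV (f ⊗ₜ d) = holoRes hV f ⊗ₜ d := Algebra.TensorProduct.map_tmul _ _ _ _

theorem localEquiv_res (h₁ : IsChartPair π c W₁ V₁) (h₂ : IsChartPair π c W₂ V₂)
    (hW : W₁ ≤ W₂) (hV : V₁ ≤ V₂) {ρ₁ : Fin 4 → (holo V₁)ˣ} {ρ₂ : Fin 4 → (holo V₂)ˣ}
    (hρ : ∀ k, (ρ₁ k : holo V₁) = holoRes hV (ρ₂ k))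
    (hy₁ : ∀ k, (ρ₁ k : holo V₁) ^ 5 * affFun c V₁ k = algebraMap P (holo V₁) (y k))
    (hy₂ : ∀ k, (ρ₂ k : holo V₂) ^ 5 * affFun c V₂ k = algebraMap P (holo V₂) (y k))
    (hs : IsFrame (chiAlg q P) (algebraMap P D) (dehomExp fermatExp π) y s) (r : secA q W₂) :
    localEquiv q h₁ hy₁ hs (secARes q hW r) = assocRes D hV (localEquiv q h₂ hy₂ hs r) :=
  frameEquiv_natural (chart_isFrame q h₂ hy₂) (hs.baseChange q (A := holo V₂))
    (chart_isFrame q h₁ hy₁) (hs.baseChange q (A := holo V₁)) (secARes q hW) (assocRes D hV)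
    (holoRes hV) (secARes_chartScalar q h₁ h₂ hW hV) (secARes_chartGen q h₁ h₂ hW hV hρ)
    (fun f => assocRes_tmul hV f 1)
    (fun k => (assocRes_tmul hV 1 (s k)).trans (congrArg (· ⊗ₜ s k) (map_one (holoRes hV)))) r

/-- Restriction of invertible functions. -/
noncomputable def resUnits (hV : V₁ ≤ V₂) (ρ : Fin 4 → (holo V₂)ˣ) (k : Fin 4) : (holo V₁)ˣ :=
  Units.map (holoRes hV : holo V₂ →* holo V₁) (ρ k)

theorem resUnits_pow (hV : V₁ ≤ V₂) {ρ : Fin 4 → (holo V₂)ˣ}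
    (hy : ∀ k, (ρ k : holo V₂) ^ 5 * affFun c V₂ k = algebraMap P (holo V₂) (y k)) (k : Fin 4) :
    (resUnits hV ρ k : holo V₁) ^ 5 * affFun c V₁ k = algebraMap P (holo V₁) (y k) := by
  rw [← (holoResC3 hV).commutes, ← hy, map_mul, map_pow]
  rfl

/-- A local isomorphism between `𝒜` and a sheaf `J_(i)`. -/
noncomputable def localIso {i : Fin 4} {Ω : Opens C3} {ρ : Fin 4 → (holo Ω)ˣ}
    (hy : ∀ k, (ρ k : holo Ω) ^ 5 * affFun c Ω k = algebraMap P (holo Ω) (y k))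
    {s : Fin 4 → localModel q i}
    (hs : IsFrame (chiAlg q P) (algebraMap P (localModel q i)) (dehomExp fermatExp π) y s)
    {p : X} (hp : p ∈ chartOpens π c Ω) (h0 : chartFun π c p.coord = 0) :
    LocalIso q i (analyticChart π c Ω hp h0) where
  iso := NatIso.ofComponents
    (fun V => (localEquiv q (isChartPair π c Ω V.unop)
      (resUnits_pow (chartImage_le π c Ω V.unop) hy) hs).toRingCatIso)
    fun {V₁ V₂} f => by
      refine RingCat.hom_ext (RingHom.ext ?_)
      exact localEquiv_res q (isChartPair π c Ω V₂.unop) (isChartPair π c Ω V₁.unop)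
        (leOfHom ((chartDomain π c Ω).isOpenEmbedding.functor.map f.unop))
        (leOfHom ((chartHom_isOpenEmbedding π c Ω).functor.map f.unop)) (fun k => rfl)
        (resUnits_pow (chartImage_le π c Ω V₂.unop) hy)
        (resUnits_pow (chartImage_le π c Ω V₁.unop) hy) hs
  linear := by
    ext V : 2
    refine RingCat.hom_ext (RingHom.ext fun f => ?_)
    exact localEquiv_chartScalar q (isChartPair π c Ω V.unop)
      (resUnits_pow (chartImage_le π c Ω V.unop) hy) hs f

end LocalIso

/-! ### Charts adapted to the strata -/

/-- Coordinates that are nonzero at `p` stay nonzero on the chart, because the slit plane omits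
zero. A point of the chart therefore lies in the stratum of `p` exactly when it has no further
nonzero coordinates, that is, when the affine coordinates that vanish at `p` vanish there too. -/
theorem mem_stratum_iff {π : Equiv.Perm (Fin 5)} {c : Fin 3 → ℂ} {i : Fin 4} {p : X}
    (hp : p ∈ stratum i) (hp4 : p.coord (π 4) ≠ 0) (hp0 : p.coord (π 0) ≠ 0)
    (hpj : ∀ j : Fin 3, p.coord (π j.succ.castSucc) ≠ 0 ↔ (j : ℕ) < i)
    (hc : ∀ j : Fin 3, c j ≠ 0 ↔ (j : ℕ) < i) (hc0 : affCoord c 0 0 ≠ 0)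
    (x : chartOpens π c (rootOpens c)) :
    (x : X) ∈ stratum i ↔ ∀ k : Fin 3, (i : ℕ) ≤ k → chartMap π c _ x k = 0 := by
  have haff : ∀ k : Fin 4, affCoord c (chartMap π c _ x) k =
      x.1.coord (π k.castSucc) / x.1.coord (π 4) :=
    affCoord_chartFun π c x.1.sum_coord x.2.1
  have hne : ∀ k : Fin 4, affCoord c 0 k ≠ 0 → x.1.coord (π k.castSucc) ≠ 0 := by
    intro k hk h
    have h1 := Complex.slitPlane_ne_zero (mem_rootOpens.mp x.2.2 k hk)
    have h2 := haff k
    rw [h, zero_div] at h2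
    exact h1 (by rw [show affCoord c (chartFun π c x.1.coord) k = 0 from h2, zero_div])
  have hsub : {k | p.coord k ≠ 0} ⊆ {k | x.1.coord k ≠ 0} := by
    intro k hk
    obtain ⟨l, rfl⟩ := π.surjective k
    refine Fin.lastCases (fun _ => x.2.1) (fun l hk => ?_) l hk
    refine Fin.cases (fun _ => hne 0 hc0) (fun j hk => ?_) l hk
    refine hne j.succ ?_
    rw [affCoord_succ, Pi.zero_apply, zero_add]
    exact (hc j).mpr ((hpj j).mp hk)
  have hp' : {k | p.coord k ≠ 0}.ncard = (i : ℕ) + 2 := hp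
  constructor
  · intro hx k hk
    -- The nonvanishing set can only grow near `p`; equal cardinality forces it to be the same.
    have heq := Set.eq_of_subset_of_ncard_le hsub (by rw [hp']; exact le_of_eq hx) (Set.toFinite _)
    have h1 : ¬ x.1.coord (π k.succ.castSucc) ≠ 0 := fun h => by
      have h2 : π k.succ.castSucc ∈ {k | p.coord k ≠ 0} := heq ▸ h
      have := (hpj k).mp h2
      omega
    have h2 := haff k.succ
    have hck : c k = 0 := by
      by_contra h
      have := (hc k).mp h
      omega
    rwa [not_not.mp h1, zero_div, affCoord_succ, hck, add_zero] at h2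
  · intro h
    have heq : {k | p.coord k ≠ 0} = {k | x.1.coord k ≠ 0} := by
      refine Set.Subset.antisymm hsub fun k hk => ?_
      obtain ⟨l, rfl⟩ := π.surjective k
      refine Fin.lastCases (fun _ => hp4) (fun l hk => ?_) l hk
      refine Fin.cases (fun _ => hp0) (fun j hk => (hpj j).mpr ?_) l hk
      by_contra hj
      refine hk ?_
      have hcj : c j = 0 := by
        by_contra h
        exact hj ((hc j).mp h)
      have h2 := haff j.succ
      rw [affCoord_succ, hcj, add_zero, h j (not_lt.mp hj), eq_comm, div_eq_zero_iff] at h2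
      exact h2.resolve_right x.2.1
    change {k | x.1.coord k ≠ 0}.ncard = _
    rw [← heq, hp']

theorem exists_localIso (q : ℂ) [Fact (IsPrimitiveRoot q 5)] (i : Fin 4) (p : X)
    (hp : p ∈ stratum i) : ∃ φ : AnalyticChart p, Nonempty (LocalIso q i φ) ∧
      ∀ x : φ.U, (x : X) ∈ stratum i ↔
        ∀ k : Fin 3, (i : ℕ) ≤ (k : ℕ) → (φ.map x : C3) k = 0 := by
  classical
  obtain ⟨π, h4, h0, hj, hgood⟩ := exists_order i {k : Fin 5 | p.coord k ≠ 0}.toFinset (by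
    rw [← Set.ncard_eq_toFinset_card']
    exact hp)
  simp only [Set.mem_toFinset, Set.mem_ofPred_eq] at h4 h0 hj
  -- The affine coordinates of `p` itself, so that `p` becomes the origin and the components for
  -- vanishing coordinates need no translation.
  let c : Fin 3 → ℂ := fun j => p.coord (π j.succ.castSucc) / p.coord (π 4)
  have hc : ∀ j : Fin 3, c j ≠ 0 ↔ (j : ℕ) < i := by
    intro j
    rw [← hj]
    exact (div_ne_zero_iff.trans (and_iff_left h4))
  have hz : chartFun π c p.coord = 0 := funext fun j => sub_self _
  have hc0 : affCoord c 0 0 ≠ 0 := by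
    rw [← hz, affCoord_chartFun π c p.sum_coord h4]
    exact div_ne_zero h0 h4
  obtain ⟨ρ, hρ⟩ := exists_units hc0 hc
  obtain ⟨s, hs⟩ := exists_localModel_frame q (dehomExp_self fermatExp_self fermatExp_swap π)
    (dehomExp_swap fermatExp_swap π) hgood
  have hpU : p ∈ chartOpens π c (rootOpens c) := ⟨h4, by rw [hz]; exact zero_mem_rootOpens c⟩
  exact ⟨analyticChart π c _ hpU hz, ⟨localIso q hρ hs hpU hz⟩,
    mem_stratum_iff hp h4 h0 hj hc hc0⟩

end QuantumFermat

theorem mainTheorem4 (q : ℂ) [Fact (IsPrimitiveRoot q 5)] :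
    -- `𝒜` and the `J_(i)` are sheaves
    (QuantumFermat.sheafA q).IsSheaf ∧
    (∀ i : Fin 4, (QuantumFermat.sheafJ q i).IsSheaf) ∧
    -- the strata `X_(i)` are locally closed and partition `X`
    (∀ i : Fin 4, IsLocallyClosed (QuantumFermat.stratum i)) ∧
    (∀ p : QuantumFermat.X, ∃! i : Fin 4, p ∈ QuantumFermat.stratum i) ∧
    -- every point of `X_(i)` has a chart `φ : U → ℂ³` with `𝒜|_U ≅ J_(i)|_U`, in which `X_(i)`
    -- is the locus where the last `3 - i` coordinates vanish
    (∀ (i : Fin 4), ∀ p ∈ QuantumFermat.stratum i,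
      ∃ φ : QuantumFermat.AnalyticChart p,
        Nonempty (QuantumFermat.LocalIso q i φ) ∧
        ∀ x : φ.U, (x : QuantumFermat.X) ∈ QuantumFermat.stratum i ↔
          ∀ k : Fin 3, (i : ℕ) ≤ (k : ℕ) → (φ.map x : QuantumFermat.C3) k = 0) ∧
    -- `J_(1)`, `J_(2)`, `J_(3)` are Morita equivalent to `1`, `5`, `25` copies of `ℂ[x, y, z]`
    IsMoritaEquivalent ℂ QuantumFermat.J1 QuantumFermat.P ∧
    IsMoritaEquivalent ℂ QuantumFermat.J2 (Fin 5 → QuantumFermat.P) ∧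
    IsMoritaEquivalent ℂ QuantumFermat.J3 (Fin 25 → QuantumFermat.P) := by
  exact ⟨QuantumFermat.sheafA_isSheaf q, QuantumFermat.sheafJ_isSheaf q,
    QuantumFermat.stratum_isLocallyClosed, QuantumFermat.existsUnique_stratum,
    QuantumFermat.exists_localIso q, QuantumFermat.morita_J1, QuantumFermat.morita_J2,
    QuantumFermat.morita_J3⟩
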